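/- **Setting.** Let $U$ be a unitary $m\times m$ matrix ($U_{ij}$ is the amplitude from input mode $j$ to output mode $i$), and let single photons enter in $n\ge 1$ distinct input modes $c_1<\dots<c_n$. The Boson Sampling distribution on output occupation vectors $n'=(n'_1,\dots,n'_m)$ with $\sum_i n'_i=n$ is $$\Pr[n']=\frac{|\operatorname{per} V|^2}{\prod_{i=1}^m n'_i!},\qquad V_{l,h}=U_{z'_l,c_h},$$ where $z'_1\le\dots\le z'_n$ lists the output modes with the multiplicities $n'_i$. An outcome is collision-free if all $n'_i\le 1$. A *nearest-neighbour interferometer of depth $D$* is $U=L_D L_{D-1}\cdots L_1$, where $L_1,L_3,\dots$ are of the form $B\oplus\cdots\oplus B\,(\oplus 1)$ and $L_2,L_4,\dots$ of the form $1\oplus B\oplus\cdots\oplus B\,(\oplus 1)$ (the last $1$ is present only if the size $m$ requires it), and each $B$ is a beamsplitter $\begin{pmatrix} e^{i\phi_T}\cos\theta & e^{i\phi_R}\sin\theta\\ -e^{-i\phi_R}\sin\theta & e^{-i\phi_T}\cos\theta\end{pmatrix}$ with its own angles. A *linear tree decomposition* of the bipartite graph of $U$ (vertices: rows and columns; edges: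 nonzero entries) is a tree decomposition whose tree is a path $t_1\to\dots\to t_m$ rooted in $t_1$, where $t_j$ contains the single column $j$ and a set $\rho(t_j)$ of rows. Its treewidth is $\omega=\max_j(|\rho(t_j)|+1)-1$. The machine model is a probabilistic random access machine with unit-cost operations: addition, truncated subtraction and halving of natural numbers, exact arithmetic on complex numbers, indirect addressing, and coin tosses with a computed bias. An outcome is written out as the list of the $n$ modes in which photons are detected. A program *samples collision-free outcomes exactly* if it returns each collision-free outcome $n'$ with probability exactly $\Pr[n']$, and otherwise reports that a collision has occurred, which happens with probability exactly $\sum_{n'\text{ with a collision}}\Pr[n']$. (So, conditioned on no collision being reported, the sample follows the Boson Sampling distribution conditioned on no collision.) **Theorem.** There is an absolute constant $C$ such that the following hold. 1. There is one program that, for all $m$, $n\ge1$, unitary $U$, occupied input modes $c_1<\dots<c_n$, and every linear tree decomposition of the graph of $U$ (its input is $n$, $m$, the list $c$, random access to $U$, and the lists of rows in the nodes of the occupied columns), samples collision-free outcomes exactly, and every run takes at most $C\,(n^2 2^\omega\omega^2+\omega n^3)$ steps, where $\omega$ is the treewidth of the given decomposition. 2. There is one program, whose input is $n$, $m$, $D$,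 the list $c$ and random access to $U$, such that for all $m\ge1$, $D\ge1$ and every nearest-neighbour interferometer $U$ of depth $D$ on $m$ modes there is a linear tree decomposition of the graph of $U$ of treewidth $\omega\le 2D$ for which, for all $n\ge1$ and all occupied input modes $c_1<\dots<c_n$, the program samples collision-free outcomes exactly and every run takes at most $C\,(n^2 2^\omega\omega^2+\omega n^3)$ steps. In particular this program runs in polynomial time for $D=O(\log m)$: for every $\gamma$ there is a polynomial $p$ such that, whenever $1\le D\le\gamma\log m$, every run takes at most $p(m)$ steps. -/

import Mathlib

namespace BosonSampling

/-! ### Nearest-neighbour interferometers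

Modes are numbered from `0`.  A matrix entry `U i j` is the transition amplitude from input
mode `j` to output mode `i`. -/

/-- The universal beamsplitter with coupling angle `θ`, transmitted phase `φT` and reflected
phase `φR`. -/
noncomputable def beamsplitter (θ φT φR : ℝ) : Matrix (Fin 2) (Fin 2) ℂ :=
  !![Complex.exp (Complex.I * φT) * Real.cos θ, Complex.exp (Complex.I * φR) * Real.sin θ;
     -(Complex.exp (-(Complex.I * φR)) * Real.sin θ), Complex.exp (-(Complex.I * φT)) * Real.cos θ]

/-- The angles of the beamsplitters of one layer; the beamsplitter coupling the modes `a` and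
`a + 1` uses the angles of index `a`. -/
structure LayerAngles where
  θ : ℕ → ℝ
  φT : ℕ → ℝ
  φR : ℕ → ℝ

/-- One layer of beamsplitters on `m` modes: there is a beamsplitter on every pair of modes
`(a, a + 1)` with `a + 1 < m` and `a` of the parity of `p`; the modes that belong to no pair are
left alone.  So `p = 0` is the layer `B ⊕ ⋯ ⊕ B (⊕ 1)`, with the final `1` for odd `m`, and
`p = 1` is the layer `1 ⊕ B ⊕ ⋯ ⊕ B (⊕ 1)`, with the final `1` for even `m`. -/
noncomputable def layer (m p : ℕ) (ψ : LayerAngles) : Matrix (Fin m) (Fin m) ℂ := fun i j =>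
  if (i : ℕ) % 2 = p % 2 ∧ (i : ℕ) + 1 < m then
    -- `i` is the first mode of its beamsplitter
    if j = i then beamsplitter (ψ.θ i) (ψ.φT i) (ψ.φR i) 0 0
    else if (j : ℕ) = i + 1 then beamsplitter (ψ.θ i) (ψ.φT i) (ψ.φR i) 0 1
    else 0
  else if 1 ≤ (i : ℕ) ∧ ((i : ℕ) - 1) % 2 = p % 2 then
    -- `i` is the second mode of its beamsplitter
    if (j : ℕ) + 1 = i then beamsplitter (ψ.θ j) (ψ.φT j) (ψ.φR j) 1 0
    else if j = i then
      beamsplitter (ψ.θ ((i : ℕ) - 1)) (ψ.φT ((i : ℕ) - 1)) (ψ.φR ((i : ℕ) - 1)) 1 1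
    else 0
  else if j = i then 1 else 0

/-- The unitary of the interferometer of depth `D`: the product of `D` alternating layers, the
first one (applied first, rightmost in the product) being of type `0`. -/
noncomputable def circuit (m : ℕ) (Ψ : ℕ → LayerAngles) : ℕ → Matrix (Fin m) (Fin m) ℂ
  | 0 => 1
  | D + 1 => layer m (D % 2) (Ψ D) * circuit m Ψ D

/-! ### Boson Sampling -/

/-- The occupation vector of a list of modes: the number of photons in each mode. -/
def occupation {m n : ℕ} (r : Fin n → Fin m) (i : Fin m) : ℕ :=
  (Finset.univ.filter (fun l => r l = i)).card

/-- The Boson Sampling probability of the output occupation vector of the list `r` of output modes,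
for the input occupation vector of the list `c` of input modes:
`|per V|² / ∏ᵢ nᵢ! n'ᵢ!`, where `V l h = U (r l) (c h)`.  It does not depend on the
order of the two lists. -/
noncomputable def outcomeProb {m n : ℕ} (U : Matrix (Fin m) (Fin m) ℂ) (c r : Fin n → Fin m) : ℝ :=
  ‖(U.submatrix r c).permanent‖ ^ 2 /
    ∏ i : Fin m, ((occupation c i).factorial * (occupation r i).factorial : ℝ)

/-! ### Tree decompositions -/

/-- A tree decomposition, with nodes `ι`, of the bipartite graph of a matrix `M`; its vertices are
the rows and the columns of `M`, its edges are the nonzero entries of `M`. -/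
structure TreeDecomposition {R C : Type*} (M : Matrix R C ℂ) (ι : Type*) where
  tree : SimpleGraph ι
  isTree : tree.IsTree
  root : ι
  rho : ι → Finset R
  kappa : ι → Finset C
  rows_covered : ∀ r, ∃ t, r ∈ rho t
  cols_covered : ∀ c, ∃ t, c ∈ kappa t
  edges_covered : ∀ r c, M r c ≠ 0 → ∃ t, r ∈ rho t ∧ c ∈ kappa t
  rows_connected : ∀ r, (tree.induce {t | r ∈ rho t}).Connected
  cols_connected : ∀ c, (tree.induce {t | c ∈ kappa t}).Connected

/-- The treewidth of a tree decomposition: the size of the largest node, minus one. -/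
def TreeDecomposition.treewidth {R C ι : Type*} [Fintype ι] {M : Matrix R C ℂ}
    (T : TreeDecomposition M ι) : ℕ :=
  (Finset.univ.sup fun t => (T.rho t).card + (T.kappa t).card) - 1

/-- A linear tree decomposition with one node per column: the tree is the path
`t₀ → t₁ → ⋯ → t_{m-1}` rooted in `t₀`, and `t_j` contains the single column `j`. -/
def TreeDecomposition.IsLinear {m : ℕ} {R : Type*} {M : Matrix R (Fin m) ℂ}
    (T : TreeDecomposition M (Fin m)) : Prop :=
  T.tree = SimpleGraph.pathGraph m ∧ (T.root : ℕ) = 0 ∧ ∀ j, T.kappa j = {j}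

/-! ### The machine model

A probabilistic random access machine with exact complex arithmetic.  A state consists of
registers holding natural numbers, of two-dimensional arrays of natural numbers, and of
two-dimensional arrays of complex numbers; registers and arrays are named by numerals that are
fixed in the program text, the indices into arrays are computed.  On natural numbers there
are addition, truncated subtraction and halving, but no multiplication.  A complex number can
only be combined arithmetically with others or serve as the bias of a coin; its digits cannot be
inspected, and the only constants are natural numbers. -/

/-- A state of the machine. -/
structure State where
  reg : ℕ → ℕ
  nat : ℕ → ℕ → ℕ → ℕ
  cpx : ℕ → ℕ → ℕ → ℂ

/-- Write the value `x` to register `v`. -/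
def State.setReg (s : State) (v x : ℕ) : State :=
  { s with reg := fun v' => if v' = v then x else s.reg v' }

/-- Write the value `x` to entry `(i, j)` of the array `a` of natural numbers. -/
def State.setNat (s : State) (a i j x : ℕ) : State :=
  { s with nat := fun a' i' j' => if a' = a ∧ i' = i ∧ j' = j then x else s.nat a' i' j' }

/-- Write the value `x` to entry `(i, j)` of the array `a` of complex numbers. -/
noncomputable def State.setCpx (s : State) (a i j : ℕ) (x : ℂ) : State :=
  { s with cpx := fun a' i' j' => if a' = a ∧ i' = i ∧ j' = j then x else s.cpx a' i' j' }

/-- Expressions for natural numbers. -/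
inductive NatExp where
  | const (k : ℕ)
  | reg (v : ℕ)
  | read (a : ℕ) (i j : NatExp)
  | add (x y : NatExp)
  | sub (x y : NatExp)
  | half (x : NatExp)

def NatExp.eval (s : State) : NatExp → ℕ
  | const k => k
  | reg v => s.reg v
  | read a i j => s.nat a (i.eval s) (j.eval s)
  | add x y => x.eval s + y.eval s
  | sub x y => x.eval s - y.eval s
  | half x => x.eval s / 2

/-- The number of steps that the evaluation of an expression takes. -/
def NatExp.cost : NatExp → ℕ
  | const _ => 1
  | reg _ => 1
  | read _ i j => i.cost + j.cost + 1
  | add x y => x.cost + y.cost + 1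
  | sub x y => x.cost + y.cost + 1
  | half x => x.cost + 1

/-- Expressions for complex numbers. -/
inductive CpxExp where
  | ofNat (x : NatExp)
  | read (a : ℕ) (i j : NatExp)
  | add (x y : CpxExp)
  | sub (x y : CpxExp)
  | mul (x y : CpxExp)
  | div (x y : CpxExp)
  | conj (x : CpxExp)

noncomputable def CpxExp.eval (s : State) : CpxExp → ℂ
  | ofNat x => (x.eval s : ℂ)
  | read a i j => s.cpx a (i.eval s) (j.eval s)
  | add x y => x.eval s + y.eval s
  | sub x y => x.eval s - y.eval s
  | mul x y => x.eval s * y.eval s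
  | div x y => x.eval s / y.eval s
  | conj x => starRingEnd ℂ (x.eval s)

/-- The number of steps that the evaluation of an expression takes. -/
def CpxExp.cost : CpxExp → ℕ
  | ofNat x => x.cost + 1
  | read _ i j => i.cost + j.cost + 1
  | add x y => x.cost + y.cost + 1
  | sub x y => x.cost + y.cost + 1
  | mul x y => x.cost + y.cost + 1
  | div x y => x.cost + y.cost + 1
  | conj x => x.cost + 1

/-- Programs. -/
inductive Program where
  | skip
  /-- `reg v := e` -/
  | setReg (v : ℕ) (e : NatExp)
  /-- `nat a (i, j) := e` -/
  | setNat (a : ℕ) (i j e : NatExp)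
  /-- `cpx a (i, j) := e` -/
  | setCpx (a : ℕ) (i j : NatExp) (e : CpxExp)
  /-- toss a fresh coin: `reg v := 1` with probability `e`, and `reg v := 0` otherwise -/
  | coin (v : ℕ) (e : CpxExp)
  | seq (p q : Program)
  /-- `if e = 0 then p else q` -/
  | ifZero (e : NatExp) (p q : Program)
  /-- `for v = 0, …, e - 1 do p`, where `e` is evaluated once, before the first round -/
  | loop (v : ℕ) (e : NatExp) (p : Program)

/-- A coin that shows `true` with probability `x`, clamped to `[0, 1]`. -/
noncomputable def coinToss (x : ℝ) : PMF Bool :=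
  PMF.ofFintype
    (fun b => cond b (ENNReal.ofReal (max 0 (min 1 x))) (ENNReal.ofReal (1 - max 0 (min 1 x)))) <| by
      rw [Fintype.sum_bool, cond_true, cond_false, ← ENNReal.ofReal_add (le_max_left _ _)]
      · simp
      · exact sub_nonneg.2 (max_le zero_le_one (min_le_left _ _))

/-- The first `N` rounds of a loop with counter `v` and body `f`, starting in state `s`: the law of
the state and of the number of steps taken.  Each round costs one step more than its body. -/
noncomputable def loopRounds (f : State → PMF (State × ℕ)) (v : ℕ) (s : State) :
    ℕ → PMF (State × ℕ)
  | 0 => PMF.pure (s, 0)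
  | N + 1 => (loopRounds f v s N).bind fun x =>
      (f (x.1.setReg v N)).map fun y => (y.1, x.2 + y.2 + 1)

/-- The semantics of programs: the joint law of the final state and of the number of steps taken,
for the initial state `s`. -/
noncomputable def Program.exec : Program → State → PMF (State × ℕ)
  | skip, s => PMF.pure (s, 1)
  | setReg v e, s => PMF.pure (s.setReg v (e.eval s), e.cost + 1)
  | setNat a i j e, s =>
      PMF.pure (s.setNat a (i.eval s) (j.eval s) (e.eval s), i.cost + j.cost + e.cost + 1)
  | setCpx a i j e, s =>
      PMF.pure (s.setCpx a (i.eval s) (j.eval s) (e.eval s), i.cost + j.cost + e.cost + 1)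
  | coin v e, s =>
      (coinToss (e.eval s).re).map fun b => (s.setReg v (if b then 1 else 0), e.cost + 1)
  | seq p q, s => (p.exec s).bind fun x => (q.exec x.1).map fun y => (y.1, x.2 + y.2)
  | ifZero e p q, s =>
      (if e.eval s = 0 then p.exec s else q.exec s).map fun x => (x.1, e.cost + x.2 + 1)
  | loop v e p, s =>
      (loopRounds p.exec v s (e.eval s)).map fun x => (x.1, e.cost + x.2 + 1)

/-- Every run of the program from the state `s` takes at most `t` steps. -/
def Program.RunsInTime (A : Program) (s : State) (t : ℕ) : Prop :=
  ∀ x ∈ (A.exec s).support, x.2 ≤ t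

/-! ### Input, output and the sampling task -/

/-- The input for a circuit: register `0` holds the number `n` of photons, register `1` the
number `m` of modes, register `2` the depth `D`; the array `0` of natural numbers holds the list
`c` of occupied input modes, and the array `0` of complex numbers holds the matrix `U`. -/
noncomputable def circuitInput {m n : ℕ} (D : ℕ) (U : Matrix (Fin m) (Fin m) ℂ)
    (c : Fin n → Fin m) : State where
  reg v := if v = 0 then n else if v = 1 then m else if v = 2 then D else 0
  nat a i j := if h : a = 0 ∧ i < n ∧ j = 0 then (c ⟨i, h.2.1⟩ : ℕ) else 0
  cpx a i j := if h : a = 0 ∧ i < m ∧ j < m then U ⟨i, h.2.1⟩ ⟨j, h.2.2⟩ else 0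

/-- The input for a matrix with a linear tree decomposition: as for a circuit, without a depth;
in addition, for every occupied input mode `c l`, the array `1` of natural numbers holds
at `(l, 0)` the number of rows in the node of that mode, and row `l` of the array `2` lists those
rows in increasing order. -/
noncomputable def treeInput {m n : ℕ} (U : Matrix (Fin m) (Fin m) ℂ) (c : Fin n → Fin m)
    (T : TreeDecomposition U (Fin m)) : State where
  reg v := if v = 0 then n else if v = 1 then m else 0
  nat a i j :=
    if h : i < n then
      if a = 0 ∧ j = 0 then (c ⟨i, h⟩ : ℕ)
      else if a = 1 ∧ j = 0 then (T.rho (c ⟨i, h⟩)).card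
      else if a = 2 then (((T.rho (c ⟨i, h⟩)).sort.map Fin.val).getD j 0)
      else 0
    else 0
  cpx a i j := if h : a = 0 ∧ i < m ∧ j < m then U ⟨i, h.2.1⟩ ⟨j, h.2.2⟩ else 0

/-- The output: if register `3` is nonzero, the program reports a collision (`none`).
Otherwise the first `n` entries of the array `3` of natural numbers are the modes in which the
photons are detected, and the outcome is their occupation vector. -/
def output (m n : ℕ) (s : State) : Option (Fin m → ℕ) :=
  if s.reg 3 = 0 then
    some fun i => ((Finset.range n).filter fun l => s.nat 3 l 0 = (i : ℕ)).card
  else none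

/-- The program, started in `s`, samples exactly from the Boson Sampling distribution of `U` for
single photons in the input modes `c`, except that it only reports the occurrence of a collision:
each collision-free outcome (the occupation vector of a list `r` of distinct output modes) is
returned with its Boson Sampling probability, and a collision is reported with the total
probability of all outcomes with a collision (an outcome is represented by the nondecreasing list
`z` of its output modes). -/
def SamplesCollisionFree {m n : ℕ} (A : Program) (s : State) (U : Matrix (Fin m) (Fin m) ℂ)
    (c : Fin n → Fin m) : Prop :=
  (∀ r : Fin n → Fin m, Function.Injective r →
    ((A.exec s).map fun x => output m n x.1) (some (occupation r)) =
      ENNReal.ofReal (outcomeProb U c r)) ∧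
  ((A.exec s).map fun x => output m n x.1) none =
    ∑ z : {z : Fin n → Fin m // Monotone z ∧ ¬ Function.Injective z},
      ENNReal.ofReal (outcomeProb U c z)

/-- The bound `n² 2^ω ω² + ω n³`. -/
def timeBound (n ω : ℕ) : ℕ := n ^ 2 * 2 ^ ω * ω ^ 2 + ω * n ^ 3

end BosonSampling

/-! The sampler draws the photons one at a time. It keeps a set `A` of selected columns and a list
`r` of detected modes; in each step it adds a uniformly random new column to `A` and then a row `i`
with probability proportional to `|per(i :: r, A)|²`. The columns of `U` are orthonormal, so these
weights sum to `∑_{l ∈ A} |per(r, A \ l)|²` (`sum_norm_lper_cons`). That is, up to a constant, the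
probability of having arrived at `r` with some `A \ l`, so the normalisation cancels and after `k`
steps a pair `(A, r)` has probability `|per(r, A)|² / (n (n-1) ⋯ (n-k+1))` (`chain_apply`). For `k =
n` every ordered list of distinct modes has probability `|per|² / n!`, and summing over the
orderings gives the Boson Sampling probability. Stopping at the first repeated mode does not affect
lists without repetition. Since the weights `|per|² / n!` of all lists sum to one
(`sum_norm_lper_ofFn`), the collision report receives exactly the mass of the lists with a
repetition.

The weights of one step need, by expansion along the new row, only the minors `per(r, A \ l)`. In a
linear decomposition each row lives on an interval of columns, so at column `l` a detected row is
expired, active or not yet begun, and at most `ω` rows are active. In a nonzero term the columns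
before `l` use all expired rows, no row that has not begun, and some set of active rows. Hence the
permanents of the columns before `l`, and those of the columns from `l` on, each need at most `2^ω`
entries (`FwdTable.succ`, `BwdTable.pred`), and a minor is the scalar product of a forward and a
backward table (`sum_fwdTable_mul_bwdTable`). All minors of a step cost `O(n 2^ω ω)`, and the
weights of the at most `n ω` relevant rows cost `O(n² ω)`; `n` steps stay within the bound.

Programs are tied to this analysis by a program logic: `Hoare` for what every run achieves, `Sim`
for couplings of runs with an abstract law, and `Frame` for data that a program cannot change.

For a circuit, the rows reached from a mode form its light cone. The first layer reaches one pair of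
modes and every further layer adds at most one mode on each side, hence at most `2D` rows. The cones
are intervals moving monotonically with the mode, so they form a linear tree decomposition, and the
machine computes them from `D` alone. -/

namespace BosonSampling

open Finset NatExp Program

/-! ### Program logic -/

/-- Does the program contain an assignment to register `u`? -/
def Program.wReg : Program → ℕ → Bool
  | skip, _ => false
  | setReg v _, u => u == v
  | setNat _ _ _ _, _ => false
  | setCpx _ _ _ _, _ => false
  | coin v _, u => u == v
  | seq p q, u => p.wReg u || q.wReg u
  | ifZero _ p q, u => p.wReg u || q.wReg u
  | loop v _ p, u => u == v || p.wReg u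

/-- Does the program contain an assignment to the array `a` of natural numbers? -/
def Program.wNat : Program → ℕ → Bool
  | skip, _ => false
  | setReg _ _, _ => false
  | setNat b _ _ _, a => a == b
  | setCpx _ _ _ _, _ => false
  | coin _ _, _ => false
  | seq p q, a => p.wNat a || q.wNat a
  | ifZero _ p q, a => p.wNat a || q.wNat a
  | loop _ _ p, a => p.wNat a

/-- Does the program contain an assignment to the array `a` of complex numbers? -/
def Program.wCpx : Program → ℕ → Bool
  | skip, _ => false
  | setReg _ _, _ => false
  | setNat _ _ _ _, _ => false
  | setCpx b _ _ _, a => a == b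
  | coin _ _, _ => false
  | seq p q, a => p.wCpx a || q.wCpx a
  | ifZero _ p q, a => p.wCpx a || q.wCpx a
  | loop _ _ p, a => p.wCpx a

/-- The states `s` and `s'` agree on everything that `p` does not write to. -/
structure Frame (p : Program) (s s' : State) : Prop where
  reg : ∀ u, p.wReg u = false → s'.reg u = s.reg u
  nat : ∀ a, p.wNat a = false → s'.nat a = s.nat a
  cpx : ∀ a, p.wCpx a = false → s'.cpx a = s.cpx a

theorem Frame.refl (p : Program) (s : State) : Frame p s s := ⟨by simp, by simp, by simp⟩

theorem Frame.trans {p : Program} {s s' s'' : State} (h : Frame p s s') (h' : Frame p s' s'') :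
    Frame p s s'' :=
  ⟨fun u hu => (h'.reg u hu).trans (h.reg u hu), fun a ha => (h'.nat a ha).trans (h.nat a ha),
    fun a ha => (h'.cpx a ha).trans (h.cpx a ha)⟩

theorem Frame.of_sub {p q : Program} {s s' : State} (h : Frame p s s')
    (hr : ∀ u, q.wReg u = false → p.wReg u = false) (hn : ∀ a, q.wNat a = false → p.wNat a = false)
    (hc : ∀ a, q.wCpx a = false → p.wCpx a = false) : Frame q s s' :=
  ⟨fun u hu => h.reg u (hr u hu), fun a ha => h.nat a (hn a ha), fun a ha => h.cpx a (hc a ha)⟩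

theorem Frame.loop_setReg (v N : ℕ) (e : NatExp) (p : Program) (s : State) :
    Frame (.loop v e p) s (s.setReg v N) := by
  refine ⟨fun u hu => ?_, fun _ _ => rfl, fun _ _ => rfl⟩
  simp only [Program.wReg, Bool.or_eq_false_iff, beq_eq_false_iff_ne] at hu
  simp [State.setReg, hu.1]

theorem Frame.loop_body {v : ℕ} {e : NatExp} {p : Program} {s s' : State} (h : Frame p s s') :
    Frame (.loop v e p) s s' :=
  h.of_sub (fun u hu => by simp [Program.wReg] at hu; exact hu.2) (fun a ha => ha) fun a ha => ha

theorem loopRounds_frame {v : ℕ} {e : NatExp} {p : Program}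
    (ih : ∀ s, ∀ x ∈ (p.exec s).support, Frame p s x.1) (s : State) (N : ℕ) :
    ∀ x ∈ (loopRounds p.exec v s N).support, Frame (.loop v e p) s x.1 := by
  induction N with
  | zero =>
    intro x hx
    simp only [loopRounds, PMF.support_pure, Set.mem_singleton_iff] at hx
    subst hx; exact Frame.refl _ _
  | succ N hN =>
    intro x hx
    simp only [loopRounds, PMF.mem_support_bind_iff, PMF.mem_support_map_iff] at hx
    obtain ⟨y, hy, z, hz, rfl⟩ := hx
    exact ((hN y hy).trans (Frame.loop_setReg v N e p _)).trans (ih _ z hz).loop_body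

/-- The write sets are computed from the program text, so for a concrete program the side conditions
hold by `rfl`, and specifications need to mention only what changes. -/
theorem Program.frame (p : Program) : ∀ s, ∀ x ∈ (p.exec s).support, Frame p s x.1 := by
  induction p with
  | skip =>
    intro s x hx
    simp only [exec, PMF.support_pure, Set.mem_singleton_iff] at hx
    subst hx; exact Frame.refl _ _
  | setReg v e =>
    intro s x hx
    simp only [exec, PMF.support_pure, Set.mem_singleton_iff] at hx
    subst hx
    exact ⟨fun u hu => by simp [wReg] at hu; simp [State.setReg, hu], fun _ _ => rfl,
      fun _ _ => rfl⟩
  | setNat b i j e =>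
    intro s x hx
    simp only [exec, PMF.support_pure, Set.mem_singleton_iff] at hx
    subst hx
    exact ⟨fun _ _ => rfl, fun a ha => by simp [wNat] at ha; simp [State.setNat, ha],
      fun _ _ => rfl⟩
  | setCpx b i j e =>
    intro s x hx
    simp only [exec, PMF.support_pure, Set.mem_singleton_iff] at hx
    subst hx
    exact ⟨fun _ _ => rfl, fun _ _ => rfl,
      fun a ha => by simp [wCpx] at ha; simp [State.setCpx, ha]⟩
  | coin v e =>
    intro s x hx
    simp only [exec, PMF.mem_support_map_iff] at hx
    obtain ⟨b, -, rfl⟩ := hx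
    exact ⟨fun u hu => by simp [wReg] at hu; simp [State.setReg, hu], fun _ _ => rfl,
      fun _ _ => rfl⟩
  | seq p q ihp ihq =>
    intro s x hx
    simp only [exec, PMF.mem_support_bind_iff, PMF.mem_support_map_iff] at hx
    obtain ⟨y, hy, z, hz, rfl⟩ := hx
    refine ((ihp s y hy).of_sub ?_ ?_ ?_).trans ((ihq _ z hz).of_sub ?_ ?_ ?_) <;>
      simp +contextual [wReg, wNat, wCpx]
  | ifZero e p q ihp ihq =>
    intro s x hx
    simp only [exec, PMF.mem_support_map_iff] at hx
    obtain ⟨y, hy, rfl⟩ := hx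
    split_ifs at hy
    · refine (ihp s y hy).of_sub ?_ ?_ ?_ <;> simp +contextual [wReg, wNat, wCpx]
    · refine (ihq s y hy).of_sub ?_ ?_ ?_ <;> simp +contextual [wReg, wNat, wCpx]
  | loop v e p ih =>
    intro s x hx
    simp only [exec, PMF.mem_support_map_iff] at hx
    obtain ⟨y, hy, rfl⟩ := hx
    exact loopRounds_frame ih s _ y hy

/-- Every run of `p` from `s` ends, within `t` steps, in a state that satisfies `Q`. -/
def Hoare (p : Program) (s : State) (t : ℕ) (Q : State → Prop) : Prop :=
  ∀ x ∈ (p.exec s).support, Q x.1 ∧ x.2 ≤ t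

/-- The law `μ` describes the random choices of `p` from `s`: there is a coupling of `μ` and of the
runs of `p` such that the value `a` and the final state are always related by `R`, and all runs
take at most `t` steps. -/
def Sim {α : Type} (p : Program) (s : State) (t : ℕ) (μ : PMF α) (R : α → State → Prop) : Prop :=
  ∃ π : PMF (α × (State × ℕ)), π.map Prod.fst = μ ∧ π.map Prod.snd = p.exec s ∧
    ∀ y ∈ π.support, R y.1 y.2.1 ∧ y.2.2 ≤ t

theorem Hoare.mono {p : Program} {s : State} {t t' : ℕ} {Q Q' : State → Prop}
    (h : Hoare p s t Q) (ht : t ≤ t') (hQ : ∀ s', Q s' → Frame p s s' → Q' s') :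
    Hoare p s t' Q' := fun x hx =>
  ⟨hQ _ (h x hx).1 (p.frame s x hx), (h x hx).2.trans ht⟩

theorem Hoare.seq {p q : Program} {s : State} {t t₁ t₂ : ℕ} {Q Q' : State → Prop}
    (hp : Hoare p s t₁ Q) (hq : ∀ s', Q s' → Frame p s s' → Hoare q s' t₂ Q') (ht : t₁ + t₂ ≤ t) :
    Hoare (.seq p q) s t Q' := by
  intro x hx
  simp only [Program.exec, PMF.mem_support_bind_iff, PMF.mem_support_map_iff] at hx
  obtain ⟨y, hy, z, hz, rfl⟩ := hx
  have h1 := hp y hy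
  have h2 := hq _ h1.1 (p.frame s y hy) z hz
  exact ⟨h2.1, by dsimp only; omega⟩

theorem Hoare.ifZero {e : NatExp} {p q : Program} {s : State} {t t' : ℕ} {Q : State → Prop}
    (hp : e.eval s = 0 → Hoare p s t Q) (hq : e.eval s ≠ 0 → Hoare q s t Q)
    (ht : e.cost + t + 1 ≤ t') : Hoare (.ifZero e p q) s t' Q := by
  intro x hx
  simp only [Program.exec, PMF.mem_support_map_iff] at hx
  obtain ⟨y, hy, rfl⟩ := hx
  split_ifs at hy with h
  · exact ⟨(hp h y hy).1, by have := (hp h y hy).2; dsimp only; omega⟩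
  · exact ⟨(hq h y hy).1, by have := (hq h y hy).2; dsimp only; omega⟩

theorem Hoare.loop {v : ℕ} {e : NatExp} {p : Program} {s : State} {t t' : ℕ}
    (I : ℕ → State → Prop) (n : ℕ) (hn : e.eval s = n) (h0 : I 0 s)
    (hstep : ∀ N < n, ∀ s', I N s' → Frame (.loop v e p) s s' →
      Hoare p (s'.setReg v N) t (I (N + 1)))
    (ht : e.cost + n * (t + 1) + 1 ≤ t') : Hoare (.loop v e p) s t' (I n) := by
  have key : ∀ N ≤ n, ∀ x ∈ (loopRounds p.exec v s N).support, I N x.1 ∧ x.2 ≤ N * (t + 1) := by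
    intro N
    induction N with
    | zero =>
      intro _ x hx
      simp only [loopRounds, PMF.support_pure, Set.mem_singleton_iff] at hx
      subst hx; exact ⟨h0, Nat.zero_le _⟩
    | succ N ih =>
      intro hN x hx
      simp only [loopRounds, PMF.mem_support_bind_iff, PMF.mem_support_map_iff] at hx
      obtain ⟨y, hy, z, hz, rfl⟩ := hx
      have h1 := ih (by omega) y hy
      have h2 := hstep N (by omega) _ h1.1 (loopRounds_frame p.frame s N y hy) z hz
      exact ⟨h2.1, by dsimp only; rw [add_mul]; omega⟩
  intro x hx
  simp only [Program.exec, PMF.mem_support_map_iff] at hx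
  obtain ⟨y, hy, rfl⟩ := hx
  rw [hn] at hy
  have := key n le_rfl y hy
  exact ⟨this.1, by dsimp only; omega⟩

/-- Programs without coins and loops. -/
def Program.straight : Program → Bool
  | coin _ _ => false
  | loop _ _ _ => false
  | seq p q => p.straight && q.straight
  | ifZero _ p q => p.straight && q.straight
  | _ => true

/-- The final state of a program without coins and loops. -/
noncomputable def Program.run : Program → State → State
  | setReg v e, s => s.setReg v (e.eval s)
  | setNat a i j e, s => s.setNat a (i.eval s) (j.eval s) (e.eval s)
  | setCpx a i j e, s => s.setCpx a (i.eval s) (j.eval s) (e.eval s)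
  | seq p q, s => q.run (p.run s)
  | ifZero e p q, s => if e.eval s = 0 then p.run s else q.run s
  | _, s => s

/-- A bound for the number of steps of a program without coins and loops. -/
def Program.maxCost : Program → ℕ
  | skip => 1
  | setReg _ e => e.cost + 1
  | setNat _ i j e => i.cost + j.cost + e.cost + 1
  | setCpx _ i j e => i.cost + j.cost + e.cost + 1
  | seq p q => p.maxCost + q.maxCost
  | ifZero e p q => e.cost + max p.maxCost q.maxCost + 1
  | _ => 0

/-- With `Hoare.block` this reduces a block of assignments to evaluating `run` by simplification and
`maxCost` by decision. -/
theorem Program.straight_hoare (p : Program) (hp : p.straight = true) :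
    ∀ s, Hoare p s p.maxCost (· = p.run s) := by
  induction p with
  | skip => intro s x hx; simp_all [exec, run, maxCost]
  | setReg v e => intro s x hx; simp_all [exec, run, maxCost]
  | setNat a i j e => intro s x hx; simp_all [exec, run, maxCost]
  | setCpx a i j e => intro s x hx; simp_all [exec, run, maxCost]
  | coin v e => simp [straight] at hp
  | loop v e p _ => simp [straight] at hp
  | seq p q ihp ihq =>
    intro s
    simp only [straight, Bool.and_eq_true] at hp
    exact (ihp hp.1 s).seq (fun s' hs' _ => by subst hs'; exact ihq hp.2 _) le_rfl
  | ifZero e p q ihp ihq =>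
    intro s
    simp only [straight, Bool.and_eq_true] at hp
    refine Hoare.ifZero (t := max p.maxCost q.maxCost) (fun h => ?_) (fun h => ?_) le_rfl
    · simp only [run, h, if_true]
      exact (ihp hp.1 s).mono (le_max_left _ _) fun _ h _ => h
    · simp only [run, h, if_false]
      exact (ihq hp.2 s).mono (le_max_right _ _) fun _ h _ => h

theorem Hoare.block {p : Program} {s : State} {t : ℕ} {Q : State → Prop}
    (hp : p.straight = true) (ht : p.maxCost ≤ t) (hQ : Q (p.run s)) : Hoare p s t Q :=
  (p.straight_hoare hp s).mono ht fun _ h _ => h ▸ hQ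

/-! ### Couplings of program runs with abstract laws -/

section Sim

variable {α β : Type}

/-- The program need not be deterministic: any law has a unique coupling with a point mass. -/
theorem Hoare.sim {p : Program} {s : State} {t : ℕ} {Q : State → Prop} (h : Hoare p s t Q)
    (a : α) : Sim p s t (PMF.pure a) (fun b s' => b = a ∧ Q s') := by
  refine ⟨(p.exec s).map fun x => (a, x), ?_, ?_, ?_⟩
  · rw [PMF.map_comp]; exact PMF.map_const _ _
  · rw [PMF.map_comp]; exact PMF.map_id _
  · intro y hy
    obtain ⟨x, hx, rfl⟩ := (PMF.mem_support_map_iff _ _ _).1 hy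
    exact ⟨⟨rfl, (h x hx).1⟩, (h x hx).2⟩

theorem Sim.mem_support {p : Program} {s : State} {π : PMF (α × (State × ℕ))} {μ : PMF α}
    (h1 : π.map Prod.fst = μ) (h2 : π.map Prod.snd = p.exec s) {y : α × (State × ℕ)}
    (hy : y ∈ π.support) : y.1 ∈ μ.support ∧ y.2 ∈ (p.exec s).support := by
  rw [← h1, ← h2, PMF.mem_support_map_iff, PMF.mem_support_map_iff]
  exact ⟨⟨y, hy, rfl⟩, ⟨y, hy, rfl⟩⟩

theorem Sim.mono {p : Program} {s : State} {t t' : ℕ} {μ : PMF α} {R R' : α → State → Prop}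
    (h : Sim p s t μ R) (ht : t ≤ t')
    (hR : ∀ a ∈ μ.support, ∀ s', R a s' → Frame p s s' → R' a s') : Sim p s t' μ R' := by
  obtain ⟨π, h1, h2, h3⟩ := h
  refine ⟨π, h1, h2, fun y hy => ?_⟩
  obtain ⟨ha, hs⟩ := Sim.mem_support h1 h2 hy
  exact ⟨hR _ ha _ (h3 y hy).1 (p.frame s _ hs), (h3 y hy).2.trans ht⟩

theorem Sim.map {p : Program} {s : State} {t : ℕ} {μ : PMF α} {R : α → State → Prop}
    {R' : β → State → Prop} (f : α → β) (h : Sim p s t μ R)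
    (hR : ∀ a ∈ μ.support, ∀ s', R a s' → R' (f a) s') : Sim p s t (μ.map f) R' := by
  obtain ⟨π, h1, h2, h3⟩ := h
  refine ⟨π.map fun y => (f y.1, y.2), ?_, ?_, ?_⟩
  · rw [← h1, PMF.map_comp, PMF.map_comp]; rfl
  · rw [← h2, PMF.map_comp]; rfl
  · intro y hy
    obtain ⟨x, hx, rfl⟩ := (PMF.mem_support_map_iff _ _ _).1 hy
    exact ⟨hR _ (Sim.mem_support h1 h2 hx).1 _ (h3 x hx).1, (h3 x hx).2⟩

/-- Sequential composition of a family of programs, with an arbitrary rule for the number of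
steps. -/
theorem Sim.bind {t₁ t₂ t : ℕ} {μ : PMF α} {R : α → State → Prop}
    {f : State → PMF (State × ℕ)} {ν : α → PMF β} {R' : β → State → Prop}
    {π : PMF (α × (State × ℕ))} (h1 : π.map Prod.fst = μ)
    (h3 : ∀ y ∈ π.support, R y.1 y.2.1 ∧ y.2.2 ≤ t₁) (g : ℕ → ℕ → ℕ)
    (hg : ∀ a ≤ t₁, ∀ b ≤ t₂, g a b ≤ t)
    (hq : ∀ y ∈ π.support, ∃ π' : PMF (β × (State × ℕ)), π'.map Prod.fst = ν y.1 ∧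
      π'.map Prod.snd = f y.2.1 ∧ ∀ z ∈ π'.support, R' z.1 z.2.1 ∧ z.2.2 ≤ t₂) :
    ∃ π' : PMF (β × (State × ℕ)), π'.map Prod.fst = μ.bind ν ∧
      π'.map Prod.snd = (π.map Prod.snd).bind (fun x => (f x.1).map fun y => (y.1, g x.2 y.2)) ∧
      ∀ z ∈ π'.support, R' z.1 z.2.1 ∧ z.2.2 ≤ t := by
  -- Conditional couplings exist only over the support of `π`; choosing them as a total function
  -- needs a default value.
  have : Nonempty (PMF (β × (State × ℕ))) :=
    let ⟨y, hy⟩ := π.support_nonempty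
    ⟨(hq y hy).choose⟩
  choose! κ hκ1 hκ2 hκ3 using hq
  refine ⟨π.bind fun y => (κ y).map fun z => (z.1, (z.2.1, g y.2.2 z.2.2)), ?_, ?_, ?_⟩
  -- The marginals of `κ y` are known only for `y` in the support, which `bindOnSupport` makes
  -- available.
  · rw [PMF.map_bind, ← h1, PMF.bind_map, ← PMF.bindOnSupport_eq_bind,
      ← PMF.bindOnSupport_eq_bind]
    congr 1; funext y hy
    rw [PMF.map_comp, Function.comp_apply, ← hκ1 y hy]; rfl
  · rw [PMF.map_bind, PMF.bind_map, ← PMF.bindOnSupport_eq_bind, ← PMF.bindOnSupport_eq_bind]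
    congr 1; funext y hy
    rw [PMF.map_comp, Function.comp_apply, ← hκ2 y hy, PMF.map_comp]; rfl
  · intro z hz
    obtain ⟨y, hy, hz⟩ := (PMF.mem_support_bind_iff _ _ _).1 hz
    obtain ⟨w, hw, rfl⟩ := (PMF.mem_support_map_iff _ _ _).1 hz
    exact ⟨(hκ3 y hy w hw).1, hg _ (h3 y hy).2 _ (hκ3 y hy w hw).2⟩

theorem Sim.seq {p q : Program} {s : State} {t t₁ t₂ : ℕ} {μ : PMF α} {ν : α → PMF β}
    {R : α → State → Prop} {R' : β → State → Prop} (hp : Sim p s t₁ μ R)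
    (hq : ∀ a ∈ μ.support, ∀ s', R a s' → Frame p s s' → Sim q s' t₂ (ν a) R')
    (ht : t₁ + t₂ ≤ t) : Sim (.seq p q) s t (μ.bind ν) R' := by
  obtain ⟨π, h1, h2, h3⟩ := hp
  obtain ⟨π', h1', h2', h3'⟩ := Sim.bind (f := q.exec) (ν := ν) (R' := R') (t₂ := t₂) (t := t)
    h1 h3 (fun a b => a + b) (fun a ha b hb => by omega) (fun y hy => by
      obtain ⟨ha, hs⟩ := Sim.mem_support h1 h2 hy
      exact hq _ ha _ (h3 y hy).1 (p.frame s _ hs))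
  exact ⟨π', h1', by rw [h2', h2]; rfl, h3'⟩

theorem Hoare.seq_sim {p q : Program} {s : State} {t t₁ t₂ : ℕ} {ν : PMF β} {Q : State → Prop}
    {R' : β → State → Prop} (hp : Hoare p s t₁ Q)
    (hq : ∀ s', Q s' → Frame p s s' → Sim q s' t₂ ν R') (ht : t₁ + t₂ ≤ t) :
    Sim (.seq p q) s t ν R' := by
  have := (hp.sim ()).seq (ν := fun _ => ν) (fun _ _ s' h hf => hq s' h.2 hf) ht
  rwa [PMF.pure_bind] at this

theorem Sim.seq_hoare {p q : Program} {s : State} {t t₁ t₂ : ℕ} {μ : PMF α}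
    {R R' : α → State → Prop} (hp : Sim p s t₁ μ R)
    (hq : ∀ a ∈ μ.support, ∀ s', R a s' → Frame p s s' → Hoare q s' t₂ (R' a))
    (ht : t₁ + t₂ ≤ t) : Sim (.seq p q) s t μ R' := by
  have := hp.seq (ν := PMF.pure) (R' := R') (t₂ := t₂) (t := t)
    (fun a ha s' h hf => ((hq a ha s' h hf).sim a).mono le_rfl
      fun b hb s'' hs _ => hs.1 ▸ hs.2) ht
  rwa [PMF.bind_pure] at this

theorem Sim.ifZero {e : NatExp} {p q : Program} {s : State} {t t' : ℕ} {μ : PMF α}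
    {R : α → State → Prop} (hp : e.eval s = 0 → Sim p s t μ R)
    (hq : e.eval s ≠ 0 → Sim q s t μ R) (ht : e.cost + t + 1 ≤ t') :
    Sim (.ifZero e p q) s t' μ R := by
  have key : ∃ π : PMF (α × (State × ℕ)), π.map Prod.fst = μ ∧
      π.map Prod.snd = (if e.eval s = 0 then p.exec s else q.exec s) ∧
      ∀ y ∈ π.support, R y.1 y.2.1 ∧ y.2.2 ≤ t := by
    split_ifs with h
    · exact hp h
    · exact hq h
  obtain ⟨π, h1, h2, h3⟩ := key
  refine ⟨π.map fun y => (y.1, (y.2.1, e.cost + y.2.2 + 1)), ?_, ?_, ?_⟩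
  · rw [← h1, PMF.map_comp]; rfl
  · rw [Program.exec, ← h2, PMF.map_comp, PMF.map_comp]; rfl
  · intro y hy
    obtain ⟨x, hx, rfl⟩ := (PMF.mem_support_map_iff _ _ _).1 hy
    exact ⟨(h3 x hx).1, by have := (h3 x hx).2; dsimp only; omega⟩

theorem Sim.coin {v : ℕ} {e : CpxExp} {s : State} :
    Sim (.coin v e) s (e.cost + 1) (coinToss (e.eval s).re)
      (fun b s' => s' = s.setReg v (if b then 1 else 0)) := by
  refine ⟨(coinToss (e.eval s).re).map
    fun b => (b, (s.setReg v (if b then 1 else 0), e.cost + 1)), ?_, ?_, ?_⟩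
  · rw [PMF.map_comp]; exact PMF.map_id _
  · rw [PMF.map_comp]; rfl
  · intro y hy
    obtain ⟨x, hx, rfl⟩ := (PMF.mem_support_map_iff _ _ _).1 hy
    exact ⟨rfl, le_rfl⟩

/-- The loop is coupled to an inhomogeneous Markov chain. The simulation of a round is required only
from values that the chain can take, so invariants of the chain become available to the program. -/
theorem Sim.loop {v : ℕ} {e : NatExp} {p : Program} {s : State} {t t' : ℕ}
    (μ : ℕ → PMF α) (step : ℕ → α → PMF α) (R : ℕ → α → State → Prop) (n : ℕ)
    (hn : e.eval s = n) (hμ : ∀ N, μ (N + 1) = (μ N).bind (step N)) {a₀ : α}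
    (hμ0 : μ 0 = PMF.pure a₀) (h0 : R 0 a₀ s)
    (hstep : ∀ N < n, ∀ a ∈ (μ N).support, ∀ s', R N a s' → Frame (.loop v e p) s s' →
      Sim p (s'.setReg v N) t (step N a) (R (N + 1)))
    (ht : e.cost + n * (t + 1) + 1 ≤ t') : Sim (.loop v e p) s t' (μ n) (R n) := by
  have key : ∀ N ≤ n, ∃ π : PMF (α × (State × ℕ)), π.map Prod.fst = μ N ∧
      π.map Prod.snd = loopRounds p.exec v s N ∧
      ∀ y ∈ π.support, R N y.1 y.2.1 ∧ y.2.2 ≤ N * (t + 1) := by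
    intro N
    induction N with
    | zero =>
      intro _
      refine ⟨PMF.pure (a₀, (s, 0)), ?_, ?_, ?_⟩
      · rw [PMF.pure_map, hμ0]
      · rw [PMF.pure_map]; rfl
      · intro y hy
        rw [PMF.mem_support_pure_iff] at hy
        subst hy
        exact ⟨h0, Nat.zero_le _⟩
    | succ N ih =>
      intro hN
      obtain ⟨π, h1, h2, h3⟩ := ih (by omega)
      obtain ⟨π', h1', h2', h3'⟩ := Sim.bind (f := fun s' => p.exec (s'.setReg v N))
        (ν := step N) (R' := R (N + 1)) (t₂ := t) (t := (N + 1) * (t + 1))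
        h1 h3 (fun a b => a + b + 1) (fun a ha b hb => by rw [add_mul]; omega) (fun y hy => by
          have hm : y.1 ∈ (μ N).support ∧ y.2 ∈ (loopRounds p.exec v s N).support := by
            rw [← h1, ← h2, PMF.mem_support_map_iff, PMF.mem_support_map_iff]
            exact ⟨⟨y, hy, rfl⟩, ⟨y, hy, rfl⟩⟩
          exact hstep N (by omega) _ hm.1 _ (h3 y hy).1 (loopRounds_frame p.frame s N _ hm.2))
      exact ⟨π', by rw [h1', hμ], by rw [h2', h2]; rfl, h3'⟩
  obtain ⟨π, h1, h2, h3⟩ := key n le_rfl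
  refine ⟨π.map fun y => (y.1, (y.2.1, e.cost + y.2.2 + 1)), ?_, ?_, ?_⟩
  · rw [← h1, PMF.map_comp]; rfl
  · rw [Program.exec, hn, ← h2, PMF.map_comp, PMF.map_comp]; rfl
  · intro y hy
    obtain ⟨x, hx, rfl⟩ := (PMF.mem_support_map_iff _ _ _).1 hy
    exact ⟨(h3 x hx).1, by have := (h3 x hx).2; dsimp only; omega⟩

theorem Sim.hoare {p : Program} {s : State} {t : ℕ} {μ : PMF α} {R : α → State → Prop}
    (h : Sim p s t μ R) : Hoare p s t fun s' => ∃ a ∈ μ.support, R a s' := by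
  obtain ⟨π, h1, h2, h3⟩ := h
  intro x hx
  rw [← h2, PMF.mem_support_map_iff] at hx
  obtain ⟨y, hy, rfl⟩ := hx
  exact ⟨⟨y.1, (Sim.mem_support h1 h2 hy).1, (h3 y hy).1⟩, (h3 y hy).2⟩

/-- The use of a coupling: an observable of the final state that is determined by the related
abstract value has the same law on both sides. -/
theorem Sim.map_exec {p : Program} {s : State} {t : ℕ} {μ : PMF α} {R : α → State → Prop}
    (h : Sim p s t μ R) (f : State → β) (g : α → β)
    (hfg : ∀ a ∈ μ.support, ∀ s', R a s' → f s' = g a) :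
    ((p.exec s).map fun x => f x.1) = μ.map g := by
  obtain ⟨π, h1, h2, h3⟩ := h
  rw [← h1, ← h2, PMF.map_comp, PMF.map_comp, PMF.map, PMF.map, ← PMF.bindOnSupport_eq_bind,
    ← PMF.bindOnSupport_eq_bind]
  congr 1; funext y hy
  simp only [Function.comp_apply]
  rw [hfg _ (Sim.mem_support h1 h2 hy).1 _ (h3 y hy).1]

end Sim

/-! ### Permanents of lists of rows -/

section Permanent

variable {α β γ : Type*} [DecidableEq α] [DecidableEq β] [DecidableEq γ]

/-- The permanent of the matrix with the rows `L` and the set of columns `Y`, by expansion along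
the first row. -/
def lper (u : α → β → ℂ) : List α → Finset β → ℂ
  | [], Y => if Y = ∅ then 1 else 0
  | a :: L, Y => ∑ b ∈ Y, u a b * lper u L (Y.erase b)

omit [DecidableEq α] in
-- Two expansions give a sum over ordered pairs of distinct columns; interchange the pair.
theorem lper_swap (u : α → β → ℂ) (a a' : α) (L : List α) (Y : Finset β) :
    lper u (a :: a' :: L) Y = lper u (a' :: a :: L) Y := by
  simp only [lper, mul_sum]
  rw [sum_sigma', sum_sigma']
  refine sum_bij' (fun x _ => ⟨x.2, x.1⟩) (fun x _ => ⟨x.2, x.1⟩) ?_ ?_ ?_ ?_ ?_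
  · simp only [mem_sigma, mem_erase]; tauto
  · simp only [mem_sigma, mem_erase]; tauto
  · simp
  · simp
  · intro x _; rw [erase_right_comm]; ring

omit [DecidableEq α] in
theorem lper_perm (u : α → β → ℂ) {L L' : List α} (h : L.Perm L') :
    ∀ Y, lper u L Y = lper u L' Y := by
  induction h with
  | nil => intro Y; rfl
  | cons a _ ih => intro Y; simp only [lper, ih]
  | swap a a' L => intro Y; exact lper_swap u _ _ L Y
  | trans _ _ ih ih' => intro Y; rw [ih, ih']

omit [DecidableEq α] [DecidableEq γ] in
theorem lper_map (u : α → β → ℂ) (f : γ → α) (L : List γ) :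
    ∀ Y, lper u (L.map f) Y = lper (fun c b => u (f c) b) L Y := by
  induction L with
  | nil => intro Y; rfl
  | cons a L ih => intro Y; simp only [List.map_cons, lper, ih]

omit [DecidableEq α] in
theorem lper_map_right (u : α → β → ℂ) (e : γ ↪ β) (L : List α) :
    ∀ Y : Finset γ, lper u L (Y.map e) = lper (fun a c => u a (e c)) L Y := by
  induction L with
  | nil => intro Y; simp [lper]
  | cons a L ih => intro Y; simp only [lper, sum_map, ← map_erase, ih]

/-- The permanent of the matrix with rows `X` and columns `Y`. -/
noncomputable def fper (u : α → β → ℂ) (Y : Finset β) (X : Finset α) : ℂ :=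
  lper (fun b a => u a b) Y.toList X

omit [DecidableEq β] in
theorem fper_empty (u : α → β → ℂ) (X : Finset α) :
    fper u ∅ X = if X = ∅ then 1 else 0 := by
  simp [fper, lper]

/-- The order in which `toList` enumerates the columns is immaterial by `lper_perm`. -/
theorem fper_insert (u : α → β → ℂ) {Y : Finset β} {b : β} (hb : b ∉ Y) (X : Finset α) :
    fper u (insert b Y) X = ∑ a ∈ X, u a b * fper u Y (X.erase a) := by
  rw [fper, lper_perm _ (toList_insert hb)]; rfl

/-- Expand along a column `l` first. The term that matches `a` with `l` is split off, and in the
others the induction hypothesis expands along `a`; exchanging the two sums reassembles the minors.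
-/
theorem fper_insert_row (u : α → β → ℂ) (Y : Finset β) {X : Finset α} {a : α} (ha : a ∉ X) :
    fper u Y (insert a X) = ∑ b ∈ Y, u a b * fper u (Y.erase b) X := by
  induction Y using Finset.induction_on generalizing X with
  | empty => simp [fper_empty]
  | insert l Y hl ih =>
    rw [fper_insert u hl, sum_insert ha, sum_insert hl, erase_insert ha, erase_insert hl]
    congr 1
    have h1 : ∀ x ∈ X, u x l * fper u Y ((insert a X).erase x) =
        ∑ b ∈ Y, u x l * (u a b * fper u (Y.erase b) (X.erase x)) := by
      intro x hx
      rw [erase_insert_of_ne (by rintro rfl; exact ha hx), ih (by simp [ha]), mul_sum]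
    rw [sum_congr rfl h1, sum_comm]
    refine sum_congr rfl fun b hb => ?_
    have hbl : l ≠ b := by rintro rfl; exact hl hb
    rw [erase_insert_of_ne hbl, fper_insert u (by simp [hl]), mul_sum]
    exact sum_congr rfl fun x _ => by ring

/-- Expansion by rows and expansion by columns agree. The former allows repeated rows, as the total
mass of all outcomes requires; the latter works on sets of rows, as the tables do. -/
theorem lper_eq_fper (u : α → β → ℂ) {L : List α} (hL : L.Nodup) :
    ∀ Y, lper u L Y = fper u Y L.toFinset := by
  induction L with
  | nil =>
    intro Y
    rcases Y.eq_empty_or_nonempty with rfl | ⟨b, hb⟩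
    · simp [lper, fper_empty]
    · rw [← insert_erase hb, List.toFinset_nil, fper_insert u (notMem_erase _ _)]
      simp [lper]
  | cons a L ih =>
    intro Y
    rw [List.nodup_cons] at hL
    rw [List.toFinset_cons, fper_insert_row u Y (by simpa using hL.1)]
    simp only [lper, ih hL.2]

/-- Laplace expansion for a splitting of the columns, by adding one column to `Y` at a time. The row
`a` matched with the new column moves from the complement into `Z`, which is the bijection `(a, Z) ↦
(insert a Z, a)`. -/
theorem fper_union (u : α → β → ℂ) {Y Y' : Finset β} (h : Disjoint Y Y') (X : Finset α) :
    fper u (Y ∪ Y') X = ∑ Z ∈ X.powerset, fper u Y Z * fper u Y' (X \ Z) := by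
  induction Y using Finset.induction_on generalizing X with
  | empty =>
    rw [sum_eq_single ∅]
    · simp [fper_empty]
    · intro Z _ hZ; simp [fper_empty, hZ]
    · simp
  | insert l Y hl ih =>
    rw [disjoint_insert_left] at h
    rw [insert_union, fper_insert u (by simp [hl, h.1])]
    simp only [ih h.2, fper_insert u hl, mul_sum, sum_mul]
    rw [sum_sigma', sum_sigma']
    refine sum_bij' (fun x _ => ⟨insert x.1 x.2, x.1⟩) (fun x _ => ⟨x.2, x.1.erase x.2⟩)
      ?_ ?_ ?_ ?_ ?_
    · rintro ⟨a, Z⟩ hx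
      simp only [mem_sigma, mem_powerset] at hx ⊢
      exact ⟨insert_subset hx.1 (hx.2.trans (erase_subset _ _)), mem_insert_self _ _⟩
    · rintro ⟨Z, a⟩ hx
      simp only [mem_sigma, mem_powerset] at hx ⊢
      exact ⟨hx.1 hx.2, erase_subset_erase _ hx.1⟩
    · rintro ⟨a, Z⟩ hx
      simp only [mem_sigma, mem_powerset] at hx
      have : a ∉ Z := fun h => by simpa using hx.2 h
      simp [this]
    · rintro ⟨Z, a⟩ hx
      simp only [mem_sigma] at hx
      simp [hx.2]
    · rintro ⟨a, Z⟩ hx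
      simp only [mem_sigma, mem_powerset] at hx
      have h' : a ∉ Z := fun h => by simpa using hx.2 h
      rw [erase_insert h', sdiff_insert, ← erase_sdiff_comm]
      ring

/-- A zero row kills the permanent; this is the only source of sparsity that the tables exploit. -/
theorem fper_eq_zero (u : α → β → ℂ) {Y : Finset β} {X : Finset α} {a : α} (ha : a ∈ X)
    (h : ∀ b ∈ Y, u a b = 0) : fper u Y X = 0 := by
  rw [← insert_erase ha, fper_insert_row u Y (notMem_erase _ _)]
  exact sum_eq_zero fun b hb => by rw [h b hb, zero_mul]

omit [DecidableEq α] in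
theorem lper_ofFn (u : α → β → ℂ) [Fintype β] {k : ℕ} (f : Fin k → α) (Y : Finset β) :
    lper u (List.ofFn f) Y =
      ∑ g : Fin k → β with Function.Injective g ∧ univ.image g = Y, ∏ j, u (f j) (g j) := by
  induction k generalizing Y with
  | zero =>
    rw [sum_filter]
    simp [lper, Function.injective_of_subsingleton, eq_comm]
  | succ k ih =>
    rw [List.ofFn_succ, lper]
    simp only [ih, mul_sum]
    rw [sum_sigma']
    refine sum_bij' (fun x _ => Fin.cons x.1 x.2) (fun g _ => ⟨g 0, Fin.tail g⟩) ?_ ?_ ?_ ?_ ?_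
    · rintro ⟨b, g⟩ hx
      simp only [mem_sigma, mem_filter, mem_univ, true_and] at hx ⊢
      obtain ⟨hb, hg, hi⟩ := hx
      refine ⟨Fin.cons_injective_iff.2 ⟨?_, hg⟩, ?_⟩
      · rintro ⟨j, hj⟩
        have : g j ∈ Y.erase b := hi ▸ mem_image_of_mem _ (mem_univ _)
        simp [hj] at this
      · ext y
        simp only [mem_image, mem_univ, true_and, Fin.exists_fin_succ, Fin.cons_zero,
          Fin.cons_succ]
        have : (∃ j, g j = y) ↔ y ∈ Y.erase b := by rw [← hi]; simp
        rw [this, mem_erase]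
        constructor
        · rintro (rfl | h)
          exacts [hb, h.2]
        · intro h; by_cases hy : b = y
          exacts [Or.inl hy, Or.inr ⟨Ne.symm hy, h⟩]
    · intro g hg
      simp only [mem_sigma, mem_filter, mem_univ, true_and] at hg ⊢
      obtain ⟨hg, rfl⟩ := hg
      refine ⟨mem_image_of_mem _ (mem_univ _), ?_, ?_⟩
      · exact hg.comp (Fin.succ_injective _)
      · ext y
        simp only [mem_image, mem_univ, true_and, mem_erase, Fin.tail]
        constructor
        · rintro ⟨j, rfl⟩
          exact ⟨fun h => Fin.succ_ne_zero _ (hg h), _, rfl⟩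
        · rintro ⟨hy, j, rfl⟩
          obtain ⟨i, rfl⟩ := Fin.exists_succ_eq.2 (show j ≠ 0 by rintro rfl; exact hy rfl)
          exact ⟨i, rfl⟩
    · rintro ⟨b, g⟩ _; simp
    · intro g _; simp
    · rintro ⟨b, g⟩ _; simp [Fin.prod_univ_succ]

omit [DecidableEq α] in
theorem lper_ofFn_eq_permanent {n : ℕ} (u : α → ℕ → ℂ) (f : Fin n → α) :
    lper u (List.ofFn f) (range n) =
      (Matrix.of fun l h : Fin n => u (f l) h).permanent := by
  have h1 : range n = (univ : Finset (Fin n)).map Fin.valEmbedding := by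
    ext x; simp
  -- `Matrix.permanent` multiplies the entries `(σ i, i)`, the expansion by rows the entries `(i, σ
  -- i)`.
  rw [h1, lper_map_right, lper_ofFn, ← Matrix.permanent_transpose, Matrix.permanent]
  symm
  refine sum_bij (fun σ _ => σ) ?_ ?_ ?_ ?_
  · intro σ _
    simp [σ.injective, image_univ_equiv]
  · intro σ _ τ _ h; exact DFunLike.coe_injective h
  · intro g hg
    simp only [mem_filter, mem_univ, true_and] at hg
    exact ⟨Equiv.ofBijective g (Finite.injective_iff_bijective.1 hg.1), mem_univ _, rfl⟩
  · intro σ _; rfl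

omit [DecidableEq α] in
/-- If the columns of `u` are orthonormal, the norms of the vector of permanents obtained by
adding a row and of the vector of permanents obtained by deleting a column agree. -/
theorem sum_norm_lper_cons (u : α → β → ℂ) (M : Finset α) (Y : Finset β)
    (hu : ∀ b ∈ Y, ∀ b' ∈ Y, ∑ a ∈ M, u a b * starRingEnd ℂ (u a b') = if b = b' then 1 else 0)
    (L : List α) :
    ∑ a ∈ M, ‖lper u (a :: L) Y‖ ^ 2 = ∑ b ∈ Y, ‖lper u L (Y.erase b)‖ ^ 2 := by
  have h : ∀ z : ℂ, ((‖z‖ ^ 2 : ℝ) : ℂ) = z * starRingEnd ℂ z := by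
    intro z; rw [Complex.mul_conj, Complex.normSq_eq_norm_sq]
  apply Complex.ofReal_injective
  simp only [Complex.ofReal_sum, h, lper, map_sum, map_mul, sum_mul_sum]
  rw [sum_comm]
  refine sum_congr rfl fun b hb => ?_
  rw [sum_comm]
  -- For fixed columns `b` and `b'`, the sum over the added row is an entry of the Gram matrix, so
  -- the cross terms vanish.
  calc _ = ∑ b' ∈ Y, (∑ a ∈ M, u a b * starRingEnd ℂ (u a b')) *
        (lper u L (Y.erase b) * starRingEnd ℂ (lper u L (Y.erase b'))) := by
        refine sum_congr rfl fun b' _ => ?_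
        rw [sum_mul]
        exact sum_congr rfl fun a _ => by ring
    _ = _ := by
        rw [sum_congr rfl fun b' hb' => by rw [hu b hb b' hb']]
        simp [hb]

end Permanent

/-! ### The dynamic program along the path -/

/-- The binary code of a finite set of natural numbers. -/
def code (Z : Finset ℕ) : ℕ := ∑ a ∈ Z, 2 ^ a

theorem code_injective : Function.Injective code := geomSum_injective le_rfl

theorem code_insert {Z : Finset ℕ} {a : ℕ} (ha : a ∉ Z) : code (insert a Z) = code Z + 2 ^ a := by
  rw [code, sum_insert ha, add_comm]; rfl

theorem code_erase {Z : Finset ℕ} {a : ℕ} (ha : a ∈ Z) : code (Z.erase a) = code Z - 2 ^ a := by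
  have := code_insert (notMem_erase a Z)
  rw [insert_erase ha] at this
  omega

theorem code_range (k : ℕ) : code (range k) = 2 ^ k - 1 := by
  have := Nat.geomSum_eq (le_refl 2) k
  simpa [code] using this

/-- The set of the entries of `L` at the positions of the binary digits `1` of `x`. -/
def pick (L : List ℕ) (x : ℕ) : Finset ℕ :=
  ((range L.length).filter fun q => x.testBit q).image fun q => L.getD q 0

theorem getD_inj {L : List ℕ} (hL : L.Nodup) {q q' : ℕ} (hq : q < L.length) (hq' : q' < L.length)
    (h : L.getD q 0 = L.getD q' 0) : q = q' := by
  simp only [List.getD_eq_getElem?_getD, List.getElem?_eq_getElem, hq, hq', Option.getD_some] at h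
  exact (hL.getElem_inj_iff).1 h

theorem getD_mem {L : List ℕ} {q : ℕ} (hq : q < L.length) : L.getD q 0 ∈ L := by
  simp [List.getD_eq_getElem?_getD, hq]

theorem exists_getD {L : List ℕ} {a : ℕ} (ha : a ∈ L) : ∃ q < L.length, L.getD q 0 = a := by
  obtain ⟨q, hq, rfl⟩ := List.mem_iff_getElem.1 ha
  exact ⟨q, hq, by simp [List.getD_eq_getElem?_getD, hq]⟩

theorem getD_mem_pick {L : List ℕ} (hL : L.Nodup) {q : ℕ} (hq : q < L.length) (x : ℕ) :
    L.getD q 0 ∈ pick L x ↔ x.testBit q = true := by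
  simp only [pick, mem_image, mem_filter, mem_range]
  constructor
  · rintro ⟨q', ⟨hq', hx⟩, h⟩
    rwa [← getD_inj hL hq' hq h]
  · intro h; exact ⟨q, ⟨hq, h⟩, rfl⟩

theorem pick_subset (L : List ℕ) (x : ℕ) : pick L x ⊆ L.toFinset := by
  intro a ha
  simp only [pick, mem_image, mem_filter, mem_range] at ha
  obtain ⟨q, ⟨hq, -⟩, rfl⟩ := ha
  exact List.mem_toFinset.2 (getD_mem hq)

theorem pick_surj {L : List ℕ} (hL : L.Nodup) {Z : Finset ℕ} (hZ : Z ⊆ L.toFinset) :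
    ∃ x < 2 ^ L.length, pick L x = Z := by
  set B := (range L.length).filter fun q => L.getD q 0 ∈ Z with hB
  have hbit : ∀ q, (code B).testBit q = true ↔ q ∈ B := by
    intro q
    rw [← Nat.mem_bitIndices, ← List.mem_toFinset, code,
      toFinset_bitIndices_sum_two_pow]
  refine ⟨code B, Nat.geomSum_lt le_rfl fun q hq => ?_, ?_⟩
  · simpa using (mem_filter.1 hq).1
  · ext a
    constructor
    · intro ha
      obtain ⟨q, hq, rfl⟩ := exists_getD (List.mem_toFinset.1 (pick_subset _ _ ha))
      rw [getD_mem_pick hL hq, hbit] at ha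
      exact (mem_filter.1 ha).2
    · intro ha
      obtain ⟨q, hq, rfl⟩ := exists_getD (List.mem_toFinset.1 (hZ ha))
      rw [getD_mem_pick hL hq, hbit]
      exact mem_filter.2 ⟨mem_range.2 hq, ha⟩

theorem image_pick {L : List ℕ} (hL : L.Nodup) :
    (range (2 ^ L.length)).image (pick L) = L.toFinset.powerset := by
  ext Z
  simp only [mem_image, mem_range, mem_powerset]
  constructor
  · rintro ⟨x, -, rfl⟩; exact pick_subset L x
  · exact pick_surj hL

theorem pick_injOn {L : List ℕ} (hL : L.Nodup) :
    Set.InjOn (pick L) (range (2 ^ L.length) : Finset ℕ) := by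
  rw [← card_image_iff, image_pick hL, card_powerset, card_range, List.toFinset_card_of_nodup hL]

theorem sum_pick {M : Type*} [AddCommMonoid M] {L : List ℕ} (hL : L.Nodup) (x : ℕ) (F : ℕ → M) :
    ∑ q ∈ range L.length, (if x.testBit q then F (L.getD q 0) else 0) = ∑ a ∈ pick L x, F a := by
  rw [← sum_filter, pick, sum_image]
  intro q hq q' hq' h
  simp only [coe_filter, mem_range, Set.mem_ofPred_eq] at hq hq'
  exact getD_inj hL hq.1 hq'.1 h

theorem sum_not_pick {M : Type*} [AddCommMonoid M] {L : List ℕ} (hL : L.Nodup) (x : ℕ)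
    (F : ℕ → M) :
    ∑ q ∈ range L.length, (if x.testBit q then 0 else F (L.getD q 0)) =
      ∑ a ∈ L.toFinset \ pick L x, F a := by
  have h : L.toFinset \ pick L x =
      ((range L.length).filter fun q => ¬ x.testBit q).image fun q => L.getD q 0 := by
    ext a
    simp only [mem_sdiff, List.mem_toFinset, mem_image, mem_filter, mem_range]
    constructor
    · rintro ⟨ha, hx⟩
      obtain ⟨q, hq, rfl⟩ := exists_getD ha
      rw [getD_mem_pick hL hq] at hx
      exact ⟨q, ⟨hq, hx⟩, rfl⟩
    · rintro ⟨q, ⟨hq, hx⟩, rfl⟩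
      exact ⟨getD_mem hq, by rwa [getD_mem_pick hL hq]⟩
  rw [h, sum_image, sum_filter]
  · exact sum_congr rfl fun q _ => by split_ifs <;> simp_all
  · intro q hq q' hq' h
    simp only [coe_filter, mem_range, Set.mem_ofPred_eq] at hq hq'
    exact getD_inj hL hq.1 hq'.1 h

/-! ### Expired and active rows, and the sets of rows that matter at a column -/

section Path

variable (k : ℕ) (f g : ℕ → ℕ)

/-- The rows whose last column lies before the column `l`. -/
def expired (l : ℕ) : Finset ℕ := (range k).filter fun a => g a < l

/-- The rows of the node of the column `l`. -/
def active (l : ℕ) : List ℕ := (List.range k).filter fun a => f a ≤ l ∧ l ≤ g a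

/-- The sets of rows that contain the expired rows and some rows of the node of the column `l`. -/
def cell (l x : ℕ) : Finset ℕ := expired k g l ∪ pick (active k f g l) x

theorem mem_expired {l a : ℕ} : a ∈ expired k g l ↔ a < k ∧ g a < l := by simp [expired]

theorem mem_active {l a : ℕ} : a ∈ active k f g l ↔ a < k ∧ f a ≤ l ∧ l ≤ g a := by simp [active]

theorem active_nodup (l : ℕ) : (active k f g l).Nodup := List.nodup_range.filter _

theorem active_succ (l : ℕ) : active (k + 1) f g l =
    active k f g l ++ if f k ≤ l ∧ l ≤ g k then [k] else [] := by
  simp only [active, List.range_succ, List.filter_append, List.filter_singleton]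
  congr 1
  by_cases h : f k ≤ l ∧ l ≤ g k <;> simp [h]

theorem expired_succ (l : ℕ) : expired (k + 1) g l =
    if g k < l then insert k (expired k g l) else expired k g l := by
  rw [expired, range_add_one, filter_insert]; rfl

theorem disjoint_expired_pick (l x : ℕ) :
    Disjoint (expired k g l) (pick (active k f g l) x) := by
  rw [disjoint_left]
  intro a ha hb
  have := List.mem_toFinset.1 (pick_subset _ _ hb)
  rw [mem_active] at this
  rw [mem_expired] at ha
  omega

theorem code_cell (l x : ℕ) : code (cell k f g l x) = code (expired k g l) +
    ∑ q ∈ range (active k f g l).length,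
      (if x.testBit q then 2 ^ (active k f g l).getD q 0 else 0) := by
  rw [sum_pick (active_nodup k f g l) x fun a => 2 ^ a, cell, code,
    sum_union (disjoint_expired_pick k f g l x)]
  rfl

theorem cell_injOn (l : ℕ) :
    Set.InjOn (cell k f g l) (range (2 ^ (active k f g l).length) : Finset ℕ) := by
  intro x hx y hy h
  refine pick_injOn (active_nodup k f g l) hx hy ?_
  have h1 := disjoint_expired_pick k f g l x
  have h2 := disjoint_expired_pick k f g l y
  rw [← union_sdiff_cancel_left h1, ← union_sdiff_cancel_left h2]
  exact congrArg (· \ expired k g l) h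

theorem cell_subset_range (l x : ℕ) : cell k f g l x ⊆ range k := by
  intro a ha
  rcases mem_union.1 ha with h | h
  · exact mem_range.2 ((mem_expired k g).1 h).1
  · exact mem_range.2 ((mem_active k f g).1 (List.mem_toFinset.1 (pick_subset _ _ h))).1

/-- A row of `Z` that has begun by `l` and is not expired is active, so `Z` is determined by a
subset of the active rows. -/
theorem exists_cell {l : ℕ} {Z : Finset ℕ} (h1 : expired k g l ⊆ Z) (hZ : Z ⊆ range k)
    (h2 : ∀ a ∈ Z, f a ≤ l) : ∃ x < 2 ^ (active k f g l).length, cell k f g l x = Z := by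
  obtain ⟨x, hx, h⟩ := pick_surj (active_nodup k f g l) (Z := Z \ expired k g l) (by
    intro a ha
    rw [mem_sdiff, mem_expired] at ha
    have hk := mem_range.1 (hZ ha.1)
    rw [List.mem_toFinset, mem_active]
    have := h2 a ha.1
    have := ha.2
    omega)
  exact ⟨x, hx, by rw [cell, h, union_sdiff_of_subset h1]⟩

theorem le_of_mem_cell {l x a : ℕ} (hfg : ∀ a < k, f a ≤ g a) (ha : a ∈ cell k f g l x) :
    f a ≤ l := by
  rcases mem_union.1 ha with h | h
  · rw [mem_expired] at h
    have := hfg a h.1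
    omega
  · exact ((mem_active k f g).1 (List.mem_toFinset.1 (pick_subset _ _ h))).2.1

/-! ### Forward and backward tables of permanents -/

variable (v : ℕ → ℕ → ℂ) (A : Finset ℕ)

/-- The table `T` contains the permanents of the columns before `l` at the codes of all sets of
rows that contain the expired rows. -/
def FwdTable (l : ℕ) (T : ℕ → ℂ) : Prop :=
  ∀ Z ⊆ range k, expired k g l ⊆ Z → T (code Z) = fper v (A.filter (· < l)) Z

/-- The table `T` contains the permanents of the columns from `l` on at the codes of the complements
of all sets of rows that contain the rows whose first column lies after `l`. -/
def BwdTable (l : ℕ) (T : ℕ → ℂ) : Prop :=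
  ∀ Z ⊆ range k, (∀ a ∈ Z, f a ≤ l) →
    T (code Z) = fper v (A.filter (l ≤ ·)) (range k \ Z)

variable {k f g v A} {n : ℕ}

theorem fwdTable_zero {T : ℕ → ℂ} (h0 : T 0 = 1) (h : ∀ z ≠ 0, T z = 0) : FwdTable k g v A 0 T := by
  intro Z _ _
  rw [filter_eq_empty_iff.2 (by simp), fper_empty]
  split_ifs with hZ
  · subst hZ; exact h0
  · exact h _ fun h0 => hZ (code_injective (h0.trans (by simp [code])))

/-- No columns are left, so only the empty complement counts, and `2 ^ k - 1` codes the full set of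
rows. -/
theorem bwdTable_last {T : ℕ → ℂ} (hA : A ⊆ range n) (h1 : T (2 ^ k - 1) = 1)
    (h : ∀ z ≠ 2 ^ k - 1, T z = 0) : BwdTable k f v A n T := by
  intro Z hZ _
  have hA' : A.filter (n ≤ ·) = ∅ := by
    rw [filter_eq_empty_iff]
    intro a ha
    have := mem_range.1 (hA ha)
    omega
  rw [hA', fper_empty]
  rw [← code_range] at h1 h
  split_ifs with hZ'
  · rw [sdiff_eq_empty_iff_subset] at hZ'
    rw [hZ.antisymm hZ', h1]
  · refine h _ fun hc => hZ' ?_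
    rw [code_injective hc, sdiff_self]; rfl

/-- Expansion along column `l`. Expired rows vanish there, and removing an active row keeps all
expired rows, so the old table is consulted only where it is correct. It suffices to write the cells
of `l`: every other relevant set contains a row that begins after `l`, and its entry is rightly
zero. -/
theorem FwdTable.succ {l : ℕ} (hl : l < n) (hfg : ∀ a < k, f a ≤ g a)
    (hv : ∀ a < k, ∀ l < n, v a l ≠ 0 → f a ≤ l ∧ l ≤ g a)
    {T T' : ℕ → ℂ} (hT : FwdTable k g v A l T)
    (h1 : ∀ x < 2 ^ (active k f g l).length, T' (code (cell k f g l x)) =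
      if l ∈ A then ∑ q ∈ range (active k f g l).length,
        (if x.testBit q then v ((active k f g l).getD q 0) l *
          T (code (cell k f g l x) - 2 ^ (active k f g l).getD q 0) else 0)
      else T (code (cell k f g l x)))
    (h2 : ∀ z, (∀ x < 2 ^ (active k f g l).length, z ≠ code (cell k f g l x)) → T' z = 0) :
    FwdTable k g v A (l + 1) T' := by
  intro Z hZ hE
  have hE' : expired k g l ⊆ Z := fun a ha => hE (by
    rw [mem_expired] at ha ⊢; omega)
  by_cases hf : ∀ a ∈ Z, f a ≤ l
  · obtain ⟨x, hx, rfl⟩ := exists_cell k f g hE' hZ hf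
    rw [h1 x hx]
    split_ifs with hlA
    · have hins : A.filter (· < l + 1) = insert l (A.filter (· < l)) := by
        ext b; simp only [mem_filter, mem_insert]
        constructor
        · rintro ⟨hb, hbl⟩
          rcases Nat.lt_succ_iff_lt_or_eq.1 hbl with h | h
          exacts [Or.inr ⟨hb, h⟩, Or.inl h]
        · rintro (rfl | ⟨hb, hbl⟩)
          exacts [⟨hlA, by omega⟩, ⟨hb, by omega⟩]
      rw [hins, fper_insert v (by simp)]
      have hsum := sum_pick (active_nodup k f g l) x fun a =>
        v a l * T (code (cell k f g l x) - 2 ^ a)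
      rw [hsum, cell, sum_union (disjoint_expired_pick k f g l x), ← cell]
      -- Expired rows contribute nothing, so the program's sum over the active rows of the cell is
      -- the whole expansion.
      rw [sum_eq_zero (s := expired k g l), zero_add]
      · refine sum_congr rfl fun a ha => ?_
        have hac : a ∈ cell k f g l x := mem_union_right _ ha
        rw [← code_erase hac, hT _ ((erase_subset _ _).trans hZ)]
        intro b hb
        refine mem_erase.2 ⟨?_, hE' hb⟩
        rintro rfl
        exact disjoint_left.1 (disjoint_expired_pick k f g l x) hb ha
      · intro a ha
        rw [mem_expired] at ha
        have : v a l = 0 := by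
          by_contra h
          have := hv a ha.1 l hl h
          omega
        rw [this, zero_mul]
    · rw [hT _ hZ hE']
      congr 1
      ext b; simp only [mem_filter]
      constructor
      · rintro ⟨hb, hbl⟩; exact ⟨hb, by omega⟩
      · rintro ⟨hb, hbl⟩
        refine ⟨hb, lt_of_le_of_ne (by omega) ?_⟩
        rintro rfl; exact hlA hb
  -- Some row of `Z` begins after `l`: it vanishes on all columns up to `l`, and no cell of `l`
  -- contains it.
  · push Not at hf
    obtain ⟨a, ha, hla⟩ := hf
    rw [h2, fper_eq_zero v ha]
    · intro b hb
      by_contra h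
      have hb' := (mem_filter.1 hb).2
      have := hv a (mem_range.1 (hZ ha)) b (by omega) h
      omega
    · intro x _ h
      rw [code_injective h] at ha
      have := le_of_mem_cell k f g hfg ha
      omega

/-- The mirror image: the sets code the rows used before `l`, and expanding along column `l` adds
one of the unused active rows to them. A set that misses an expired row leaves it to columns on
which it vanishes. -/
theorem BwdTable.pred {l : ℕ} (hl : l < n) (hA : A ⊆ range n)
    (hv : ∀ a < k, ∀ l < n, v a l ≠ 0 → f a ≤ l ∧ l ≤ g a)
    {T T' : ℕ → ℂ} (hT : BwdTable k f v A (l + 1) T)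
    (h1 : ∀ x < 2 ^ (active k f g l).length, T' (code (cell k f g l x)) =
      if l ∈ A then ∑ q ∈ range (active k f g l).length,
        (if x.testBit q then 0 else v ((active k f g l).getD q 0) l *
          T (code (cell k f g l x) + 2 ^ (active k f g l).getD q 0))
      else T (code (cell k f g l x)))
    (h2 : ∀ z, (∀ x < 2 ^ (active k f g l).length, z ≠ code (cell k f g l x)) → T' z = 0) :
    BwdTable k f v A l T' := by
  intro Z hZ hf
  by_cases hE : expired k g l ⊆ Z
  · obtain ⟨x, hx, rfl⟩ := exists_cell k f g hE hZ hf
    rw [h1 x hx]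
    split_ifs with hlA
    · have hins : A.filter (l ≤ ·) = insert l (A.filter (l + 1 ≤ ·)) := by
        ext b; simp only [mem_filter, mem_insert]
        constructor
        · rintro ⟨hb, hbl⟩
          rcases Nat.eq_or_lt_of_le hbl with h | h
          exacts [Or.inl h.symm, Or.inr ⟨hb, h⟩]
        · rintro (rfl | ⟨hb, hbl⟩)
          exacts [⟨hlA, le_rfl⟩, ⟨hb, by omega⟩]
      rw [hins, fper_insert v (by simp)]
      have hsum := sum_not_pick (active_nodup k f g l) x fun a =>
        v a l * T (code (cell k f g l x) + 2 ^ a)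
      rw [hsum]
      symm
      have hsub : (active k f g l).toFinset \ pick (active k f g l) x ⊆
          range k \ cell k f g l x := by
        intro a ha
        rw [mem_sdiff, List.mem_toFinset, mem_active] at ha
        rw [mem_sdiff, mem_range, cell, mem_union, mem_expired, not_or]
        exact ⟨ha.1.1, by omega, ha.2⟩
      -- The unused rows that are not active vanish in column `l`.
      rw [← sum_subset hsub]
      · refine sum_congr rfl fun a ha => ?_
        have hac := (mem_sdiff.1 (hsub ha)).2
        rw [mem_sdiff, List.mem_toFinset, mem_active] at ha
        rw [← code_insert hac, hT]
        · rw [sdiff_insert]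
        · exact insert_subset (mem_range.2 ha.1.1) hZ
        · intro b hb
          rcases mem_insert.1 hb with rfl | hb
          · omega
          · have := hf b hb; omega
      · intro a ha ha'
        have hak := mem_range.1 (mem_sdiff.1 ha).1
        have hac := (mem_sdiff.1 ha).2
        rw [cell, mem_union, not_or] at hac
        have : a ∉ active k f g l := fun h => ha' (mem_sdiff.2 ⟨List.mem_toFinset.2 h, hac.2⟩)
        rw [mem_active] at this
        have : v a l = 0 := by
          by_contra h
          exact this ⟨hak, hv a hak l hl h⟩
        rw [this, zero_mul]
    · rw [hT _ hZ fun a ha => (hf a ha).trans (Nat.le_succ l)]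
      congr 1
      ext b; simp only [mem_filter]
      constructor
      · rintro ⟨hb, hbl⟩; exact ⟨hb, by omega⟩
      · rintro ⟨hb, hbl⟩
        refine ⟨hb, lt_of_le_of_ne hbl ?_⟩
        rintro rfl; exact hlA hb
  · obtain ⟨a, ha, haZ⟩ := not_subset.1 hE
    rw [mem_expired] at ha
    rw [h2, fper_eq_zero v (a := a) (mem_sdiff.2 ⟨mem_range.2 ha.1, haZ⟩)]
    · intro b hb
      by_contra h
      have hb' := mem_filter.1 hb
      have := hv a ha.1 b (mem_range.1 (hA hb'.1)) h
      omega
    · intro x _ h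
      rw [code_injective h] at haZ
      exact haZ (mem_union_left _ ((mem_expired k g).2 ha))

/-- The permanent of all rows and of the columns other than `l`, from the tables on both sides of
`l`. -/
theorem sum_fwdTable_mul_bwdTable {l : ℕ} (hfg : ∀ a < k, f a ≤ g a) (hA : A ⊆ range n)
    (hv : ∀ a < k, ∀ l < n, v a l ≠ 0 → f a ≤ l ∧ l ≤ g a) (hl : l < n)
    {T T' : ℕ → ℂ} (hT : FwdTable k g v A l T) (hT' : BwdTable k f v A (l + 1) T') :
    ∑ x ∈ range (2 ^ (active k f g l).length),
      T (code (cell k f g l x)) * T' (code (cell k f g l x)) = fper v (A.erase l) (range k) := by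
  -- The deleted column splits the others into a left and a right part, to which the Laplace
  -- expansion applies. Outside the cells of `l` one factor vanishes: the left one if `Z` has a row
  -- beginning after `l`, the right one if `Z` misses an expired row.
  have hunion : A.erase l = A.filter (· < l) ∪ A.filter (l + 1 ≤ ·) := by
    ext b; simp only [mem_erase, mem_union, mem_filter, ← and_or_left]
    constructor
    · rintro ⟨h, hb⟩; exact ⟨hb, by omega⟩
    · rintro ⟨hb, h⟩; exact ⟨by omega, hb⟩
  rw [hunion, fper_union v (by
    rw [disjoint_left]; intro b hb hb'
    have := (mem_filter.1 hb).2
    have := (mem_filter.1 hb').2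
    omega)]
  rw [← sum_image (g := cell k f g l) (s := range (2 ^ (active k f g l).length))
    (f := fun Z => T (code Z) * T' (code Z)) (cell_injOn k f g l)]
  have hsub : (range (2 ^ (active k f g l).length)).image (cell k f g l) ⊆
      (range k).powerset := by
    intro Z hZ
    obtain ⟨x, -, rfl⟩ := mem_image.1 hZ
    exact mem_powerset.2 (cell_subset_range k f g l x)
  rw [← sum_subset hsub]
  · refine sum_congr rfl fun Z hZ => ?_
    obtain ⟨x, -, rfl⟩ := mem_image.1 hZ
    have hc := cell_subset_range k f g l x
    rw [hT _ hc subset_union_left, hT' _ hc]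
    intro a ha
    exact (le_of_mem_cell k f g hfg ha).trans (Nat.le_succ l)
  · intro Z hZ hZ'
    rw [mem_powerset] at hZ
    by_cases hE : expired k g l ⊆ Z
    · have : ∃ a ∈ Z, l < f a := by
        by_contra h
        push Not at h
        obtain ⟨x, hx, rfl⟩ := exists_cell k f g hE hZ h
        exact hZ' (mem_image_of_mem _ (mem_range.2 hx))
      obtain ⟨a, ha, hla⟩ := this
      rw [fper_eq_zero v ha, zero_mul]
      intro b hb
      by_contra h
      have hb' := (mem_filter.1 hb).2
      have := hv a (mem_range.1 (hZ ha)) b (by omega) h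
      omega
    · obtain ⟨a, ha, haZ⟩ := not_subset.1 hE
      rw [mem_expired] at ha
      rw [fper_eq_zero v (Y := A.filter (l + 1 ≤ ·)) (a := a)
        (mem_sdiff.2 ⟨mem_range.2 ha.1, haZ⟩), mul_zero]
      intro b hb
      by_contra h
      have hb' := mem_filter.1 hb
      have := hv a ha.1 b (mem_range.1 (hA hb'.1)) h
      omega

end Path

/-! ### The programs for the tables -/

/-- Sequential composition. -/
local infixr:60 " ;; " => Program.seq

/-- The last binary digit of register `v`. -/
def oddExp (v : ℕ) : NatExp := .sub (.reg v) (.add (.half (.reg v)) (.half (.reg v)))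

/-- For every position `q` (register `14`) in the list of the active rows of the column in register
`15`, run `p₁` or `p₀`, according to the binary digit `q` of register `11`. -/
def bitLoop (p₀ p₁ : Program) : Program :=
  setReg 12 (.reg 11) ;;
  loop 14 (.read 11 (.reg 15) (.const 0)) (.ifZero (oddExp 12) p₀ p₁ ;; setReg 12 (.half (.reg 12)))

/-- After `q` rounds register `12` holds `x / 2 ^ q`, whose parity is digit `q` of `x`. The
invariant `J` has to tolerate changes of the registers `12` and `14`, which the loop itself writes.
-/
theorem bitLoop_hoare {p₀ p₁ : Program} {s : State} {x l w t : ℕ} (hx : s.reg 11 = x)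
    (hl : s.reg 15 = l) (hw : s.nat 11 l 0 = w) (h0 : p₀.wReg 12 = false) (h1 : p₁.wReg 12 = false)
    (J : ℕ → State → Prop) (hJ12 : ∀ q s' y, J q s' → J q (s'.setReg 12 y))
    (hJ14 : ∀ q s' y, J q s' → J q (s'.setReg 14 y)) (hJ0 : J 0 s)
    (hstep : ∀ q < w, ∀ s', J q s' → Frame (bitLoop p₀ p₁) s s' → s'.reg 14 = q →
      Hoare (if x.testBit q then p₁ else p₀) s' t (J (q + 1))) :
    Hoare (bitLoop p₀ p₁) s (w * (t + 12) + 6) (J w) := by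
  refine Hoare.seq (t₁ := 2) (t₂ := w * (t + 12) + 4) (Q := fun s' => s' = s.setReg 12 x)
    (Hoare.block rfl le_rfl (by simp [Program.run, NatExp.eval, hx])) ?_ (by omega)
  rintro s1 rfl -
  refine (Hoare.loop (t := t + 11) (fun q s' => J q s' ∧ s'.reg 12 = x / 2 ^ q) w ?_ ?_ ?_
    ?_).mono le_rfl fun s' h _ => h.1
  · simp [NatExp.eval, State.setReg, hl, hw]
  · exact ⟨hJ12 _ _ _ hJ0, by simp [State.setReg]⟩
  · rintro q hq s' ⟨hJ, hy⟩ hF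
    have hFr : Frame (bitLoop p₀ p₁) s (s'.setReg 14 q) := by
      refine Frame.trans (Frame.trans (s' := s.setReg 12 x) ?_ ?_)
        (s' := s') (Frame.of_sub (p := .loop 14 (.const 0) .skip) (Frame.loop_setReg _ _ _ _ _)
          ?_ ?_ ?_)
      · refine ⟨fun u hu => ?_, fun _ _ => rfl, fun _ _ => rfl⟩
        simp [bitLoop, Program.wReg] at hu
        simp [State.setReg, hu]
      · refine hF.of_sub ?_ ?_ ?_ <;> simp +contextual [bitLoop, wReg, wNat, wCpx]
      all_goals simp +contextual [bitLoop, wReg, wNat, wCpx]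
    have hbit := hstep q hq _ (hJ14 q s' q hJ) hFr (by simp [State.setReg])
    have hodd : (oddExp 12).eval (s'.setReg 14 q) = (x / 2 ^ q) % 2 := by
      simp only [oddExp, NatExp.eval, State.setReg]
      norm_num [hy]
      omega
    have htb : x.testBit q = decide ((x / 2 ^ q) % 2 = 1) := Nat.testBit_eq_decide_div_mod_eq
    refine Hoare.seq (t₁ := t + 8) (t₂ := 3)
      (Q := fun s'' => J (q + 1) s'' ∧ s''.reg 12 = x / 2 ^ q) ?_ ?_ (by omega)
    · refine Hoare.ifZero (t := t) (fun h => ?_) (fun h => ?_) (by simp [oddExp, NatExp.cost]; omega)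
      · rw [hodd] at h
        rw [htb, h] at hbit
        refine (show Hoare p₀ _ _ _ from hbit).mono le_rfl fun s'' h hf => ⟨h, ?_⟩
        rw [hf.reg 12 h0]
        simp [State.setReg, hy]
      · rw [hodd] at h
        have h' : x / 2 ^ q % 2 = 1 := by omega
        rw [htb, h'] at hbit
        refine (show Hoare p₁ _ _ _ from hbit).mono le_rfl fun s'' h hf => ⟨h, ?_⟩
        rw [hf.reg 12 h1]
        simp [State.setReg, hy]
    · rintro s'' ⟨hJ', hy'⟩ -
      refine Hoare.block rfl le_rfl ?_
      simp only [Program.run]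
      refine ⟨hJ12 _ _ _ hJ', ?_⟩
      simp [State.setReg, NatExp.eval, hy', pow_succ, Nat.div_div_eq_div_mul]
  · simp only [NatExp.cost, Nat.add_assoc, Nat.reduceAdd]
    omega

/-- The arrays `9` to `13` describe the expired and the active rows of the columns before `n`. -/
structure Layout (k n : ℕ) (f g : ℕ → ℕ) (s : State) : Prop where
  pow : ∀ a < k, s.nat 9 a 0 = 2 ^ a
  act : ∀ l < n, ∀ q < (active k f g l).length, s.nat 10 l q = (active k f g l).getD q 0
  cnt : ∀ l < n, s.nat 11 l 0 = (active k f g l).length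
  exp : ∀ l < n, s.nat 12 l 0 = code (expired k g l)
  two : ∀ l < n, s.nat 13 l 0 = 2 ^ (active k f g l).length

theorem Layout.congr {k n : ℕ} {f g : ℕ → ℕ} {s s' : State} (h : Layout k n f g s)
    (h' : ∀ a, 9 ≤ a → a ≤ 13 → s'.nat a = s.nat a) : Layout k n f g s' := by
  obtain ⟨h1, h2, h3, h4, h5⟩ := h
  constructor
  · rwa [h' 9 (by norm_num) (by norm_num)]
  · rwa [h' 10 (by norm_num) (by norm_num)]
  · rwa [h' 11 (by norm_num) (by norm_num)]
  · rwa [h' 12 (by norm_num) (by norm_num)]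
  · rwa [h' 13 (by norm_num) (by norm_num)]

theorem Layout.frame {k n : ℕ} {f g : ℕ → ℕ} {s s' : State} {p : Program}
    (h : Layout k n f g s) (hF : Frame p s s')
    (hp : ((List.range 5).all fun i => !p.wNat (i + 9)) = true) : Layout k n f g s' := by
  refine h.congr fun a ha ha' => hF.nat a ?_
  rw [List.all_eq_true] at hp
  have := hp (a - 9) (List.mem_range.2 (by omega))
  rw [Nat.sub_add_cancel ha] at this
  simpa using this

/-- The active row number `q` (register `14`) of the column in register `15`. -/
def actExp : NatExp := .read 10 (.reg 15) (.reg 14)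

/-- The power of two for the active row number `q`. -/
def powExp : NatExp := .read 9 actExp (.const 0)

/-- The matrix entry for the active row number `q` and the column in register `15`. -/
def ampExp : CpxExp := .read 0 (.read 3 actExp (.const 0)) (.read 0 (.reg 15) (.const 0))

/-- Write the code of the set number `x` (register `11`) to register `13`. -/
def codeProg : Program :=
  setReg 13 (.read 12 (.reg 15) (.const 0)) ;;
  bitLoop skip (setReg 13 (.add (.reg 13) powExp))

theorem codeProg_hoare {k n l x : ℕ} {f g : ℕ → ℕ} {s : State} (h : Layout k n f g s) (hl : l < n)
    (hl' : s.reg 15 = l) (hx : s.reg 11 = x) {ω : ℕ} (hω : (active k f g l).length ≤ ω) :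
    Hoare codeProg s (20 * ω + 10) (fun s' => s'.reg 13 = code (cell k f g l x)) := by
  refine Hoare.seq (t₁ := 4) (t₂ := 20 * ω + 6) (Q := fun s' => s' = s.setReg 13 (s.nat 12 l 0))
    (Hoare.block rfl le_rfl (by simp [Program.run, NatExp.eval, hl'])) ?_ (by omega)
  rintro s1 rfl -
  refine (bitLoop_hoare (x := x) (l := l) (w := (active k f g l).length) (t := 8) ?_ ?_ ?_ rfl rfl
    (fun q s' => s'.reg 13 = code (expired k g l) + ∑ q' ∈ range q,
      (if x.testBit q' then 2 ^ (active k f g l).getD q' 0 else 0)) ?_ ?_ ?_ ?_).mono ?_ ?_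
  · simpa [State.setReg] using hx
  · simpa [State.setReg] using hl'
  · simpa [State.setReg] using h.cnt l hl
  · intro q s' y hs; simpa [State.setReg] using hs
  · intro q s' y hs; simpa [State.setReg] using hs
  · simpa [State.setReg] using h.exp l hl
  · intro q hq s' hs hF h14
    rw [sum_range_succ]
    have h15 : s'.reg 15 = l := by rw [hF.reg 15 rfl]; simpa [State.setReg] using hl'
    have h10 : s'.nat 10 l q = (active k f g l).getD q 0 := by
      rw [hF.nat 10 rfl]; exact h.act l hl q hq
    have h9 : s'.nat 9 ((active k f g l).getD q 0) 0 = 2 ^ (active k f g l).getD q 0 := by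
      rw [hF.nat 9 rfl]; exact h.pow _ ((mem_active k f g).1 (getD_mem hq)).1
    split_ifs with hb
    · refine Hoare.block rfl (by decide) ?_
      simp only [Program.run, powExp, actExp, NatExp.eval, State.setReg]
      simp only [if_true, h14, h15, h10, h9, hs]
      omega
    · exact Hoare.block rfl (by decide) (by simpa [Program.run] using hs)
  · omega
  · intro s' hs _
    rw [hs, code_cell]

/-- The sum of the register `15`, the register `5` and of the constant `i`. -/
def rowExp (i : ℕ) : NatExp := .add (.add (.reg 5) (.reg 15)) (.const i)

/-- Compute the tables of the permanents of the columns before `l`. -/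
def fwdProg : Program :=
  setCpx 1 (.reg 5) (.const 0) (.ofNat (.const 1)) ;;
  loop 15 (.reg 0) (
    loop 11 (.read 13 (.reg 15) (.const 0)) (
      codeProg ;;
      .ifZero (.read 4 (.reg 15) (.const 0))
        (setCpx 1 (rowExp 1) (.reg 13) (.read 1 (rowExp 0) (.reg 13)))
        (bitLoop skip (setCpx 1 (rowExp 1) (.reg 13) (.add (.read 1 (rowExp 1) (.reg 13))
          (.mul ampExp (.read 1 (rowExp 0) (.sub (.reg 13) powExp))))))))

/-- Each column has at most `2 ^ ω` cells, and each cell costs `O(ω)` for its code and its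
expansion. The tables are addressed by the code of a set and never cleared; they occupy rows of the
array from `b` on that are still zero. -/
theorem fwdProg_hoare {k n : ℕ} {f g : ℕ → ℕ} {s : State} {v : ℕ → ℕ → ℂ} {A : Finset ℕ} {ω b : ℕ}
    (h : Layout k n f g s) (hn : s.reg 0 = n) (hb : s.reg 5 = b)
    (hω : ∀ l < n, (active k f g l).length ≤ ω) (hfg : ∀ a < k, f a ≤ g a)
    (hv : ∀ a < k, ∀ l < n, v a l ≠ 0 → f a ≤ l ∧ l ≤ g a)
    (hv' : ∀ a < k, ∀ l < n, s.cpx 0 (s.nat 3 a 0) (s.nat 0 l 0) = v a l)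
    (hA : ∀ l < n, s.nat 4 l 0 = if l ∈ A then 1 else 0)
    (hfresh : ∀ i ≥ b, s.cpx 1 i = 0) :
    Hoare fwdProg s (n * (2 ^ ω * (100 * ω + 50) + 10) + 10)
      (fun s' => (∀ l ≤ n, FwdTable k g v A l (s'.cpx 1 (b + l))) ∧
        ∀ i > b + n, s'.cpx 1 i = 0) := by
  refine Hoare.seq (t₁ := 5) (t₂ := n * (2 ^ ω * (100 * ω + 50) + 10) + 5)
    (Q := fun s' => s' = s.setCpx 1 b 0 1)
    (Hoare.block rfl le_rfl (by simp [Program.run, NatExp.eval, CpxExp.eval, hb])) ?_ (by omega)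
  rintro s1 hs1 hF1
  have h1 : Layout k n f g s1 := h.frame hF1 rfl
  refine (Hoare.loop (t := 2 ^ ω * (100 * ω + 50) + 5) (fun l s' =>
    (∀ l' ≤ l, FwdTable k g v A l' (s'.cpx 1 (b + l'))) ∧ ∀ i > b + l, s'.cpx 1 i = 0) n ?_ ?_ ?_
    ?_)
  · simp [NatExp.eval, hs1, hn, State.setCpx]
  · refine ⟨fun l' hl' => ?_, fun i hi => ?_⟩
    · obtain rfl : l' = 0 := by omega
      refine fwdTable_zero ?_ fun z hz => ?_
      · simp [hs1, State.setCpx]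
      · simp [hs1, State.setCpx, hz, hfresh]
    · funext z
      rw [hs1]
      have : i ≠ b := by omega
      simp only [State.setCpx, this, false_and, and_false, if_false]
      rw [hfresh i (by omega)]
  · rintro l hl s2 ⟨hT, hz⟩ hF2
    set s3 := s2.setReg 15 l with hs3
    have hF3 : Frame (loop 15 (.const 0) skip) s2 s3 := Frame.loop_setReg _ _ _ _ _
    have h3 : Layout k n f g s3 := (h1.frame hF2 rfl).frame hF3 rfl
    have hc3 : s3.cpx 1 = s2.cpx 1 := rfl
    have h15 : s3.reg 15 = l := by simp [hs3, State.setReg]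
    have h5 : s3.reg 5 = b := by
      rw [hF3.reg 5 rfl, hF2.reg 5 rfl, hF1.reg 5 rfl, hb]
    have hv3 : ∀ a < k, ∀ l < n, s3.cpx 0 (s3.nat 3 a 0) (s3.nat 0 l 0) = v a l := by
      rw [hF3.cpx 0 rfl, hF2.cpx 0 rfl, hF1.cpx 0 rfl, hF3.nat 3 rfl, hF2.nat 3 rfl,
        hF1.nat 3 rfl, hF3.nat 0 rfl, hF2.nat 0 rfl, hF1.nat 0 rfl]
      exact hv'
    have hA3 : ∀ l < n, s3.nat 4 l 0 = if l ∈ A then 1 else 0 := by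
      rw [hF3.nat 4 rfl, hF2.nat 4 rfl, hF1.nat 4 rfl]
      exact hA
    set w := (active k f g l).length with hw
    have hwω : w ≤ ω := hω l hl
    refine (Hoare.loop (t := 100 * ω + 49) (fun x s' =>
      (∀ i, i ≠ b + l + 1 → s'.cpx 1 i = s2.cpx 1 i) ∧
      (∀ x' < x, s'.cpx 1 (b + l + 1) (code (cell k f g l x')) =
        if l ∈ A then ∑ q ∈ range w, (if x'.testBit q then v ((active k f g l).getD q 0) l *
          s2.cpx 1 (b + l) (code (cell k f g l x') - 2 ^ (active k f g l).getD q 0) else 0)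
        else s2.cpx 1 (b + l) (code (cell k f g l x'))) ∧
      ∀ z, (∀ x' < x, z ≠ code (cell k f g l x')) → s'.cpx 1 (b + l + 1) z = 0) (2 ^ w)
      ?_ ?_ ?_ ?_).mono le_rfl ?_
    · simp [NatExp.eval, h15, h3.two l hl, hw]
    · refine ⟨fun i hi => by rw [hc3], fun x' hx' => absurd hx' (by omega), fun z _ => ?_⟩
      rw [hc3, hz _ (by omega)]; rfl
    · rintro x hx s4 ⟨hi1, hi2, hi3⟩ hF4
      set s5 := s4.setReg 11 x with hs5
      have hF5 : Frame (loop 11 (.const 0) skip) s4 s5 := Frame.loop_setReg _ _ _ _ _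
      have h5' : Layout k n f g s5 := (h3.frame hF4 rfl).frame hF5 rfl
      have h15' : s5.reg 15 = l := by rw [hF5.reg 15 rfl, hF4.reg 15 rfl, h15]
      have h11 : s5.reg 11 = x := by simp [hs5, State.setReg]
      -- Different cells have different codes, so the entry of the current cell is still zero and
      -- can serve as the accumulator.
      have hz0 : ∀ x' < x, code (cell k f g l x) ≠ code (cell k f g l x') := by
        intro x' hx' he
        have := cell_injOn k f g l (by simpa using hx) (by simpa using hx'.trans hx)
          (code_injective he)
        omega
      set z := code (cell k f g l x) with hzdef
      refine Hoare.seq (t₁ := 20 * ω + 10) (t₂ := 80 * ω + 39)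
        (codeProg_hoare h5' hl h15' h11 hwω) ?_ (by omega)
      intro s6 h13 hF6
      rw [← hzdef] at h13
      have hc6 : s6.cpx 1 = s4.cpx 1 := by rw [hF6.cpx 1 rfl, hF5.cpx 1 rfl]
      have h15'' : s6.reg 15 = l := by rw [hF6.reg 15 rfl, h15']
      have h11' : s6.reg 11 = x := by rw [hF6.reg 11 rfl, h11]
      have h5'' : s6.reg 5 = b := by rw [hF6.reg 5 rfl, hF5.reg 5 rfl, hF4.reg 5 rfl, h5]
      have h6 : Layout k n f g s6 := h5'.frame hF6 rfl
      have hA6 : s6.nat 4 l 0 = if l ∈ A then 1 else 0 := by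
        rw [hF6.nat 4 rfl, hF5.nat 4 rfl, hF4.nat 4 rfl]
        exact hA3 l hl
      have hv6 : ∀ a < k, s6.cpx 0 (s6.nat 3 a 0) (s6.nat 0 l 0) = v a l := by
        rw [hF6.cpx 0 rfl, hF5.cpx 0 rfl, hF4.cpx 0 rfl, hF6.nat 3 rfl, hF5.nat 3 rfl,
          hF4.nat 3 rfl, hF6.nat 0 rfl, hF5.nat 0 rfl, hF4.nat 0 rfl]
        exact fun a ha => hv3 a ha l hl
      have hentry : s6.cpx 1 (b + l + 1) z = 0 := by rw [hc6]; exact hi3 z hz0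
      have hsrc : s6.cpx 1 (b + l) = s2.cpx 1 (b + l) := by rw [hc6]; exact hi1 _ (by omega)
      -- it suffices to write the right value to the entry `z` and nothing else
      have hfin : ∀ s7 : State, (∀ i z', ¬ (i = b + l + 1 ∧ z' = z) →
          s7.cpx 1 i z' = s6.cpx 1 i z') →
          (s7.cpx 1 (b + l + 1) z = if l ∈ A then ∑ q ∈ range w,
            (if x.testBit q then v ((active k f g l).getD q 0) l *
              s2.cpx 1 (b + l) (z - 2 ^ (active k f g l).getD q 0) else 0)
            else s2.cpx 1 (b + l) z) →
          ((∀ i, i ≠ b + l + 1 → s7.cpx 1 i = s2.cpx 1 i) ∧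
          (∀ x' < x + 1, s7.cpx 1 (b + l + 1) (code (cell k f g l x')) =
            if l ∈ A then ∑ q ∈ range w, (if x'.testBit q then v ((active k f g l).getD q 0) l *
              s2.cpx 1 (b + l) (code (cell k f g l x') - 2 ^ (active k f g l).getD q 0) else 0)
            else s2.cpx 1 (b + l) (code (cell k f g l x'))) ∧
          ∀ z', (∀ x' < x + 1, z' ≠ code (cell k f g l x')) →
            s7.cpx 1 (b + l + 1) z' = 0) := by
        intro s7 ho hval
        refine ⟨fun i hi => ?_, fun x' hx' => ?_, fun z' hz' => ?_⟩
        · funext z'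
          rw [ho i z' (by tauto), hc6, hi1 i hi]
        · rcases Nat.lt_succ_iff_lt_or_eq.1 hx' with hlt | rfl
          · rw [ho _ _ (fun hh => hz0 x' hlt hh.2.symm), hc6]
            exact hi2 x' hlt
          · exact hval
        · rw [ho _ _ (fun hh => hz' x (by omega) hh.2), hc6]
          exact hi3 z' fun x' hx' => hz' x' (by omega)
      refine Hoare.ifZero (t := 80 * ω + 34) (fun he => ?_) (fun he => ?_)
        (by simp only [NatExp.cost]; omega)
      · have hlA : l ∉ A := by
          intro hl'
          simp [NatExp.eval, h15'', hA6, hl'] at he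
        refine Hoare.block rfl (le_trans (b := 30) (by decide) (by omega)) (hfin _ ?_ ?_)
        · intro i z' hne
          simp [Program.run, rowExp, NatExp.eval, CpxExp.eval, State.setCpx, h15'', h5'', h13, hne]
        · simp [Program.run, rowExp, NatExp.eval, CpxExp.eval, State.setCpx, h15'', h5'', h13, hlA,
            hsrc]
      · have hlA : l ∈ A := by
          by_contra hl'
          simp [NatExp.eval, h15'', hA6, hl'] at he
        refine (bitLoop_hoare (x := x) (l := l) (w := w) (t := 40) h11' h15'' (h6.cnt l hl) rfl rfl
          (fun q s' => s'.reg 13 = z ∧ (∀ i z', ¬ (i = b + l + 1 ∧ z' = z) →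
            s'.cpx 1 i z' = s6.cpx 1 i z') ∧ s'.cpx 1 (b + l + 1) z = ∑ q' ∈ range q,
              (if x.testBit q' then v ((active k f g l).getD q' 0) l *
                s2.cpx 1 (b + l) (z - 2 ^ (active k f g l).getD q' 0) else 0)) ?_ ?_ ?_ ?_).mono
            (by omega) ?_
        · rintro q s' y ⟨ha, hb, hc⟩
          exact ⟨by simpa [State.setReg] using ha, hb, hc⟩
        · rintro q s' y ⟨ha, hb, hc⟩
          exact ⟨by simpa [State.setReg] using ha, hb, hc⟩
        · exact ⟨h13, fun _ _ _ => rfl, by simpa using hentry⟩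
        · rintro q hq s7 ⟨ha, ho, hval⟩ hF7 h14
          rw [sum_range_succ]
          have g15 : s7.reg 15 = l := by rw [hF7.reg 15 rfl, h15'']
          have g5 : s7.reg 5 = b := by rw [hF7.reg 5 rfl, h5'']
          have hak := ((mem_active k f g).1 (getD_mem hq)).1
          have g10 : s7.nat 10 l q = (active k f g l).getD q 0 := by
            rw [hF7.nat 10 rfl]; exact h6.act l hl q hq
          have g9 : s7.nat 9 ((active k f g l).getD q 0) 0 = 2 ^ (active k f g l).getD q 0 := by
            rw [hF7.nat 9 rfl]; exact h6.pow _ hak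
          have gv : s7.cpx 0 (s7.nat 3 ((active k f g l).getD q 0) 0) (s7.nat 0 l 0) =
              v ((active k f g l).getD q 0) l := by
            rw [hF7.cpx 0 rfl, hF7.nat 3 rfl, hF7.nat 0 rfl]; exact hv6 _ hak
          have gs : ∀ z', s7.cpx 1 (b + l) z' = s2.cpx 1 (b + l) z' := by
            intro z'
            rw [ho _ _ (by omega), hsrc]
          split_ifs with hbit
          · refine Hoare.block rfl (by decide) ⟨?_, fun i z' hne => ?_, ?_⟩
            · simpa [Program.run, State.setCpx] using ha
            · rw [← ho i z' hne]
              simp [Program.run, rowExp, NatExp.eval, State.setCpx, g15, g5, ha, hne]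
            · simp only [Program.run, rowExp, powExp, ampExp, actExp, NatExp.eval, CpxExp.eval,
                State.setCpx, g15, g5, ha, h14, g10, g9, gv, add_zero, gs, hval]
              simp
          · refine Hoare.block rfl (by decide) ⟨ha, ho, ?_⟩
            simpa [Program.run] using hval
        · rintro s7 ⟨-, ho, hval⟩ -
          exact hfin s7 ho (by rw [hval, if_pos hlA])
    · simp only [NatExp.cost]
      have h2 : 2 ^ w ≤ 2 ^ ω := Nat.pow_le_pow_right (by norm_num) hwω
      have := Nat.mul_le_mul_right (100 * ω + 50) h2
      simp only [Nat.add_assoc, Nat.reduceAdd]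
      omega
    · rintro s4 ⟨hi1, hi2, hi3⟩ -
      refine ⟨fun l' hl' => ?_, fun i hi => ?_⟩
      · rcases Nat.lt_succ_iff_lt_or_eq.1 (Nat.lt_succ_of_le hl') with hlt | rfl
        · rw [hi1 _ (by omega)]
          exact hT l' (by omega)
        · exact (hT l le_rfl).succ hl hfg hv hi2 hi3
      · rw [hi1 _ (by omega), hz _ (by omega)]
  · simp only [NatExp.cost]
    have : n * (2 ^ ω * (100 * ω + 50) + 5 + 1) ≤ n * (2 ^ ω * (100 * ω + 50) + 10) :=
      Nat.mul_le_mul_left _ (by omega)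
    omega

/-- Compute the tables of the permanents of the columns from `l` on, and, for every selected column
`l`, the permanent of the other selected columns. -/
def bwdProg : Program :=
  setCpx 2 (.add (.reg 5) (.reg 0)) (.sub (.reg 6) (.const 1)) (.ofNat (.const 1)) ;;
  loop 10 (.reg 0) (
    setReg 15 (.sub (.sub (.reg 0) (.reg 10)) (.const 1)) ;;
    setCpx 3 (.reg 15) (.const 0) (.ofNat (.const 0)) ;;
    loop 11 (.read 13 (.reg 15) (.const 0)) (
      codeProg ;;
      .ifZero (.read 4 (.reg 15) (.const 0))
        (setCpx 2 (rowExp 0) (.reg 13) (.read 2 (rowExp 1) (.reg 13)))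
        (setCpx 3 (.reg 15) (.const 0) (.add (.read 3 (.reg 15) (.const 0))
            (.mul (.read 1 (rowExp 0) (.reg 13)) (.read 2 (rowExp 1) (.reg 13)))) ;;
         bitLoop (setCpx 2 (rowExp 0) (.reg 13) (.add (.read 2 (rowExp 0) (.reg 13))
          (.mul ampExp (.read 2 (rowExp 1) (.add (.reg 13) powExp))))) skip)))

/-- The minor without column `l` is accumulated during the same pass over the cells of `l`: it needs
only the forward table at `l` and the backward table at `l + 1`, both complete by then. -/
theorem bwdProg_hoare {k n : ℕ} {f g : ℕ → ℕ} {s : State} {v : ℕ → ℕ → ℂ} {A : Finset ℕ} {ω b : ℕ}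
    (h : Layout k n f g s) (hn : s.reg 0 = n) (hb : s.reg 5 = b) (hk : s.reg 6 = 2 ^ k)
    (hω : ∀ l < n, (active k f g l).length ≤ ω) (hfg : ∀ a < k, f a ≤ g a)
    (hv : ∀ a < k, ∀ l < n, v a l ≠ 0 → f a ≤ l ∧ l ≤ g a)
    (hv' : ∀ a < k, ∀ l < n, s.cpx 0 (s.nat 3 a 0) (s.nat 0 l 0) = v a l)
    (hAn : A ⊆ range n) (hA : ∀ l < n, s.nat 4 l 0 = if l ∈ A then 1 else 0)
    (hT : ∀ l ≤ n, FwdTable k g v A l (s.cpx 1 (b + l)))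
    (hfresh : ∀ i ≥ b, s.cpx 2 i = 0) :
    Hoare bwdProg s (n * (2 ^ ω * (100 * ω + 70) + 20) + 15)
      (fun s' => (∀ l < n, s'.cpx 3 l 0 = if l ∈ A then fper v (A.erase l) (range k) else 0) ∧
        ∀ i > b + n, s'.cpx 2 i = 0) := by
  refine Hoare.seq (t₁ := 9) (t₂ := n * (2 ^ ω * (100 * ω + 70) + 20) + 5)
    (Q := fun s' => s' = s.setCpx 2 (b + n) (2 ^ k - 1) 1)
    (Hoare.block rfl le_rfl (by simp [Program.run, NatExp.eval, CpxExp.eval, hb, hn, hk])) ?_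
    (by omega)
  rintro s1 hs1 hF1
  have h1 : Layout k n f g s1 := h.frame hF1 rfl
  refine (Hoare.loop (t := 2 ^ ω * (100 * ω + 70) + 19) (fun N s' =>
    (∀ l, n - N ≤ l → l ≤ n → BwdTable k f v A l (s'.cpx 2 (b + l))) ∧
    (∀ i ≥ b, ¬ (b + (n - N) ≤ i ∧ i ≤ b + n) → s'.cpx 2 i = 0) ∧
    ∀ l, n - N ≤ l → l < n →
      s'.cpx 3 l 0 = if l ∈ A then fper v (A.erase l) (range k) else 0) n ?_ ?_ ?_
    ?_).mono le_rfl ?_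
  · simp [NatExp.eval, hs1, hn, State.setCpx]
  · refine ⟨fun l hl hl' => ?_, fun i hi hi' => ?_, fun l hl hl' => by omega⟩
    · obtain rfl : l = n := by omega
      refine bwdTable_last hAn ?_ fun z hz => ?_
      · simp [hs1, State.setCpx]
      · simp [hs1, State.setCpx, hz, hfresh]
    · funext z
      rw [hs1]
      have : i ≠ b + n := by omega
      simp only [State.setCpx, this, false_and, and_false, if_false]
      rw [hfresh i (by omega)]
  · rintro N hN s2 ⟨hV, hz, hM⟩ hF2
    -- The counter runs upwards, the columns downwards from `n - 1`.
    obtain ⟨l, hlN, hl⟩ : ∃ l, n - N = l + 1 ∧ l < n := ⟨n - N - 1, by omega, by omega⟩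
    rw [hlN] at hV hz hM
    have hlN' : n - (N + 1) = l := by omega
    rw [hlN']
    have h0 : s2.reg 0 = n := by rw [hF2.reg 0 rfl, hF1.reg 0 rfl, hn]
    refine Hoare.seq (t₁ := 6) (t₂ := 2 ^ ω * (100 * ω + 70) + 13)
      (Q := fun s' => s' = (s2.setReg 10 N).setReg 15 l)
      (Hoare.block rfl le_rfl (by
        simp only [Program.run, NatExp.eval]
        simp only [State.setReg, if_true, h0]
        simp [hlN])) ?_ (by omega)
    intro s2a hs2a _
    refine Hoare.seq (t₁ := 5) (t₂ := 2 ^ ω * (100 * ω + 70) + 8)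
      (Q := fun s' => s' = s2a.setCpx 3 l 0 0)
      (Hoare.block rfl le_rfl (by
        simp only [Program.run, NatExp.eval, CpxExp.eval, hs2a]
        simp [State.setReg])) ?_ (by omega)
    intro s3 hs3 _
    have hF3 : Frame (setReg 10 (.const 0) ;; setReg 15 (.const 0) ;;
        setCpx 3 (.const 0) (.const 0) (.ofNat (.const 0))) s2 s3 := by
      rw [hs3, hs2a]
      refine ⟨fun u hu => ?_, fun a ha => rfl, fun a ha => ?_⟩
      · simp [Program.wReg] at hu
        simp [State.setReg, State.setCpx, hu]
      · simp [Program.wCpx] at ha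
        simp [State.setReg, State.setCpx, ha]
    have h3 : Layout k n f g s3 := (h1.frame hF2 rfl).frame hF3 rfl
    have hc3 : s3.cpx 2 = s2.cpx 2 := hF3.cpx 2 rfl
    have hc3' : ∀ l', l' ≠ l → s3.cpx 3 l' 0 = s2.cpx 3 l' 0 := by
      intro l' hl'
      rw [hs3, hs2a]
      simp [State.setReg, State.setCpx, hl']
    have hc3'' : s3.cpx 3 l 0 = 0 := by
      rw [hs3]
      simp [State.setCpx]
    have h15 : s3.reg 15 = l := by simp [hs3, hs2a, State.setReg, State.setCpx]
    have h5 : s3.reg 5 = b := by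
      rw [hF3.reg 5 rfl, hF2.reg 5 rfl, hF1.reg 5 rfl, hb]
    have hv3 : ∀ a < k, ∀ l < n, s3.cpx 0 (s3.nat 3 a 0) (s3.nat 0 l 0) = v a l := by
      rw [hF3.cpx 0 rfl, hF2.cpx 0 rfl, hF1.cpx 0 rfl, hF3.nat 3 rfl, hF2.nat 3 rfl,
        hF1.nat 3 rfl, hF3.nat 0 rfl, hF2.nat 0 rfl, hF1.nat 0 rfl]
      exact hv'
    have hA3 : ∀ l < n, s3.nat 4 l 0 = if l ∈ A then 1 else 0 := by
      rw [hF3.nat 4 rfl, hF2.nat 4 rfl, hF1.nat 4 rfl]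
      exact hA
    have hT3 : s3.cpx 1 = s.cpx 1 := by rw [hF3.cpx 1 rfl, hF2.cpx 1 rfl, hF1.cpx 1 rfl]
    set w := (active k f g l).length with hw
    have hwω : w ≤ ω := hω l hl
    refine (Hoare.loop (t := 100 * ω + 69) (fun x s' =>
      (∀ i, i ≠ b + l → s'.cpx 2 i = s2.cpx 2 i) ∧
      (∀ x' < x, s'.cpx 2 (b + l) (code (cell k f g l x')) =
        if l ∈ A then ∑ q ∈ range w, (if x'.testBit q then 0 else v ((active k f g l).getD q 0) l *
          s2.cpx 2 (b + l + 1) (code (cell k f g l x') + 2 ^ (active k f g l).getD q 0))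
        else s2.cpx 2 (b + l + 1) (code (cell k f g l x'))) ∧
      (∀ z, (∀ x' < x, z ≠ code (cell k f g l x')) → s'.cpx 2 (b + l) z = 0) ∧
      (∀ l', l' ≠ l → s'.cpx 3 l' 0 = s2.cpx 3 l' 0) ∧
      s'.cpx 3 l 0 = if l ∈ A then ∑ x' ∈ range x, s.cpx 1 (b + l) (code (cell k f g l x')) *
        s2.cpx 2 (b + l + 1) (code (cell k f g l x')) else 0) (2 ^ w)
      ?_ ?_ ?_ ?_).mono le_rfl ?_
    · simp [NatExp.eval, h15, h3.two l hl, hw]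
    · refine ⟨fun i hi => by rw [hc3], fun x' hx' => absurd hx' (by omega), fun z _ => ?_, hc3', ?_⟩
      · rw [hc3, hz _ (by omega) (by omega)]; rfl
      · rw [hc3'']; simp
    · rintro x hx s4 ⟨hi1, hi2, hi3, hm1, hm2⟩ hF4
      set s5 := s4.setReg 11 x with hs5
      have hF5 : Frame (loop 11 (.const 0) skip) s4 s5 := Frame.loop_setReg _ _ _ _ _
      have h5' : Layout k n f g s5 := (h3.frame hF4 rfl).frame hF5 rfl
      have h15' : s5.reg 15 = l := by rw [hF5.reg 15 rfl, hF4.reg 15 rfl, h15]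
      have h11 : s5.reg 11 = x := by simp [hs5, State.setReg]
      have hz0 : ∀ x' < x, code (cell k f g l x) ≠ code (cell k f g l x') := by
        intro x' hx' he
        have := cell_injOn k f g l (by simpa using hx) (by simpa using hx'.trans hx)
          (code_injective he)
        omega
      set z := code (cell k f g l x) with hzdef
      refine Hoare.seq (t₁ := 20 * ω + 10) (t₂ := 80 * ω + 59)
        (codeProg_hoare h5' hl h15' h11 hwω) ?_ (by omega)
      intro s6 h13 hF6
      rw [← hzdef] at h13
      have hc6 : s6.cpx 2 = s4.cpx 2 := by rw [hF6.cpx 2 rfl, hF5.cpx 2 rfl]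
      have hc6' : s6.cpx 3 = s4.cpx 3 := by rw [hF6.cpx 3 rfl, hF5.cpx 3 rfl]
      have hT6 : s6.cpx 1 = s.cpx 1 := by
        rw [hF6.cpx 1 rfl, hF5.cpx 1 rfl, hF4.cpx 1 rfl, hT3]
      have h15'' : s6.reg 15 = l := by rw [hF6.reg 15 rfl, h15']
      have h11' : s6.reg 11 = x := by rw [hF6.reg 11 rfl, h11]
      have h5'' : s6.reg 5 = b := by rw [hF6.reg 5 rfl, hF5.reg 5 rfl, hF4.reg 5 rfl, h5]
      have h6 : Layout k n f g s6 := h5'.frame hF6 rfl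
      have hA6 : s6.nat 4 l 0 = if l ∈ A then 1 else 0 := by
        rw [hF6.nat 4 rfl, hF5.nat 4 rfl, hF4.nat 4 rfl]
        exact hA3 l hl
      have hv6 : ∀ a < k, s6.cpx 0 (s6.nat 3 a 0) (s6.nat 0 l 0) = v a l := by
        rw [hF6.cpx 0 rfl, hF5.cpx 0 rfl, hF4.cpx 0 rfl, hF6.nat 3 rfl, hF5.nat 3 rfl,
          hF4.nat 3 rfl, hF6.nat 0 rfl, hF5.nat 0 rfl, hF4.nat 0 rfl]
        exact fun a ha => hv3 a ha l hl
      have hentry : s6.cpx 2 (b + l) z = 0 := by rw [hc6]; exact hi3 z hz0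
      have hsrc : s6.cpx 2 (b + l + 1) = s2.cpx 2 (b + l + 1) := by
        rw [hc6]; exact hi1 _ (by omega)
      have hfin : ∀ s7 : State, (∀ i z', ¬ (i = b + l ∧ z' = z) →
          s7.cpx 2 i z' = s6.cpx 2 i z') →
          (s7.cpx 2 (b + l) z = if l ∈ A then ∑ q ∈ range w,
            (if x.testBit q then 0 else v ((active k f g l).getD q 0) l *
              s2.cpx 2 (b + l + 1) (z + 2 ^ (active k f g l).getD q 0))
            else s2.cpx 2 (b + l + 1) z) →
          (∀ l', l' ≠ l → s7.cpx 3 l' 0 = s6.cpx 3 l' 0) →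
          (s7.cpx 3 l 0 = s6.cpx 3 l 0 + if l ∈ A then
            s.cpx 1 (b + l) z * s2.cpx 2 (b + l + 1) z else 0) →
          ((∀ i, i ≠ b + l → s7.cpx 2 i = s2.cpx 2 i) ∧
          (∀ x' < x + 1, s7.cpx 2 (b + l) (code (cell k f g l x')) =
            if l ∈ A then ∑ q ∈ range w, (if x'.testBit q then 0 else
              v ((active k f g l).getD q 0) l *
              s2.cpx 2 (b + l + 1) (code (cell k f g l x') + 2 ^ (active k f g l).getD q 0))
            else s2.cpx 2 (b + l + 1) (code (cell k f g l x'))) ∧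
          (∀ z', (∀ x' < x + 1, z' ≠ code (cell k f g l x')) → s7.cpx 2 (b + l) z' = 0) ∧
          (∀ l', l' ≠ l → s7.cpx 3 l' 0 = s2.cpx 3 l' 0) ∧
          s7.cpx 3 l 0 = if l ∈ A then ∑ x' ∈ range (x + 1),
            s.cpx 1 (b + l) (code (cell k f g l x')) *
            s2.cpx 2 (b + l + 1) (code (cell k f g l x')) else 0) := by
        intro s7 ho hval ho3 hval3
        refine ⟨fun i hi => ?_, fun x' hx' => ?_, fun z' hz' => ?_, fun l' hl' => ?_, ?_⟩
        · funext z'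
          rw [ho i z' (by tauto), hc6, hi1 i hi]
        · rcases Nat.lt_succ_iff_lt_or_eq.1 hx' with hlt | rfl
          · rw [ho _ _ (fun hh => hz0 x' hlt hh.2.symm), hc6]
            exact hi2 x' hlt
          · exact hval
        · rw [ho _ _ (fun hh => hz' x (by omega) hh.2), hc6]
          exact hi3 z' fun x' hx' => hz' x' (by omega)
        · rw [ho3 l' hl', hc6', hm1 l' hl']
        · rw [hval3, hc6', hm2]
          split_ifs
          · rw [sum_range_succ]
          · simp
      refine Hoare.ifZero (t := 80 * ω + 54) (fun he => ?_) (fun he => ?_)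
        (by simp only [NatExp.cost]; omega)
      · have hlA : l ∉ A := by
          intro hl'
          simp [NatExp.eval, h15'', hA6, hl'] at he
        refine Hoare.block rfl (le_trans (b := 30) (by decide) (by omega))
          (hfin _ ?_ ?_ (fun _ _ => rfl) (by simp [hlA, Program.run, State.setCpx]))
        · intro i z' hne
          simp [Program.run, rowExp, NatExp.eval, CpxExp.eval, State.setCpx, h15'', h5'', h13, hne]
        · simp [Program.run, rowExp, NatExp.eval, CpxExp.eval, State.setCpx, h15'', h5'', h13, hlA,
            hsrc]
      · have hlA : l ∈ A := by
          by_contra hl'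
          simp [NatExp.eval, h15'', hA6, hl'] at he
        refine Hoare.seq (t₁ := 23) (t₂ := 80 * ω + 31)
          (Q := fun s' => s' = s6.setCpx 3 l 0 (s6.cpx 3 l 0 +
            s.cpx 1 (b + l) z * s2.cpx 2 (b + l + 1) z))
          (Hoare.block rfl (by decide) (by
            simp only [Program.run, rowExp, NatExp.eval, CpxExp.eval, h15'', h5'', h13, hT6, hsrc,
              add_zero])) ?_ (by omega)
        intro s6' hs6' hF6'
        have e2 : s6'.cpx 2 = s6.cpx 2 := hF6'.cpx 2 rfl
        have e15 : s6'.reg 15 = l := by rw [hF6'.reg 15 rfl, h15'']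
        have e5 : s6'.reg 5 = b := by rw [hF6'.reg 5 rfl, h5'']
        have e6 : Layout k n f g s6' := h6.frame hF6' rfl
        refine (bitLoop_hoare (x := x) (l := l) (w := w) (t := 40)
          (by rw [hF6'.reg 11 rfl, h11']) e15 (e6.cnt l hl) rfl rfl
          (fun q s' => s'.reg 13 = z ∧ (∀ i z', ¬ (i = b + l ∧ z' = z) →
            s'.cpx 2 i z' = s6.cpx 2 i z') ∧ s'.cpx 2 (b + l) z = ∑ q' ∈ range q,
              (if x.testBit q' then 0 else v ((active k f g l).getD q' 0) l *
                s2.cpx 2 (b + l + 1) (z + 2 ^ (active k f g l).getD q' 0))) ?_ ?_ ?_ ?_).mono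
            (by omega) ?_
        · rintro q s' y ⟨ha, hb, hc⟩
          exact ⟨by simpa [State.setReg] using ha, hb, hc⟩
        · rintro q s' y ⟨ha, hb, hc⟩
          exact ⟨by simpa [State.setReg] using ha, hb, hc⟩
        · exact ⟨by rw [hF6'.reg 13 rfl, h13], fun _ _ _ => by rw [e2], by simpa [e2] using hentry⟩
        · rintro q hq s7 ⟨ha, ho, hval⟩ hF7 h14
          rw [sum_range_succ]
          have g15 : s7.reg 15 = l := by rw [hF7.reg 15 rfl, e15]
          have g5 : s7.reg 5 = b := by rw [hF7.reg 5 rfl, e5]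
          have hak := ((mem_active k f g).1 (getD_mem hq)).1
          have g10 : s7.nat 10 l q = (active k f g l).getD q 0 := by
            rw [hF7.nat 10 rfl]; exact e6.act l hl q hq
          have g9 : s7.nat 9 ((active k f g l).getD q 0) 0 = 2 ^ (active k f g l).getD q 0 := by
            rw [hF7.nat 9 rfl]; exact e6.pow _ hak
          have gv : s7.cpx 0 (s7.nat 3 ((active k f g l).getD q 0) 0) (s7.nat 0 l 0) =
              v ((active k f g l).getD q 0) l := by
            rw [hF7.cpx 0 rfl, hF7.nat 3 rfl, hF7.nat 0 rfl, hF6'.cpx 0 rfl, hF6'.nat 3 rfl,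
              hF6'.nat 0 rfl]
            exact hv6 _ hak
          have gs : ∀ z', s7.cpx 2 (b + l + 1) z' = s2.cpx 2 (b + l + 1) z' := by
            intro z'
            rw [ho _ _ (by omega), hsrc]
          split_ifs with hbit
          · refine Hoare.block rfl (by decide) ⟨ha, ho, ?_⟩
            simpa [Program.run] using hval
          · refine Hoare.block rfl (by decide) ⟨?_, fun i z' hne => ?_, ?_⟩
            · simpa [Program.run, State.setCpx] using ha
            · rw [← ho i z' hne]
              simp [Program.run, rowExp, NatExp.eval, State.setCpx, g15, g5, ha, hne]
            · simp only [Program.run, rowExp, powExp, ampExp, actExp, NatExp.eval, CpxExp.eval,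
                State.setCpx, g15, g5, ha, h14, g10, g9, gv, add_zero, gs, hval]
              simp
        · rintro s7 ⟨-, ho, hval⟩ hF7
          refine hfin s7 ho (by rw [hval, if_pos hlA]) (fun l' hl' => ?_) ?_
          · rw [hF7.cpx 3 rfl, hs6']
            simp [State.setCpx, hl']
          · rw [hF7.cpx 3 rfl, hs6', if_pos hlA]
            simp [State.setCpx]
    · simp only [NatExp.cost]
      have h2 : 2 ^ w ≤ 2 ^ ω := Nat.pow_le_pow_right (by norm_num) hwω
      have := Nat.mul_le_mul_right (100 * ω + 70) h2
      simp only [Nat.add_assoc, Nat.reduceAdd]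
      omega
    · rintro s4 ⟨hi1, hi2, hi3, hm1, hm2⟩ -
      have hVl := hV (l + 1) (by omega) (by omega)
      rw [← add_assoc] at hVl
      refine ⟨fun l' hl' hl'' => ?_, fun i hi hi' => ?_, fun l' hl' hl'' => ?_⟩
      · rcases Nat.eq_or_lt_of_le hl' with rfl | hlt
        · exact hVl.pred (g := g) hl hAn hv hi2 hi3
        · rw [hi1 _ (by omega)]
          exact hV l' (by omega) hl''
      · rw [hi1 _ (by omega)]
        exact hz i hi (by omega)
      · rcases Nat.eq_or_lt_of_le hl' with rfl | hlt
        · rw [hm2]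
          rw [sum_fwdTable_mul_bwdTable hfg hAn hv hl (hT l (by omega)) hVl]
        · rw [hm1 _ (by omega)]
          exact hM l' (by omega) hl''
  · simp only [NatExp.cost, Nat.add_assoc, Nat.reduceAdd]
    omega
  · rintro s' ⟨-, hz, hM⟩ -
    exact ⟨fun l hl => hM l (by omega) hl, fun i hi => hz i (by omega) (by omega)⟩

/-! ### Sampling from a finite distribution by coin tosses -/

theorem coinToss_true {x : ℝ} (h0 : 0 ≤ x) (h1 : x ≤ 1) :
    coinToss x true = ENNReal.ofReal x := by
  simp [coinToss, h0, h1]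

theorem coinToss_false {x : ℝ} (h0 : 0 ≤ x) (h1 : x ≤ 1) :
    coinToss x false = ENNReal.ofReal (1 - x) := by
  simp [coinToss, h0, h1]

/-- One round of the sequential choice: if nothing has been chosen, choose `N` with probability
`p`. -/
noncomputable def pickStep (p : ℝ) (N : ℕ) : Option ℕ → PMF (Option ℕ)
  | none => (coinToss p).map fun b => if b then some N else none
  | some i => PMF.pure (some i)

/-- The sequential choice among the numbers below `N`, with the weights `wt` of total mass `W`. -/
noncomputable def pickLaw (wt : ℕ → ℝ) (W : ℝ) : ℕ → PMF (Option ℕ)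
  | 0 => PMF.pure none
  | N + 1 => (pickLaw wt W N).bind (pickStep (wt N / (W - ∑ i ∈ range N, wt i)) N)

theorem pickStep_none_none (p : ℝ) (N : ℕ) : pickStep p N none none = coinToss p false := by
  rw [pickStep, PMF.map_apply, tsum_bool]
  simp

theorem pickStep_none_some (p : ℝ) (N i : ℕ) :
    pickStep p N none (some i) = if i = N then coinToss p true else 0 := by
  rw [pickStep, PMF.map_apply, tsum_bool]
  simp

theorem bind_pickStep_none (μ : PMF (Option ℕ)) (p : ℝ) (N : ℕ) :
    μ.bind (pickStep p N) none = μ none * coinToss p false := by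
  rw [PMF.bind_apply, tsum_eq_single none, pickStep_none_none]
  rintro (_ | j) hj
  · exact absurd rfl hj
  · simp [pickStep]

theorem bind_pickStep_some (μ : PMF (Option ℕ)) (p : ℝ) (N i : ℕ) :
    μ.bind (pickStep p N) (some i) =
      μ none * (if i = N then coinToss p true else 0) + μ (some i) := by
  rw [PMF.bind_apply, tsum_eq_sum (s := {none, some i}), sum_pair (by simp), pickStep_none_some]
  · simp [pickStep]
  · rintro (_ | j) hj
    · simp at hj
    · simp only [mem_insert, mem_singleton, not_or, Option.some_inj] at hj
      simp [pickStep, Ne.symm hj.2]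

/-- The probabilities telescope: nothing has been chosen before `N` with probability `(W - S) / W`,
where `S` is the mass offered so far, and the bias `wt N / (W - S)` turns this into `wt N / W`. -/
theorem pickLaw_apply {wt : ℕ → ℝ} {W : ℝ} {M : ℕ} (h0 : ∀ i, 0 ≤ wt i)
    (hW : W = ∑ i ∈ range M, wt i) (hpos : 0 < W) {N : ℕ} (hN : N ≤ M) :
    pickLaw wt W N none = ENNReal.ofReal ((W - ∑ i ∈ range N, wt i) / W) ∧
    ∀ i, pickLaw wt W N (some i) = if i < N then ENNReal.ofReal (wt i / W) else 0 := by
  induction N with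
  | zero => simp [pickLaw, hpos.ne']
  | succ N ih =>
    obtain ⟨ih1, ih2⟩ := ih (by omega)
    have hle : ∑ i ∈ range (N + 1), wt i ≤ W := by
      rw [hW]
      exact sum_le_sum_of_subset_of_nonneg (range_subset_range.2 hN) fun i _ _ => h0 i
    rw [sum_range_succ] at hle ⊢
    set S := ∑ i ∈ range N, wt i
    have hS : wt N ≤ W - S := by linarith
    have hwN := h0 N
    have hp0 : 0 ≤ wt N / (W - S) := div_nonneg hwN (hwN.trans hS)
    have hp1 : wt N / (W - S) ≤ 1 := div_le_one_of_le₀ hS (hwN.trans hS)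
    constructor
    · rw [pickLaw, bind_pickStep_none, ih1, coinToss_false hp0 hp1, ← ENNReal.ofReal_mul
        (div_nonneg (hwN.trans hS) hpos.le)]
      congr 1
      -- If all mass has been offered, then `wt N = 0`, and the bias `0 / 0` is `0` by convention,
      -- as it should be.
      rcases eq_or_ne (W - S) 0 with h | h
      · have : wt N = 0 := by linarith
        rw [h, this]
        simp only [zero_div, zero_mul]
        rw [eq_comm, div_eq_zero_iff]
        left; linarith
      · field_simp
        ring
    · intro i
      rw [pickLaw, bind_pickStep_some, ih1, ih2, coinToss_true hp0 hp1]
      rcases lt_trichotomy i N with h | rfl | h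
      · simp [h, h.ne, h.trans (Nat.lt_succ_self N)]
      · simp only [if_true, lt_irrefl, if_false, add_zero, Nat.lt_succ_self]
        rw [← ENNReal.ofReal_mul (div_nonneg (hwN.trans hS) hpos.le)]
        congr 1
        rcases eq_or_ne (W - S) 0 with h | h
        · have : wt i = 0 := by linarith
          simp [this]
        · field_simp
      · simp [h.ne', not_lt.2 h.le, Nat.not_lt.2 h]

/-- The choice of a number below `M` with a probability proportional to `wt`. -/
noncomputable def choice (wt : ℕ → ℝ) (M : ℕ) : PMF ℕ :=
  (pickLaw wt (∑ i ∈ range M, wt i) M).map fun o => o.getD 0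

section Choice

variable {wt : ℕ → ℝ} {M : ℕ} (h0 : ∀ i, 0 ≤ wt i) (hpos : 0 < ∑ i ∈ range M, wt i)

include h0 hpos

/-- After `M` rounds no mass is left for `none`, so the default value in `choice` is never used. -/
theorem pickLaw_support {o : Option ℕ}
    (ho : o ∈ (pickLaw wt (∑ i ∈ range M, wt i) M).support) : ∃ i < M, o = some i := by
  obtain ⟨h1, h2⟩ := pickLaw_apply h0 rfl hpos (le_refl M)
  rw [PMF.mem_support_iff] at ho
  rcases o with _ | i
  · rw [h1] at ho; simp at ho
  · rw [h2] at ho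
    exact ⟨i, by by_contra h; simp [h] at ho, rfl⟩

theorem choice_apply (i : ℕ) : choice wt M i =
    if i < M then ENNReal.ofReal (wt i / ∑ i ∈ range M, wt i) else 0 := by
  obtain ⟨h1, h2⟩ := pickLaw_apply h0 rfl hpos (le_refl M)
  rw [← h2, choice, PMF.map_apply, tsum_eq_single (some i)]
  · simp
  · rintro (_ | j) hj
    · rw [h1]; simp
    · rw [if_neg]
      rintro rfl
      exact hj rfl

end Choice

/-- Choose an index below `e` according to the weights in the array `4`: afterwards register `7`
holds the successor of the index. -/
def chooseProg (e : NatExp) : Program :=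
  setCpx 5 (.const 0) (.const 0) (.ofNat (.const 0)) ;;
  loop 16 e (setCpx 5 (.const 0) (.const 0)
    (.add (.read 5 (.const 0) (.const 0)) (.read 4 (.reg 16) (.const 0)))) ;;
  setReg 7 (.const 0) ;;
  loop 16 e (.ifZero (.reg 7)
    (coin 8 (.div (.read 4 (.reg 16) (.const 0)) (.read 5 (.const 0) (.const 0))) ;;
     .ifZero (.reg 8)
      (setCpx 5 (.const 0) (.const 0)
        (.sub (.read 5 (.const 0) (.const 0)) (.read 4 (.reg 16) (.const 0))))
      (setReg 7 (.add (.reg 16) (.const 1))))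
    skip)

/-- The condition `v < 7` keeps the loop bound, which is read twice, away from the registers `7`,
`8` and `16` that the program writes. -/
theorem chooseProg_sim {v M : ℕ} {wt : ℕ → ℝ} {s : State} (hv : v < 7) (hM : s.reg v = M)
    (hwt : ∀ i < M, s.cpx 4 i 0 = wt i) (h0 : ∀ i, 0 ≤ wt i)
    (hpos : 0 < ∑ i ∈ range M, wt i) :
    Sim (chooseProg (.reg v)) s (60 * M + 20) (choice wt M)
      (fun i s' => i < M ∧ s'.reg 7 = i + 1) := by
  refine Hoare.seq_sim (t₁ := 5) (t₂ := 60 * M + 15) (Q := fun s' => s'.cpx 5 0 0 = 0)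
    (Hoare.block rfl (by decide) (by
      simp [Program.run, NatExp.eval, CpxExp.eval, State.setCpx])) ?_ (by omega)
  intro s1 hs1 hF1
  refine Hoare.seq_sim (t₁ := 20 * M + 2) (t₂ := 40 * M + 13)
    (Q := fun s' => s'.cpx 5 0 0 = (∑ i ∈ range M, wt i : ℝ)) ?_ ?_ (by omega)
  · refine Hoare.loop (t := 19) (fun N s' => s'.cpx 5 0 0 = (∑ i ∈ range N, wt i : ℝ)) M
      ?_ ?_ ?_ (by simp only [NatExp.cost]; omega)
    · simp [NatExp.eval, hF1.reg v rfl, hM]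
    · simpa using hs1
    · intro N hN s' hs' hF
      refine Hoare.block rfl (by decide) ?_
      have h4 : s'.cpx 4 N 0 = wt N := by rw [hF.cpx 4 rfl, hF1.cpx 4 rfl, hwt N hN]
      simp [Program.run, NatExp.eval, CpxExp.eval, State.setCpx, State.setReg, hs', h4,
        sum_range_succ]
  intro s2 hs2 hF2
  refine Hoare.seq_sim (t₁ := 2) (t₂ := 40 * M + 11)
    (Q := fun s' => s'.reg 7 = 0) (Hoare.block rfl (by decide) (by
      simp [Program.run, NatExp.eval, State.setReg])) ?_ (by omega)
  intro s3 hs3 hF3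
  have hv3 : s3.reg v = M := by
    have h1 : v ≠ 16 := by omega
    have h2 : v ≠ 7 := by omega
    rw [hF3.reg v (by simp [wReg, h2]), hF2.reg v (by simp [wReg, h1]), hF1.reg v rfl, hM]
  have hc4 : s3.cpx 4 = s.cpx 4 := by rw [hF3.cpx 4 rfl, hF2.cpx 4 rfl, hF1.cpx 4 rfl]
  set W := ∑ i ∈ range M, wt i
  -- While nothing has been chosen, entry `(0, 0)` of array `5` holds the mass not yet offered,
  -- which is the denominator of the next bias; afterwards it is irrelevant.
  have main := Sim.loop (v := 16) (e := .reg v) (s := s3) (t := 38) (t' := 40 * M + 11)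
    (p := .ifZero (.reg 7)
    (coin 8 (.div (.read 4 (.reg 16) (.const 0)) (.read 5 (.const 0) (.const 0))) ;;
     .ifZero (.reg 8)
      (setCpx 5 (.const 0) (.const 0)
        (.sub (.read 5 (.const 0) (.const 0)) (.read 4 (.reg 16) (.const 0))))
      (setReg 7 (.add (.reg 16) (.const 1))))
    skip) (pickLaw wt W) (fun N => pickStep (wt N / (W - ∑ i ∈ range N, wt i)) N)
    (fun N o s' => (∀ i, o = some i → s'.reg 7 = i + 1) ∧ (o = none → s'.reg 7 = 0 ∧
      s'.cpx 5 0 0 = (W - ∑ i ∈ range N, wt i : ℝ))) M (by simp [NatExp.eval, hv3])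
    (fun N => rfl) (a₀ := none) rfl ⟨by simp, fun _ => ⟨hs3, by
      rw [hF3.cpx 5 rfl, hs2]; simp⟩⟩ ?_ (by simp only [NatExp.cost]; omega)
  · refine main.map (fun o => o.getD 0) fun o ho s' h => ?_
    obtain ⟨i, hi, rfl⟩ := pickLaw_support h0 hpos ho
    exact ⟨hi, h.1 i rfl⟩
  · rintro N hN (_ | i) - s4 ⟨h1, h2⟩ hF4
    · obtain ⟨h7, h5⟩ := h2 rfl
      refine Sim.ifZero (t := 30) (fun _ => ?_) (fun h => ?_) (by simp [NatExp.cost])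
      · have h4 : s4.cpx 4 N 0 = wt N := by rw [hF4.cpx 4 rfl, hc4, hwt N hN]
        have hcoin := Sim.coin (v := 8) (e := .div (.read 4 (.reg 16) (.const 0))
          (.read 5 (.const 0) (.const 0))) (s := s4.setReg 16 N)
        have hp : (CpxExp.eval (s4.setReg 16 N) (.div (.read 4 (.reg 16) (.const 0))
          (.read 5 (.const 0) (.const 0)))).re = wt N / (W - ∑ i ∈ range N, wt i) := by
          simp only [CpxExp.eval, NatExp.eval, State.setReg, if_true, h4, h5]
          rw [← Complex.ofReal_div, Complex.ofReal_re]
        rw [hp] at hcoin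
        have := hcoin.seq_hoare (t₂ := 16) (t := 30)
          (R' := fun b s' => (∀ i, (if b = true then some N else none) = some i →
              s'.reg 7 = i + 1) ∧
            ((if b = true then some N else none) = none → s'.reg 7 = 0 ∧
              s'.cpx 5 0 0 = (W - ∑ i ∈ range (N + 1), wt i : ℝ)))
          (q := .ifZero (.reg 8)
            (setCpx 5 (.const 0) (.const 0)
            (.sub (.read 5 (.const 0) (.const 0)) (.read 4 (.reg 16) (.const 0))))
            (setReg 7 (.add (.reg 16) (.const 1)))) (fun b _ s' hs' _ => by
          subst hs'
          refine Hoare.block rfl (by decide) ?_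
          rw [sum_range_succ]
          cases b
          · simp [Program.run, NatExp.eval, CpxExp.eval, State.setReg, State.setCpx, h7, h5, h4]
            ring
          · simp [Program.run, NatExp.eval, State.setReg]) (by decide)
        exact this.map _ fun b _ s' h => h
      · simp [NatExp.eval, State.setReg, h7] at h
    · refine Sim.mono (Hoare.sim (t := 3) (Q := fun s' => s'.reg 7 = i + 1) ?_ (some i)) (by decide)
        fun a _ s' ⟨ha, hs'⟩ _ => ⟨fun j hj => ?_, fun hj => ?_⟩
      · have h7 : (s4.setReg 16 N).reg 7 = i + 1 := by simpa [State.setReg] using h1 i rfl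
        refine Hoare.ifZero (t := 1) (fun h => ?_) (fun _ => Hoare.block rfl le_rfl h7) (by decide)
        simp [NatExp.eval, h7] at h
      · subst ha; rw [hs', Option.some_inj.1 hj]
      · subst ha; cases hj

/-! ### One step of the sampler -/

theorem active_congr {k l : ℕ} {f f' g g' : ℕ → ℕ} (hf : ∀ a < k, f a = f' a)
    (hg : ∀ a < k, g a = g' a) : active k f g l = active k f' g' l := by
  refine List.filter_congr fun a ha => ?_
  rw [hf a (List.mem_range.1 ha), hg a (List.mem_range.1 ha)]

theorem expired_congr {k l : ℕ} {g g' : ℕ → ℕ} (hg : ∀ a < k, g a = g' a) :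
    expired k g l = expired k g' l := by
  refine filter_congr fun a ha => ?_
  rw [hg a (mem_range.1 ha)]

/-- The rows `cand` that are relevant for the columns before `n`; the row `i` occurs in the nodes
of the columns from `fst i` to `lst i`, and these nodes have at most `ω` rows. -/
structure Geometry (m n ω : ℕ) (u : ℕ → ℕ → ℂ) (cand : List ℕ) (fst lst : ℕ → ℕ) : Prop where
  nodup : cand.Nodup
  lt : ∀ i ∈ cand, i < m
  le : ∀ i ∈ cand, fst i ≤ lst i
  supp : ∀ i < m, ∀ l < n, u i l ≠ 0 → i ∈ cand ∧ fst i ≤ l ∧ l ≤ lst i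
  width : ∀ l < n, (cand.filter fun i => fst i ≤ l ∧ l ≤ lst i).length ≤ ω
  length_le : cand.length ≤ n * ω
  orth : ∀ l < n, ∀ l' < n,
    ∑ i ∈ range m, u i l * starRingEnd ℂ (u i l') = if l = l' then 1 else 0

/-- The data computed before the first step. -/
structure Static (n : ℕ) (u : ℕ → ℕ → ℂ) (cand : List ℕ) (fst lst : ℕ → ℕ) (s : State) : Prop where
  photons : s.reg 0 = n
  length : s.reg 4 = cand.length
  cands : ∀ x < cand.length, s.nat 7 x 0 = cand.getD x 0
  fsts : ∀ i ∈ cand, s.nat 8 i 0 = fst i + 1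
  lsts : ∀ i ∈ cand, s.nat 6 i 0 = lst i
  amps : ∀ i ∈ cand, ∀ l < n, s.cpx 0 i (s.nat 0 l 0) = u i l

theorem Static.frame {n : ℕ} {u : ℕ → ℕ → ℂ} {cand : List ℕ} {fst lst : ℕ → ℕ} {s s' : State}
    {p : Program} (h : Static n u cand fst lst s) (hF : Frame p s s')
    (hp : (!p.wReg 0 && !p.wReg 4 && !p.wNat 7 && !p.wNat 8 && !p.wNat 6 && !p.wNat 0 &&
      !p.wCpx 0) = true) : Static n u cand fst lst s' := by
  simp only [Bool.and_eq_true, Bool.not_eq_true'] at hp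
  obtain ⟨⟨⟨⟨⟨⟨h1, h2⟩, h3⟩, h4⟩, h5⟩, h6⟩, h7⟩ := hp
  obtain ⟨g1, g2, g3, g4, g5, g6⟩ := h
  refine ⟨?_, ?_, ?_, ?_, ?_, ?_⟩
  · rwa [hF.reg 0 h1]
  · rwa [hF.reg 4 h2]
  · rwa [hF.nat 7 h3]
  · rwa [hF.nat 8 h4]
  · rwa [hF.nat 6 h5]
  · rwa [hF.nat 0 h6, hF.cpx 0 h7]

/-- The row of the photon `a`, if the rows are listed in `r`, the last one first. -/
def rowOf (r : List ℕ) (a : ℕ) : ℕ := r.reverse.getD a 0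

theorem rowOf_cons_of_lt (i : ℕ) {r : List ℕ} {a : ℕ} (ha : a < r.length) :
    rowOf (i :: r) a = rowOf r a := by
  simp [rowOf, List.getD_eq_getElem?_getD, List.getElem?_append, ha]

theorem rowOf_cons_length (i : ℕ) (r : List ℕ) : rowOf (i :: r) r.length = i := by
  simp [rowOf, List.getD_eq_getElem?_getD]

theorem rowOf_mem {r : List ℕ} {a : ℕ} (ha : a < r.length) : rowOf r a ∈ r := by
  rw [← List.mem_reverse]
  exact getD_mem (by simpa using ha)

theorem map_rowOf_range (r : List ℕ) : (List.range r.length).map (rowOf r) = r.reverse := by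
  refine List.ext_getElem (by simp) fun i h1 h2 => ?_
  simp only [List.length_map, List.length_range] at h1
  simp [rowOf, List.getD_eq_getElem?_getD, h1]

/-- The tables index rows by the number of the photon rather than by the mode. These numbers are
distinct in any case, so `lper_eq_fper` applies without an assumption on `r`. -/
theorem lper_eq_fper_rowOf (u : ℕ → ℕ → ℂ) (r : List ℕ) (Y : Finset ℕ) :
    lper u r Y = fper (fun a l => u (rowOf r a) l) Y (range r.length) := by
  rw [← lper_perm u (List.reverse_perm r), ← map_rowOf_range, lper_map,
    lper_eq_fper _ List.nodup_range]
  congr 1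
  ext a
  simp

/-- The state of the machine when the columns `A` have been selected, and the photons have been
detected in the modes `r`. -/
structure Dyn (n : ℕ) (fst lst : ℕ → ℕ) (A : Finset ℕ) (r : List ℕ) (s : State) : Prop where
  ok : s.reg 3 = 0
  rows : ∀ a < r.length, s.nat 3 a 0 = rowOf r a
  taken : ∀ i, s.nat 5 i 0 = if i ∈ r then 1 else 0
  sel : ∀ l < n, s.nat 4 l 0 = if l ∈ A then 1 else 0
  pow : s.reg 6 = 2 ^ r.length
  fresh : ∀ i ≥ s.reg 5, s.cpx 1 i = 0 ∧ s.cpx 2 i = 0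
  layout : Layout r.length n (fun a => fst (rowOf r a)) (fun a => lst (rowOf r a)) s

/-- Distinct photons sit in distinct candidate rows, so those active at `l` are among the rows of
the node of `l`. -/
theorem active_length_le {m n ω : ℕ} {u : ℕ → ℕ → ℂ} {cand : List ℕ} {fst lst : ℕ → ℕ}
    (G : Geometry m n ω u cand fst lst) {r : List ℕ} (hr : r.Nodup) (hrc : ∀ i ∈ r, i ∈ cand)
    {l : ℕ} (hl : l < n) :
    (active r.length (fun a => fst (rowOf r a)) (fun a => lst (rowOf r a)) l).length ≤ ω := by
  refine le_trans ?_ (G.width l hl)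
  have hmap : ((active r.length (fun a => fst (rowOf r a)) (fun a => lst (rowOf r a)) l).map
      (rowOf r)) = r.reverse.filter fun i => fst i ≤ l ∧ l ≤ lst i := by
    rw [← map_rowOf_range, List.filter_map]
    rfl
  rw [← List.length_map (rowOf r), hmap]
  refine List.Subperm.length_le (List.subperm_of_subset ((List.nodup_reverse.2 hr).filter _) ?_)
  intro i hi
  simp only [List.mem_filter, List.mem_reverse] at hi ⊢
  exact ⟨hrc i hi.1, hi.2⟩

/-- The weights for the choice of a column. -/
def colWt (A : Finset ℕ) (l : ℕ) : ℝ := if l ∈ A then 0 else 1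

/-- The weights for the choice of a row. -/
noncomputable def rowWt (u : ℕ → ℕ → ℂ) (cand : List ℕ) (A : Finset ℕ) (r : List ℕ) (x : ℕ) : ℝ :=
  ‖lper u (cand.getD x 0 :: r) A‖ ^ 2

/-- Compute the weights of the columns. -/
def colWtProg : Program :=
  loop 16 (.reg 0) (setCpx 4 (.reg 16) (.const 0)
    (.ofNat (.sub (.const 1) (.read 4 (.reg 16) (.const 0)))))

theorem colWtProg_hoare {n : ℕ} {A : Finset ℕ} {s : State} (hn : s.reg 0 = n)
    (hA : ∀ l < n, s.nat 4 l 0 = if l ∈ A then 1 else 0) :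
    Hoare colWtProg s (20 * n + 2) (fun s' => ∀ l < n, s'.cpx 4 l 0 = (colWt A l : ℝ)) := by
  refine Hoare.loop (t := 19) (fun N s' => ∀ l < N, s'.cpx 4 l 0 = (colWt A l : ℝ)) n
    (by simp [NatExp.eval, hn]) (by simp) ?_ (by simp only [NatExp.cost]; omega)
  intro N hN s' hs' hF
  refine Hoare.block rfl (by decide) fun l hl => ?_
  have h4 : s'.nat 4 N 0 = if N ∈ A then 1 else 0 := by rw [hF.nat 4 rfl, hA N hN]
  rcases Nat.lt_succ_iff_lt_or_eq.1 hl with hlt | rfl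
  · simp [Program.run, NatExp.eval, CpxExp.eval, State.setReg, State.setCpx, hlt.ne, hs' l hlt]
  · by_cases hlA : l ∈ A <;>
      simp [Program.run, NatExp.eval, CpxExp.eval, State.setReg, State.setCpx, h4, colWt, hlA]

/-- Compute the weights of the rows from the permanents in the array `3`. -/
def rowWtProg : Program :=
  loop 16 (.reg 4) (
    setCpx 5 (.const 0) (.const 0) (.ofNat (.const 0)) ;;
    loop 17 (.reg 0) (setCpx 5 (.const 0) (.const 0)
      (.add (.read 5 (.const 0) (.const 0)) (.mul
        (.read 0 (.read 7 (.reg 16) (.const 0)) (.read 0 (.reg 17) (.const 0)))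
        (.read 3 (.reg 17) (.const 0))))) ;;
    setCpx 4 (.reg 16) (.const 0)
      (.mul (.read 5 (.const 0) (.const 0)) (.conj (.read 5 (.const 0) (.const 0)))))

theorem rowWtProg_hoare {n : ℕ} {u : ℕ → ℕ → ℂ} {cand : List ℕ} {fst lst : ℕ → ℕ} {s : State}
    {A : Finset ℕ} {r : List ℕ} (hS : Static n u cand fst lst s) (hA : A ⊆ range n)
    (hM : ∀ l < n, s.cpx 3 l 0 = if l ∈ A then lper u r (A.erase l) else 0) :
    Hoare rowWtProg s (cand.length * (30 * n + 40) + 2)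
      (fun s' => ∀ x < cand.length, s'.cpx 4 x 0 = (rowWt u cand A r x : ℝ)) := by
  refine Hoare.loop (t := 30 * n + 39) (fun N s' => ∀ x < N, s'.cpx 4 x 0 =
    (rowWt u cand A r x : ℝ)) cand.length
    (by simp [NatExp.eval, hS.length]) (by simp) ?_
    (by simp only [NatExp.cost, Nat.add_assoc, Nat.reduceAdd]; omega)
  intro N hN s' hs' hF
  have hS' : Static n u cand fst lst s' := hS.frame hF rfl
  refine Hoare.seq (t₁ := 5) (t₂ := 30 * n + 34)
    (Q := fun s'' => s''.cpx 5 0 0 = 0 ∧ s''.reg 16 = N)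
    (Hoare.block rfl (by decide) (by
      simp [Program.run, NatExp.eval, CpxExp.eval, State.setCpx, State.setReg])) ?_ (by omega)
  rintro s1 ⟨h5, h16⟩ hF1
  have hF1' : Frame rowWtProg s' s1 := by
    refine (Frame.loop_setReg 16 N (.reg 4) skip s').of_sub ?_ ?_ ?_ |>.trans
      (hF1.of_sub ?_ ?_ ?_) <;>
    simp +contextual [rowWtProg, wReg, wNat, wCpx]
  have hS1 : Static n u cand fst lst s1 := hS'.frame hF1' rfl
  have hmem : cand.getD N 0 ∈ cand := getD_mem hN
  -- Expansion along the new row; the minors are stored as zero outside `A`, so the program may sum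
  -- over all columns.
  have hval : ∑ l ∈ range n, u (cand.getD N 0) l * (if l ∈ A then lper u r (A.erase l) else 0) =
      lper u (cand.getD N 0 :: r) A := by
    simp only [mul_ite, mul_zero]
    rw [← sum_filter, lper, filter_mem_eq_inter, inter_eq_right.2 hA]
  refine Hoare.seq (t₁ := 30 * n + 2) (t₂ := 32) (Q := fun s'' => s''.cpx 5 0 0 =
    ∑ l ∈ range n, u (cand.getD N 0) l * (if l ∈ A then lper u r (A.erase l) else 0))
    ?_ ?_ (by omega)
  · refine Hoare.loop (t := 29) (fun N' s'' => s''.cpx 5 0 0 =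
      ∑ l ∈ range N', u (cand.getD N 0) l * (if l ∈ A then lper u r (A.erase l) else 0)) n
      (by simp [NatExp.eval, hS1.photons]) (by simpa using h5) ?_
      (by simp only [NatExp.cost]; omega)
    intro l hl s2 hs2 hF2
    refine Hoare.block rfl (by decide) ?_
    have hS2 : Static n u cand fst lst s2 := hS1.frame hF2 rfl
    have e16 : s2.reg 16 = N := by rw [hF2.reg 16 rfl, h16]
    have e3 : s2.cpx 3 l 0 = if l ∈ A then lper u r (A.erase l) else 0 := by
      rw [hF2.cpx 3 rfl, hF1'.cpx 3 rfl, hF.cpx 3 rfl]; exact hM l hl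
    have e7 := hS2.cands N hN
    have e0 := hS2.amps _ hmem l hl
    rw [sum_range_succ, ← hs2, ← e3, ← e0, ← e7]
    simp [Program.run, NatExp.eval, CpxExp.eval, State.setCpx, State.setReg, e16]
  · intro s2 hs2 hF2
    refine Hoare.block rfl ((by decide : _ ≤ 32)) fun x hx => ?_
    have e16 : s2.reg 16 = N := by rw [hF2.reg 16 rfl, h16]
    have e4 : s2.cpx 4 = s'.cpx 4 := by rw [hF2.cpx 4 rfl, hF1.cpx 4 rfl]; rfl
    rw [hval] at hs2
    rcases Nat.lt_succ_iff_lt_or_eq.1 hx with hlt | rfl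
    · simp [Program.run, NatExp.eval, CpxExp.eval, State.setCpx, e16, hlt.ne, e4, hs' x hlt]
    · simp [Program.run, NatExp.eval, CpxExp.eval, State.setCpx, e16, hs2, rowWt,
        Complex.mul_conj, Complex.normSq_eq_norm_sq]

/-- Compute the weights of the rows. -/
def minorProg : Program := fwdProg ;; bwdProg ;; rowWtProg

theorem minorProg_hoare {m n ω : ℕ} {u : ℕ → ℕ → ℂ} {cand : List ℕ} {fst lst : ℕ → ℕ} {s : State}
    {A : Finset ℕ} {r : List ℕ} (G : Geometry m n ω u cand fst lst)
    (hS : Static n u cand fst lst s) (hD : Dyn n fst lst A r s) (hA : A ⊆ range n)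
    (hr : r.Nodup) (hrc : ∀ i ∈ r, i ∈ cand) :
    Hoare minorProg s (n * (2 ^ ω * (200 * ω + 120) + 30) + n * ω * (30 * n + 40) + 27)
      (fun s' => (∀ x < cand.length, s'.cpx 4 x 0 = (rowWt u cand A r x : ℝ)) ∧
        ∀ i ≥ s.reg 5 + n + 1, s'.cpx 1 i = 0 ∧ s'.cpx 2 i = 0) := by
  set v : ℕ → ℕ → ℂ := fun a l => u (rowOf r a) l with hvdef
  have hmem : ∀ a < r.length, rowOf r a ∈ cand := fun a ha => hrc _ (rowOf_mem ha)
  have hω := fun l (hl : l < n) => active_length_le G hr hrc hl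
  have hfg : ∀ a < r.length, fst (rowOf r a) ≤ lst (rowOf r a) := fun a ha => G.le _ (hmem a ha)
  have hv : ∀ a < r.length, ∀ l < n, v a l ≠ 0 → fst (rowOf r a) ≤ l ∧ l ≤ lst (rowOf r a) :=
    fun a ha l hl h => (G.supp _ (G.lt _ (hmem a ha)) l hl h).2
  have hv' : ∀ a < r.length, ∀ l < n, s.cpx 0 (s.nat 3 a 0) (s.nat 0 l 0) = v a l := by
    intro a ha l hl
    rw [hD.rows a ha, hS.amps _ (hmem a ha) l hl]
  refine Hoare.seq (fwdProg_hoare hD.layout hS.photons rfl hω hfg hv hv' hD.sel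
    fun i hi => (hD.fresh i hi).1) (t₂ := n * (2 ^ ω * (100 * ω + 70) + 20) +
      n * ω * (30 * n + 40) + 17) ?_ ?_
  · rintro s1 ⟨hT, hz1⟩ hF1
    have hS1 : Static n u cand fst lst s1 := hS.frame hF1 rfl
    refine Hoare.seq (bwdProg_hoare (k := r.length) (n := n) (b := s.reg 5) (A := A) (ω := ω) (v := v)
      (hD.layout.frame hF1 rfl) hS1.photons (hF1.reg 5 rfl) ((hF1.reg 6 rfl).trans hD.pow) hω hfg hv
      ?_ hA ?_ hT ?_) (t₂ := n * ω * (30 * n + 40) + 2) ?_ ?_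
    · rw [hF1.cpx 0 rfl, hF1.nat 3 rfl, hF1.nat 0 rfl]; exact hv'
    · rw [hF1.nat 4 rfl]; exact hD.sel
    · rw [hF1.cpx 2 rfl]; exact fun i hi => (hD.fresh i hi).2
    · rintro s2 ⟨hM, hz2⟩ hF2
      have hS2 : Static n u cand fst lst s2 := hS1.frame hF2 rfl
      refine (rowWtProg_hoare (r := r) hS2 hA ?_).mono
        (Nat.add_le_add_right (Nat.mul_le_mul_right _ G.length_le) _) fun s3 hs3 hF3 =>
          ⟨hs3, fun i hi => ⟨?_, ?_⟩⟩
      · intro l hl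
        rw [hM l hl, lper_eq_fper_rowOf]
      · rw [hF3.cpx 1 rfl, hF2.cpx 1 rfl, hz1 i (by omega)]
      · rw [hF3.cpx 2 rfl, hz2 i (by omega)]
    · omega
  · ring_nf
    omega

/-- Record a photon in the mode in register `18`. -/
def recordProg : Program :=
  setNat 3 (.reg 9) (.const 0) (.reg 18) ;;
  setNat 5 (.reg 18) (.const 0) (.const 1) ;;
  setNat 9 (.reg 9) (.const 0) (.reg 6) ;;
  loop 16 (.reg 0) (
    .ifZero (.sub (.read 8 (.reg 18) (.const 0)) (.add (.reg 16) (.const 1)))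
      (.ifZero (.sub (.reg 16) (.read 6 (.reg 18) (.const 0)))
        (setNat 10 (.reg 16) (.read 11 (.reg 16) (.const 0)) (.reg 9) ;;
         setNat 11 (.reg 16) (.const 0) (.add (.read 11 (.reg 16) (.const 0)) (.const 1)) ;;
         setNat 13 (.reg 16) (.const 0)
          (.add (.read 13 (.reg 16) (.const 0)) (.read 13 (.reg 16) (.const 0))))
        (setNat 12 (.reg 16) (.const 0) (.add (.read 12 (.reg 16) (.const 0)) (.reg 6))))
      skip) ;;
  setReg 6 (.add (.reg 6) (.reg 6)) ;;
  setReg 5 (.add (.add (.reg 5) (.reg 0)) (.const 1))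

/-- The new photon has the largest index `k`, so each active list either gets `k` appended or is
unchanged, and an expired code grows by `2 ^ k` or is unchanged. Advancing register `5` by `n + 1`
makes the table rows of the next step fresh. -/
theorem recordProg_hoare {n i : ℕ} {u : ℕ → ℕ → ℂ} {cand : List ℕ} {fst lst : ℕ → ℕ} {s : State}
    {A : Finset ℕ} {r : List ℕ} (hS : Static n u cand fst lst s) (hic : i ∈ cand)
    (hil : fst i ≤ lst i) (h3 : s.reg 3 = 0) (h9 : s.reg 9 = r.length) (h18 : s.reg 18 = i)
    (hrows : ∀ a < r.length, s.nat 3 a 0 = rowOf r a)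
    (htaken : ∀ i, s.nat 5 i 0 = if i ∈ r then 1 else 0)
    (hsel : ∀ l < n, s.nat 4 l 0 = if l ∈ A then 1 else 0)
    (hpow : s.reg 6 = 2 ^ r.length)
    (hfresh : ∀ i ≥ s.reg 5 + n + 1, s.cpx 1 i = 0 ∧ s.cpx 2 i = 0)
    (hL : Layout r.length n (fun a => fst (rowOf r a)) (fun a => lst (rowOf r a)) s) :
    Hoare recordProg s (70 * n + 30)
      (fun s' => Static n u cand fst lst s' ∧ Dyn n fst lst A (i :: r) s') := by
  set k := r.length with hk
  set f := fun a => fst (rowOf r a)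
  set g := fun a => lst (rowOf r a)
  set f' := fun a => fst (rowOf (i :: r) a) with hf'
  set g' := fun a => lst (rowOf (i :: r) a) with hg'
  have hff : ∀ a < k, f' a = f a := fun a ha => congrArg fst (rowOf_cons_of_lt i ha)
  have hgg : ∀ a < k, g' a = g a := fun a ha => congrArg lst (rowOf_cons_of_lt i ha)
  have hfk : f' k = fst i := congrArg fst (rowOf_cons_length i r)
  have hgk : g' k = lst i := congrArg lst (rowOf_cons_length i r)
  have hact : ∀ l, active (k + 1) f' g' l =
      active k f g l ++ if fst i ≤ l ∧ l ≤ lst i then [k] else [] := by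
    intro l
    rw [active_succ, hfk, hgk, active_congr hff hgg]
  have hexp : ∀ l, code (expired (k + 1) g' l) =
      code (expired k g l) + if lst i < l then 2 ^ k else 0 := by
    intro l
    rw [expired_succ, hgk, expired_congr hgg]
    split_ifs
    · rw [code_insert]
      simp [mem_expired]
    · rfl
  set s1 := ((s.setNat 3 k 0 i).setNat 5 i 0 1).setNat 9 k 0 (2 ^ k) with hs1def
  have hF1 : Frame recordProg s s1 := by
    refine ⟨fun _ _ => rfl, fun a ha => ?_, fun _ _ => rfl⟩
    simp [recordProg, wNat] at ha
    simp [hs1def, State.setNat, ha]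
  have hS1 : Static n u cand fst lst s1 := hS.frame hF1 rfl
  refine Hoare.seq (t₁ := 4) (t₂ := 70 * n + 26) (Q := fun s' => s' = s.setNat 3 k 0 i)
    (Hoare.block rfl (by decide) (by simp [Program.run, NatExp.eval, h9, h18])) ?_ (by omega)
  rintro _ rfl -
  refine Hoare.seq (t₁ := 4) (t₂ := 70 * n + 22)
    (Q := fun s' => s' = (s.setNat 3 k 0 i).setNat 5 i 0 1)
    (Hoare.block rfl (by decide) (by simp [Program.run, NatExp.eval, State.setNat, h18])) ?_
    (by omega)
  rintro _ rfl -
  refine Hoare.seq (t₁ := 4) (t₂ := 70 * n + 18) (Q := fun s' => s' = s1)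
    (Hoare.block rfl (by decide) (by
      simp [hs1def, Program.run, NatExp.eval, State.setNat, h9, hpow])) ?_ (by omega)
  rintro _ rfl -
  have hn1 : ∀ a, a ≠ 3 → a ≠ 5 → a ≠ 9 → s1.nat a = s.nat a := by
    intro a h1 h2 h3
    simp [hs1def, State.setNat, h1, h2, h3]
  refine Hoare.seq (t₁ := 70 * n + 2) (t₂ := 16) (Q := fun s' =>
    (∀ l < n, ∀ q < (active (k + 1) f' g' l).length,
      s'.nat 10 l q = (active (k + 1) f' g' l).getD q 0) ∧
    (∀ l < n, s'.nat 11 l 0 = (active (k + 1) f' g' l).length) ∧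
    (∀ l < n, s'.nat 12 l 0 = code (expired (k + 1) g' l)) ∧
    (∀ l < n, s'.nat 13 l 0 = 2 ^ (active (k + 1) f' g' l).length)) ?_ ?_ (by omega)
  · refine (Hoare.loop (t := 69) (fun N s' =>
      (∀ l < N, (∀ q < (active (k + 1) f' g' l).length,
        s'.nat 10 l q = (active (k + 1) f' g' l).getD q 0) ∧
        s'.nat 11 l 0 = (active (k + 1) f' g' l).length ∧
        s'.nat 12 l 0 = code (expired (k + 1) g' l) ∧
        s'.nat 13 l 0 = 2 ^ (active (k + 1) f' g' l).length) ∧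
      (∀ l ≥ N, s'.nat 10 l = s.nat 10 l ∧ s'.nat 11 l = s.nat 11 l ∧
        s'.nat 12 l = s.nat 12 l ∧ s'.nat 13 l = s.nat 13 l)) n ?_ ?_ ?_ ?_).mono le_rfl ?_
    · simp [NatExp.eval, hS1.photons]
    · refine ⟨by simp, fun l _ => ?_⟩
      simp [hn1]
    · rintro l hl s2 ⟨ha, hb⟩ hF2
      have hS2 : Static n u cand fst lst s2 := hS1.frame hF2 rfl
      have e18 : s2.reg 18 = i := by rw [hF2.reg 18 rfl]; exact h18
      have e9 : s2.reg 9 = k := by rw [hF2.reg 9 rfl]; exact h9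
      have e6 : s2.reg 6 = 2 ^ k := by rw [hF2.reg 6 rfl]; exact hpow
      have e8 : s2.nat 8 i 0 = fst i + 1 := hS2.fsts i hic
      have e6' : s2.nat 6 i 0 = lst i := hS2.lsts i hic
      obtain ⟨b10, b11, b12, b13⟩ := hb l le_rfl
      have c10 := hL.act l hl
      have c11 := hL.cnt l hl
      have c12 := hL.exp l hl
      have c13 := hL.two l hl
      rw [← b10] at c10
      rw [← b11] at c11
      rw [← b12] at c12
      rw [← b13] at c13
      set s2' := s2.setReg 16 l with hs2'
      have d16 : s2'.reg 16 = l := by simp [hs2', State.setReg]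
      have d18 : s2'.reg 18 = i := by simpa [hs2', State.setReg] using e18
      have d9 : s2'.reg 9 = k := by simpa [hs2', State.setReg] using e9
      have d6 : s2'.reg 6 = 2 ^ k := by simpa [hs2', State.setReg] using e6
      have dn : s2'.nat = s2.nat := rfl
      -- the entries of the other columns are left alone
      have hfin : ∀ s3 : State, (∀ a l', l' ≠ l → s3.nat a l' = s2.nat a l') →
          ((∀ q < (active (k + 1) f' g' l).length,
            s3.nat 10 l q = (active (k + 1) f' g' l).getD q 0) ∧
            s3.nat 11 l 0 = (active (k + 1) f' g' l).length ∧
            s3.nat 12 l 0 = code (expired (k + 1) g' l) ∧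
            s3.nat 13 l 0 = 2 ^ (active (k + 1) f' g' l).length) →
          ((∀ l' < l + 1, (∀ q < (active (k + 1) f' g' l').length,
            s3.nat 10 l' q = (active (k + 1) f' g' l').getD q 0) ∧
            s3.nat 11 l' 0 = (active (k + 1) f' g' l').length ∧
            s3.nat 12 l' 0 = code (expired (k + 1) g' l') ∧
            s3.nat 13 l' 0 = 2 ^ (active (k + 1) f' g' l').length) ∧
          (∀ l' ≥ l + 1, s3.nat 10 l' = s.nat 10 l' ∧ s3.nat 11 l' = s.nat 11 l' ∧
            s3.nat 12 l' = s.nat 12 l' ∧ s3.nat 13 l' = s.nat 13 l')) := by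
        intro s3 ho hl3
        refine ⟨fun l' hl' => ?_, fun l' hl' => ?_⟩
        · rcases Nat.lt_succ_iff_lt_or_eq.1 hl' with hlt | rfl
          · rw [ho _ _ hlt.ne, ho _ _ hlt.ne, ho _ _ hlt.ne, ho _ _ hlt.ne]
            exact ha l' hlt
          · exact hl3
        · have hne : l' ≠ l := by omega
          rw [ho _ _ hne, ho _ _ hne, ho _ _ hne, ho _ _ hne]
          exact hb l' (by omega)
      rw [hact, hexp] at hfin
      refine Hoare.ifZero (t := 40) (fun he => ?_) (fun he => ?_) (by simp [NatExp.cost])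
      -- Array `8` holds `fst i + 1`, so the truncated difference vanishes exactly when the row has
      -- begun by column `l`.
      · have h1 : fst i ≤ l := by
          simp only [NatExp.eval, d18, d16, dn, e8] at he; omega
        refine Hoare.ifZero (t := 30) (fun he' => ?_) (fun he' => ?_) (by simp [NatExp.cost])
        · have h2 : l ≤ lst i := by
            simp only [NatExp.eval, d18, d16, dn, e6'] at he'; omega
          have h3 : ¬ lst i < l := by omega
          simp only [h1, h2, h3, if_true, if_false, and_self, List.length_append,
            List.length_singleton, add_zero] at hfin
          refine Hoare.block rfl (by decide) (hfin _ (fun a l' hne => ?_) ⟨fun q hq => ?_, ?_, ?_, ?_⟩)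
          · simp [Program.run, NatExp.eval, State.setNat, d16, hne, dn]
          · rcases Nat.lt_succ_iff_lt_or_eq.1 hq with hq | rfl
            · have := c10 q hq
              simp [Program.run, NatExp.eval, State.setNat, d16, dn, c11, hq.ne, this,
                List.getD_eq_getElem?_getD, List.getElem?_append, hq]
            · simp [Program.run, NatExp.eval, State.setNat, d16, d9, dn, c11,
                List.getD_eq_getElem?_getD]
          · simp [Program.run, NatExp.eval, State.setNat, d16, dn, c11]
          · simp [Program.run, NatExp.eval, State.setNat, d16, dn, c12]
          · simp [Program.run, NatExp.eval, State.setNat, d16, dn, c13, pow_succ, mul_two]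
        · have h2 : ¬ l ≤ lst i := by
            simp only [NatExp.eval, d18, d16, dn, e6'] at he'; omega
          have h3 : lst i < l := by omega
          simp only [h1, h2, h3, if_true, if_false, and_false, List.append_nil] at hfin
          refine Hoare.block rfl (by decide) (hfin _ (fun a l' hne => ?_) ⟨fun q hq => ?_, ?_, ?_, ?_⟩)
          · simp [Program.run, NatExp.eval, State.setNat, d16, hne, dn]
          · have := c10 q hq
            simp [Program.run, NatExp.eval, State.setNat, d16, dn, this]
          · simp [Program.run, NatExp.eval, State.setNat, d16, dn, c11]
          · simp [Program.run, NatExp.eval, State.setNat, d16, d6, dn, c12]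
          · simp [Program.run, NatExp.eval, State.setNat, d16, dn, c13]
      · have h1 : ¬ fst i ≤ l := by
          simp only [NatExp.eval, d18, d16, dn, e8] at he; omega
        have h3 : ¬ lst i < l := by omega
        simp only [h1, h3, if_false, false_and, List.append_nil, add_zero] at hfin
        exact Hoare.block rfl (by decide) (hfin _ (fun a l' hne => rfl) ⟨c10, c11, c12, c13⟩)
    · simp only [NatExp.cost]
      omega
    · rintro s' ⟨ha, -⟩ -
      exact ⟨fun l hl => (ha l hl).1, fun l hl => (ha l hl).2.1, fun l hl => (ha l hl).2.2.1,
        fun l hl => (ha l hl).2.2.2⟩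
  · rintro s2 ⟨a10, a11, a12, a13⟩ hF2
    refine Hoare.block rfl (by decide) ?_
    have hS2 : Static n u cand fst lst s2 := hS1.frame hF2 rfl
    set s3 := Program.run (setReg 6 (.add (.reg 6) (.reg 6)) ;;
      setReg 5 (.add (.add (.reg 5) (.reg 0)) (.const 1))) s2 with hs3
    have hr : ∀ v, v ≠ 6 → v ≠ 5 → s3.reg v = s2.reg v := by
      intro v h1 h2
      simp [hs3, Program.run, State.setReg, h1, h2]
    have hn3 : s3.nat = s2.nat := rfl
    have hc3 : s3.cpx = s2.cpx := rfl
    refine ⟨hS2.frame (p := setReg 6 (.const 0) ;; setReg 5 (.const 0)) ⟨fun v hv => ?_, fun _ _ => rfl,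
      fun _ _ => rfl⟩ rfl, ?_⟩
    · simp [wReg] at hv
      exact hr v hv.1 hv.2
    · refine ⟨?_, fun a ha => ?_, fun j => ?_, fun l hl => ?_, ?_, fun j hj => ?_, ?_⟩
      · rw [hr 3 (by decide) (by decide), hF2.reg 3 rfl]; exact h3
      · rw [hn3, hF2.nat 3 rfl]
        rw [List.length_cons, ← hk] at ha
        rcases Nat.lt_succ_iff_lt_or_eq.1 ha with hlt | rfl
        · rw [rowOf_cons_of_lt i hlt, ← hrows a hlt]
          simp [hs1def, State.setNat, hlt.ne]
        · rw [rowOf_cons_length]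
          simp [hs1def, State.setNat]
      · rw [hn3, hF2.nat 5 rfl]
        by_cases hj : j = i
        · simp [hs1def, State.setNat, hj]
        · simpa [hs1def, State.setNat, hj] using htaken j
      · rw [hn3, hF2.nat 4 rfl, hn1 4 (by decide) (by decide) (by decide)]
        exact hsel l hl
      · have : s3.reg 6 = s2.reg 6 + s2.reg 6 := by
          simp [hs3, Program.run, State.setReg, NatExp.eval]
        rw [this, hF2.reg 6 rfl, List.length_cons, pow_succ, ← hk]
        change s.reg 6 + s.reg 6 = _
        rw [hpow]; ring
      · have h5 : s3.reg 5 = s.reg 5 + n + 1 := by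
          have : s3.reg 5 = s2.reg 5 + s2.reg 0 + 1 := by
            simp [hs3, Program.run, State.setReg, NatExp.eval]
          rw [this, hS2.photons, hF2.reg 5 rfl]
          rfl
        rw [hc3, hF2.cpx 1 rfl, hF2.cpx 2 rfl]
        exact hfresh j (h5 ▸ hj)
      · refine ⟨fun a ha => ?_, fun l hl => ?_, fun l hl => ?_, fun l hl => ?_, fun l hl => ?_⟩
        · rw [hn3, hF2.nat 9 rfl]
          rw [List.length_cons, ← hk] at ha
          rcases Nat.lt_succ_iff_lt_or_eq.1 ha with hlt | rfl
          · simpa [hs1def, State.setNat, hlt.ne] using hL.pow a hlt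
          · simp [hs1def, State.setNat]
        · exact a10 l hl
        · exact a11 l hl
        · exact a12 l hl
        · exact a13 l hl

/-- One step of the sampler: select a random column, and choose the mode of the next photon. -/
def stepProg : Program :=
  .ifZero (.reg 3) (
    colWtProg ;;
    chooseProg (.reg 0) ;;
    setNat 4 (.sub (.reg 7) (.const 1)) (.const 0) (.const 1) ;;
    minorProg ;;
    chooseProg (.reg 4) ;;
    setReg 18 (.read 7 (.sub (.reg 7) (.const 1)) (.const 0)) ;;
    .ifZero (.read 5 (.reg 18) (.const 0)) recordProg (setReg 3 (.const 1)))
  skip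

/-- The law of one step of the sampler; `none` stands for a collision, `some (A, r)` for the
selected columns `A` and the modes `r` of the photons. -/
noncomputable def chainStep (n : ℕ) (u : ℕ → ℕ → ℂ) (cand : List ℕ) :
    Option (Finset ℕ × List ℕ) → PMF (Option (Finset ℕ × List ℕ))
  | none => PMF.pure none
  | some (A, r) => (choice (colWt A) n).bind fun h =>
      (choice (rowWt u cand (insert h A) r) cand.length).map fun x =>
        if cand.getD x 0 ∈ r then none else some (insert h A, cand.getD x 0 :: r)

/-- The law of the sampler after `k` steps. -/
noncomputable def chain (n : ℕ) (u : ℕ → ℕ → ℂ) (cand : List ℕ) :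
    ℕ → PMF (Option (Finset ℕ × List ℕ))
  | 0 => PMF.pure (some (∅, []))
  | k + 1 => (chain n u cand k).bind (chainStep n u cand)

/-- The values that the chain takes after `k` steps without a collision. -/
structure Valid (n : ℕ) (u : ℕ → ℕ → ℂ) (cand : List ℕ) (k : ℕ) (A : Finset ℕ) (r : List ℕ) :
    Prop where
  sub : A ⊆ range n
  card : #A = k
  length : r.length = k
  nodup : r.Nodup
  mem : ∀ i ∈ r, i ∈ cand
  ne_zero : lper u r A ≠ 0

theorem colWt_nonneg (A : Finset ℕ) (l : ℕ) : 0 ≤ colWt A l := by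
  rw [colWt]; split_ifs <;> norm_num

theorem rowWt_nonneg (u : ℕ → ℕ → ℂ) (cand : List ℕ) (A : Finset ℕ) (r : List ℕ) (x : ℕ) :
    0 ≤ rowWt u cand A r x := sq_nonneg _

theorem sum_colWt {n : ℕ} {A : Finset ℕ} (hA : A ⊆ range n) :
    ∑ l ∈ range n, colWt A l = n - #A := by
  have h : ∀ l, colWt A l = 1 - if l ∈ A then 1 else 0 := by
    intro l; rw [colWt]; split_ifs <;> norm_num
  simp only [h, sum_sub_distrib, sum_const, card_range, nsmul_eq_mul, mul_one]
  rw [← sum_filter, filter_mem_eq_inter, inter_eq_right.2 hA]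
  simp

/-! ### Invariants of the chain and its simulation by the machine -/

variable {m n ω : ℕ} {u : ℕ → ℕ → ℂ} {cand : List ℕ} {fst lst : ℕ → ℕ}

theorem sum_getD {M : Type*} [AddCommMonoid M] {L : List ℕ} (hL : L.Nodup) (F : ℕ → M) :
    ∑ x ∈ range L.length, F (L.getD x 0) = ∑ i ∈ L.toFinset, F i := by
  have h : L.toFinset = (range L.length).image fun x => L.getD x 0 := by
    ext a
    simp only [List.mem_toFinset, mem_image, mem_range]
    exact ⟨exists_getD, by rintro ⟨x, hx, rfl⟩; exact getD_mem hx⟩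
  rw [h, sum_image]
  intro x hx y hy hxy
  exact getD_inj hL (by simpa using hx) (by simpa using hy) hxy

theorem lper_cons_eq_zero {i : ℕ} {r : List ℕ} {A : Finset ℕ} (h : ∀ l ∈ A, u i l = 0) :
    lper u (i :: r) A = 0 :=
  sum_eq_zero fun l hl => by rw [h l hl, zero_mul]

/-- Rows that are not candidates vanish on all `n` columns, so the sum may be taken over all rows,
where orthonormality of the columns applies. -/
theorem sum_rowWt (G : Geometry m n ω u cand fst lst) {A : Finset ℕ} (hA : A ⊆ range n)
    (r : List ℕ) : ∑ x ∈ range cand.length, rowWt u cand A r x =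
      ∑ l ∈ A, ‖lper u r (A.erase l)‖ ^ 2 := by
  rw [← sum_norm_lper_cons u (range m) A (fun b hb b' hb' => G.orth b (mem_range.1 (hA hb)) b'
    (mem_range.1 (hA hb'))) r]
  unfold rowWt
  rw [sum_getD G.nodup fun i => ‖lper u (i :: r) A‖ ^ 2]
  refine sum_subset (fun i hi => mem_range.2 (G.lt i (List.mem_toFinset.1 hi))) fun i hi hi' => ?_
  rw [lper_cons_eq_zero, norm_zero, zero_pow two_ne_zero]
  intro l hl
  by_contra h
  exact hi' (List.mem_toFinset.2 (G.supp i (mem_range.1 hi) l (mem_range.1 (hA hl)) h).1)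

theorem Valid.sum_colWt_pos {k : ℕ} {A : Finset ℕ} {r : List ℕ} (hV : Valid n u cand k A r)
    (hk : k < n) : 0 < ∑ l ∈ range n, colWt A l := by
  rw [sum_colWt hV.sub, hV.card, sub_pos]
  exact_mod_cast hk

/-- The column just added contributes the permanent of the current state, which is nonzero because
states of weight zero are never reached. So the row choice is always well defined. -/
theorem Valid.sum_rowWt_pos (G : Geometry m n ω u cand fst lst) {k h : ℕ} {A : Finset ℕ}
    {r : List ℕ} (hV : Valid n u cand k A r) (hh : h < n) (hA : h ∉ A) :
    0 < ∑ x ∈ range cand.length, rowWt u cand (insert h A) r x := by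
  rw [sum_rowWt G (insert_subset (mem_range.2 hh) hV.sub)]
  refine sum_pos' (fun _ _ => sq_nonneg _) ⟨h, mem_insert_self _ _, ?_⟩
  rw [erase_insert hA]
  exact pow_pos (norm_pos_iff.2 hV.ne_zero) 2

theorem Valid.of_mem_col {k h : ℕ} {A : Finset ℕ} {r : List ℕ} (hV : Valid n u cand k A r)
    (hk : k < n) (hh : h ∈ (choice (colWt A) n).support) : h < n ∧ h ∉ A := by
  rw [PMF.mem_support_iff, choice_apply (colWt_nonneg A) (hV.sum_colWt_pos hk)] at hh
  constructor
  · by_contra hn; simp [hn] at hh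
  · intro hA; simp [colWt, hA] at hh

theorem Valid.of_mem_row (G : Geometry m n ω u cand fst lst) {k h x : ℕ} {A : Finset ℕ}
    {r : List ℕ} (hV : Valid n u cand k A r) (hh : h < n) (hA : h ∉ A)
    (hx : x ∈ (choice (rowWt u cand (insert h A) r) cand.length).support)
    (hr : cand.getD x 0 ∉ r) : Valid n u cand (k + 1) (insert h A) (cand.getD x 0 :: r) := by
  rw [PMF.mem_support_iff, choice_apply (rowWt_nonneg _ _ _ _) (hV.sum_rowWt_pos G hh hA)] at hx
  have hxl : x < cand.length := by by_contra hn; simp [hn] at hx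
  refine ⟨insert_subset (mem_range.2 hh) hV.sub, by rw [card_insert_of_notMem hA, hV.card],
    by rw [List.length_cons, hV.length], List.nodup_cons.2 ⟨hr, hV.nodup⟩, ?_, ?_⟩
  · simp only [List.mem_cons, forall_eq_or_imp]
    exact ⟨getD_mem hxl, hV.mem⟩
  · intro h0
    have hw : rowWt u cand (insert h A) r x = 0 := by rw [rowWt, h0, norm_zero, zero_pow two_ne_zero]
    rw [hw, zero_div, ENNReal.ofReal_zero, ite_self] at hx
    exact hx rfl

theorem chain_valid (G : Geometry m n ω u cand fst lst) {k : ℕ} (hk : k ≤ n) :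
    ∀ {A : Finset ℕ} {r : List ℕ}, some (A, r) ∈ (chain n u cand k).support →
      Valid n u cand k A r := by
  induction k with
  | zero =>
    intro A r h
    rw [chain, PMF.mem_support_pure_iff, Option.some_inj, Prod.mk.injEq] at h
    obtain ⟨rfl, rfl⟩ := h
    exact ⟨by simp, by simp, rfl, List.nodup_nil, by simp, by simp [lper]⟩
  | succ k ih =>
    intro A r h
    rw [chain, PMF.mem_support_bind_iff] at h
    obtain ⟨_ | ⟨A', r'⟩, h1, h2⟩ := h
    · simp [chainStep] at h2
    · have hV := ih (by omega) h1
      rw [chainStep, PMF.mem_support_bind_iff] at h2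
      obtain ⟨h, hh, h2⟩ := h2
      rw [PMF.mem_support_map_iff] at h2
      obtain ⟨x, hx, hxe⟩ := h2
      split_ifs at hxe with hr
      rw [Option.some_inj, Prod.mk.injEq] at hxe
      obtain ⟨rfl, rfl⟩ := hxe
      obtain ⟨hhn, hhA⟩ := hV.of_mem_col (by omega) hh
      exact hV.of_mem_row G hhn hhA hx hr

/-- The states of the machine that correspond to a value of the chain. -/
def Rel (n : ℕ) (u : ℕ → ℕ → ℂ) (cand : List ℕ) (fst lst : ℕ → ℕ) :
    Option (Finset ℕ × List ℕ) → State → Prop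
  | none, s => s.reg 3 ≠ 0
  | some (A, r), s => Static n u cand fst lst s ∧ Dyn n fst lst A r s

/-- A bound for the number of steps that one step of the sampler takes. -/
def stepTime (n ω : ℕ) : ℕ :=
  n * (2 ^ ω * (200 * ω + 120)) + n * ω * (30 * n + 100) + 200 * n + 150

theorem Dyn.frame {A : Finset ℕ} {r : List ℕ} {s s' : State} {p : Program}
    (h : Dyn n fst lst A r s) (hF : Frame p s s')
    (hp : (!p.wReg 3 && !p.wReg 5 && !p.wReg 6 && !p.wNat 3 && !p.wNat 4 && !p.wNat 5 &&
      !p.wCpx 1 && !p.wCpx 2 && (List.range 5).all fun i => !p.wNat (i + 9)) = true) :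
    Dyn n fst lst A r s' := by
  rw [Bool.and_eq_true] at hp
  obtain ⟨hp, hp'⟩ := hp
  simp only [Bool.and_eq_true, Bool.not_eq_true'] at hp
  obtain ⟨⟨⟨⟨⟨⟨⟨h1, h2⟩, h3⟩, h4⟩, h5⟩, h6⟩, h7⟩, h8⟩ := hp
  obtain ⟨g1, g2, g3, g4, g5, g6, g7⟩ := h
  refine ⟨?_, ?_, ?_, ?_, ?_, ?_, g7.frame hF hp'⟩
  · rwa [hF.reg 3 h1]
  · rwa [hF.nat 3 h4]
  · rwa [hF.nat 5 h6]
  · rwa [hF.nat 4 h5]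
  · rwa [hF.reg 6 h3]
  · rwa [hF.reg 5 h2, hF.cpx 1 h7, hF.cpx 2 h8]

theorem stepProg_sim (G : Geometry m n ω u cand fst lst) {k : ℕ} {A : Finset ℕ} {r : List ℕ}
    {s : State} (hV : Valid n u cand k A r) (hk : k < n) (hS : Static n u cand fst lst s)
    (hD : Dyn n fst lst A r s) (h9 : s.reg 9 = k) :
    Sim stepProg s (stepTime n ω) (chainStep n u cand (some (A, r))) (Rel n u cand fst lst) := by
  have hlen := G.length_le
  -- The nonlinear part of the cost becomes one atom, which leaves the remaining bookkeeping linear.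
  set T := n * (2 ^ ω * (200 * ω + 120)) + n * ω * (30 * n + 100) with hTdef
  have hT : n * (2 ^ ω * (200 * ω + 120) + 30) + n * ω * (30 * n + 40) + 27 + 60 * (n * ω) =
      T + 30 * n + 27 := by rw [hTdef]; ring
  refine Sim.ifZero (t := T + 200 * n + 140) (fun _ => ?_) (fun h => absurd hD.ok h) (by
    simp only [NatExp.cost, stepTime]; omega)
  refine Hoare.seq_sim (colWtProg_hoare hS.photons hD.sel) (t₂ := T + 180 * n + 138) ?_ (by omega)
  intro s1 hw1 hF1
  have hS1 : Static n u cand fst lst s1 := hS.frame hF1 rfl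
  have hD1 : Dyn n fst lst A r s1 := hD.frame hF1 rfl
  refine Sim.seq (chooseProg_sim (by norm_num) hS1.photons hw1 (colWt_nonneg A)
    (hV.sum_colWt_pos hk)) (t₂ := T + 120 * n + 118) ?_ (by omega)
  rintro h hh s2 ⟨-, h7⟩ hF2
  obtain ⟨hhn, hhA⟩ := hV.of_mem_col hk hh
  have hS2 : Static n u cand fst lst s2 := hS1.frame hF2 rfl
  have hD2 : Dyn n fst lst A r s2 := hD1.frame hF2 rfl
  have hA' : insert h A ⊆ range n := insert_subset (mem_range.2 hhn) hV.sub
  refine Hoare.seq_sim (t₁ := 6) (t₂ := T + 120 * n + 112) (Q := fun s' => s' = s2.setNat 4 h 0 1)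
    (Hoare.block rfl (by decide) (by simp [Program.run, NatExp.eval, h7])) ?_ (by omega)
  intro s3 hs3 hF3
  have hS3 : Static n u cand fst lst s3 := hS2.frame hF3 rfl
  have hD3 : Dyn n fst lst (insert h A) r s3 := by
    refine ⟨?_, ?_, ?_, fun l hl => ?_, ?_, ?_, hD2.layout.frame hF3 rfl⟩
    · rw [hF3.reg 3 rfl]; exact hD2.ok
    · rw [hF3.nat 3 rfl]; exact hD2.rows
    · rw [hF3.nat 5 rfl]; exact hD2.taken
    · have := hD2.sel l hl
      by_cases hlh : l = h
      · simp [hs3, State.setNat, hlh]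
      · simpa [hs3, State.setNat, hlh] using this
    · rw [hF3.reg 6 rfl]; exact hD2.pow
    · rw [hF3.reg 5 rfl, hF3.cpx 1 rfl, hF3.cpx 2 rfl]; exact hD2.fresh
  refine Hoare.seq_sim (minorProg_hoare G hS3 hD3 hA' hV.nodup hV.mem)
    (t₂ := 60 * cand.length + 80 * n + 80) ?_ (by omega)
  rintro s4 ⟨hw4, hz4⟩ hF4
  have hS4 : Static n u cand fst lst s4 := hS3.frame hF4 rfl
  have main := Sim.seq_hoare (chooseProg_sim (by norm_num) hS4.length hw4 (rowWt_nonneg _ _ _ _)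
    (hV.sum_rowWt_pos G hhn hhA)) (t₂ := 70 * n + 60) (t := 60 * cand.length + 80 * n + 80)
    (q := setReg 18 (.read 7 (.sub (.reg 7) (.const 1)) (.const 0)) ;;
      .ifZero (.read 5 (.reg 18) (.const 0)) recordProg (setReg 3 (.const 1)))
    (R' := fun x s' => Rel n u cand fst lst
      (if cand.getD x 0 ∈ r then none else some (insert h A, cand.getD x 0 :: r)) s') ?_ (by omega)
  · exact main.map _ fun x _ s' hx => hx
  · rintro x hx s5 ⟨hxl, h7'⟩ hF5
    have hS5 : Static n u cand fst lst s5 := hS4.frame hF5 rfl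
    refine Hoare.seq (t₁ := 6) (t₂ := 70 * n + 50)
      (Q := fun s' => s' = s5.setReg 18 (cand.getD x 0)) (Hoare.block rfl (by decide) (by
        simp [Program.run, NatExp.eval, h7', hS5.cands x hxl])) ?_ (by omega)
    intro s6 hs6 hF6
    have hS6 : Static n u cand fst lst s6 := hS5.frame hF6 rfl
    have h18 : s6.reg 18 = cand.getD x 0 := by simp [hs6, State.setReg]
    have htaken : ∀ i, s6.nat 5 i 0 = if i ∈ r then 1 else 0 := by
      rw [hF6.nat 5 rfl, hF5.nat 5 rfl, hF4.nat 5 rfl]; exact hD3.taken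
    refine Hoare.ifZero (t := 70 * n + 30) (fun he => ?_) (fun he => ?_) (by simp [NatExp.cost]; omega)
    · have hr : cand.getD x 0 ∉ r := by
        intro hr
        simp only [NatExp.eval, h18, htaken, if_pos hr] at he
        exact one_ne_zero he
      have hmem := getD_mem hxl
      have hk' : k = r.length := hV.length.symm
      simp only [if_neg hr]
      refine recordProg_hoare hS6 hmem (G.le _ hmem) ?_ ?_ h18 ?_ htaken ?_ ?_ ?_ ?_
      · rw [hF6.reg 3 rfl, hF5.reg 3 rfl, hF4.reg 3 rfl]; exact hD3.ok
      · rw [hF6.reg 9 rfl, hF5.reg 9 rfl, hF4.reg 9 rfl, hF3.reg 9 rfl, hF2.reg 9 rfl,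
          hF1.reg 9 rfl, h9, hk']
      · rw [hF6.nat 3 rfl, hF5.nat 3 rfl, hF4.nat 3 rfl]; exact hD3.rows
      · rw [hF6.nat 4 rfl, hF5.nat 4 rfl, hF4.nat 4 rfl]; exact hD3.sel
      · rw [hF6.reg 6 rfl, hF5.reg 6 rfl, hF4.reg 6 rfl]; exact hD3.pow
      · rw [hF6.reg 5 rfl, hF5.reg 5 rfl, hF4.reg 5 rfl, hF6.cpx 1 rfl, hF5.cpx 1 rfl,
          hF6.cpx 2 rfl, hF5.cpx 2 rfl]
        exact hz4
      · exact ((hD3.layout.frame hF4 rfl).frame hF5 rfl).frame hF6 rfl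
    · have hr : cand.getD x 0 ∈ r := by
        by_contra hr
        simp only [NatExp.eval, h18, htaken, if_neg hr] at he
        exact he rfl
      simp only [if_pos hr]
      exact Hoare.block rfl (le_trans (b := 30) (by decide) (by omega))
        (by simp [Rel, Program.run, NatExp.eval, State.setReg])

/-- The main loop. -/
def mainLoop : Program := loop 9 (.reg 0) stepProg

/-- After a collision the remaining rounds are idle on both sides, and the collision flag stays set.
-/
theorem mainLoop_sim (G : Geometry m n ω u cand fst lst) {s : State}
    (hS : Static n u cand fst lst s) (hD : Dyn n fst lst ∅ [] s) :
    Sim mainLoop s (n * (stepTime n ω + 1) + 2) (chain n u cand n) (Rel n u cand fst lst) := by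
  refine Sim.loop (t := stepTime n ω) (chain n u cand) (fun _ => chainStep n u cand)
    (fun _ => Rel n u cand fst lst) n (by simp [NatExp.eval, hS.photons]) (fun _ => rfl)
    (a₀ := some (∅, [])) rfl ⟨hS, hD⟩ ?_ (by simp only [NatExp.cost]; omega)
  rintro k hk (_ | ⟨A, r⟩) ha s' hR -
  · refine Sim.mono (Hoare.sim (t := 3) (Q := fun s' => s'.reg 3 ≠ 0) ?_ none)
      (by simp only [stepTime]; omega) fun a _ s'' ⟨ha, hs⟩ _ => by subst ha; exact hs
    have h3 : (s'.setReg 9 k).reg 3 ≠ 0 := by simpa [State.setReg, Rel] using hR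
    exact Hoare.ifZero (t := 1) (fun h => absurd h h3) (fun _ => Hoare.block rfl le_rfl h3)
      (by decide)
  · have hF := Frame.loop_setReg 9 k (.const 0) skip s'
    exact stepProg_sim G (chain_valid G hk.le ha) hk (hR.1.frame hF rfl) (hR.2.frame hF rfl)
      (by simp [State.setReg])

/-! ### The law of the sampler -/

section ChainLaw

variable {m n ω : ℕ} {u : ℕ → ℕ → ℂ} {cand : List ℕ} {fst lst : ℕ → ℕ}

/-- Only the choice of column `h` and of row `i` leads to this value: any other new column would
give a different set. -/
theorem chainStep_apply (G : Geometry m n ω u cand fst lst) {k h i : ℕ} {A : Finset ℕ}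
    {r : List ℕ} (hV : Valid n u cand k (A.erase h) r) (hk : k < n) (hA : A ⊆ range n) (hh : h ∈ A)
    (hi : i ∈ cand) (hir : i ∉ r) :
    chainStep n u cand (some (A.erase h, r)) (some (A, i :: r)) =
      ENNReal.ofReal (1 / (n - k) * (‖lper u (i :: r) A‖ ^ 2 /
        ∑ l ∈ A, ‖lper u r (A.erase l)‖ ^ 2)) := by
  have hhn := mem_range.1 (hA hh)
  obtain ⟨x, hx, rfl⟩ := exists_getD hi
  rw [chainStep, PMF.bind_apply, tsum_eq_single h]
  · rw [choice_apply (colWt_nonneg _) (hV.sum_colWt_pos hk), if_pos hhn, sum_colWt hV.sub, hV.card,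
      colWt, if_neg (notMem_erase h A), insert_erase hh, PMF.map_apply, tsum_eq_single x]
    · have hpos := hV.sum_rowWt_pos G hhn (notMem_erase h A)
      rw [insert_erase hh] at hpos
      rw [if_neg hir, if_pos rfl, choice_apply (rowWt_nonneg _ _ _ _) hpos, if_pos hx,
        sum_rowWt G hA, rowWt, ← ENNReal.ofReal_mul]
      rw [one_div_nonneg, sub_nonneg]
      exact_mod_cast hk.le
    · intro y hy
      refine (em _).elim (fun he => ?_) fun he => if_neg he
      split_ifs at he with hyr
      rw [Option.some_inj, Prod.mk.injEq, List.cons.injEq] at he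
      have hpos := hV.sum_rowWt_pos G hhn (notMem_erase h A)
      rw [insert_erase hh] at hpos
      rw [choice_apply (rowWt_nonneg _ _ _ _) hpos, if_neg (c := y < cand.length), ite_self]
      intro hyl
      exact hy (getD_inj G.nodup hyl hx he.2.1.symm)
  · intro h' hh'
    rw [mul_eq_zero, or_iff_not_imp_left]
    intro hne
    obtain ⟨-, hn⟩ := hV.of_mem_col hk ((PMF.mem_support_iff _ _).2 hne)
    rw [PMF.map_apply, ENNReal.tsum_eq_zero]
    intro y
    refine if_neg fun he => ?_
    split_ifs at he with hyr
    rw [Option.some_inj, Prod.mk.injEq] at he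
    have h1 : h' ∈ A := he.1 ▸ mem_insert_self _ _
    exact absurd (mem_erase.2 ⟨hh', h1⟩) hn

/-- The heart of the correctness proof. The predecessors of `(A, i :: r)` are the pairs `(A \ h, r)`
with `h ∈ A`, and their probabilities add up to `W / n.descFactorial k`. The step probability has
`W` in the denominator and is otherwise the same for all `h`, so `W` cancels. -/
theorem chain_apply (G : Geometry m n ω u cand fst lst) {k : ℕ} (hk : k ≤ n) :
    ∀ {A : Finset ℕ} {r : List ℕ}, A ⊆ range n → r.length = k → r.Nodup → (∀ i ∈ r, i ∈ cand) →
      chain n u cand k (some (A, r)) = ENNReal.ofReal (‖lper u r A‖ ^ 2 / n.descFactorial k) := by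
  induction k with
  | zero =>
    intro A r hA hr _ _
    obtain rfl := List.length_eq_zero_iff.1 hr
    rw [chain, PMF.pure_apply]
    by_cases h : A = ∅ <;> simp [lper, h]
  | succ k ih =>
    intro A r hA hlen hnd hmem
    obtain ⟨i, r, rfl⟩ : ∃ i r', r = i :: r' := List.exists_cons_of_length_eq_add_one hlen
    rw [List.nodup_cons] at hnd
    simp only [List.mem_cons, forall_eq_or_imp] at hmem
    have hlen' : r.length = k := by simpa using hlen
    have hinj : Set.InjOn (fun h => (some (A.erase h, r) : Option (Finset ℕ × List ℕ))) A := by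
      intro h hh h' hh' he
      have he' : A.erase h = A.erase h' := by simpa using he
      exact (erase_injOn A) hh hh' he'
    set W := ∑ l ∈ A, ‖lper u r (A.erase l)‖ ^ 2 with hW
    have hW0 : 0 ≤ W := sum_nonneg fun _ _ => sq_nonneg _
    rw [chain, PMF.bind_apply, tsum_eq_sum (s := A.image fun h => some (A.erase h, r)),
      sum_image hinj]
    · have hterm : ∀ h ∈ A, chain n u cand k (some (A.erase h, r)) *
          chainStep n u cand (some (A.erase h, r)) (some (A, i :: r)) =
          ENNReal.ofReal (‖lper u r (A.erase h)‖ ^ 2 / n.descFactorial k) *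
          ENNReal.ofReal (1 / (n - k) * (‖lper u (i :: r) A‖ ^ 2 / W)) := by
        intro h hh
        have hc := ih (by omega) ((erase_subset h A).trans hA) hlen' hnd.2 hmem.2
        rw [← hc]
        rcases eq_or_ne (chain n u cand k (some (A.erase h, r))) 0 with h0 | h0
        · rw [h0, zero_mul, zero_mul]
        · rw [chainStep_apply G (chain_valid G (by omega) ((PMF.mem_support_iff _ _).2 h0))
            (by omega) hA hh hmem.1 hnd.1]
      have hnk : (0 : ℝ) < n - k := by
        rw [sub_pos]; exact_mod_cast (by omega : k < n)
      have hdk : (0 : ℝ) < n.descFactorial k := by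
        exact_mod_cast Nat.pos_of_ne_zero fun h => by
          rw [Nat.descFactorial_eq_zero_iff_lt] at h; omega
      rw [sum_congr rfl hterm, ← sum_mul, ← ENNReal.ofReal_sum_of_nonneg
        fun _ _ => div_nonneg (sq_nonneg _) hdk.le, ← ENNReal.ofReal_mul
        (sum_nonneg fun _ _ => div_nonneg (sq_nonneg _) hdk.le), ← sum_div, ← hW,
        Nat.descFactorial_succ, Nat.cast_mul, Nat.cast_sub (by omega)]
      congr 1
      -- If `W = 0`, the weight of `i` vanishes as well, being one of the nonnegative terms with sum
      -- `W`.
      rcases hW0.eq_or_lt with h0 | h0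
      · have : ‖lper u (i :: r) A‖ ^ 2 = 0 := by
          obtain ⟨x, hx, rfl⟩ := exists_getD hmem.1
          refine le_antisymm ?_ (sq_nonneg _)
          rw [h0, hW, ← sum_rowWt G hA r]
          exact single_le_sum (f := rowWt u cand A r) (fun y _ => rowWt_nonneg _ _ _ _ y)
            (mem_range.2 hx)
        rw [this, ← h0]; simp
      · field_simp
    -- No other value has a transition to `(A, i :: r)`.
    · rintro (_ | ⟨A', r'⟩) ha
      · simp [chainStep]
      · rw [mul_eq_zero, or_iff_not_imp_left]
        intro hne
        have hV := chain_valid G (by omega) ((PMF.mem_support_iff _ _).2 hne)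
        by_contra hstep
        rw [chainStep, ← ne_eq, ← PMF.mem_support_iff, PMF.mem_support_bind_iff] at hstep
        obtain ⟨h, hh, hstep⟩ := hstep
        obtain ⟨x, -, he⟩ := (PMF.mem_support_map_iff _ _ _).1 hstep
        split_ifs at he with hr
        rw [Option.some_inj, Prod.mk.injEq, List.cons.injEq] at he
        obtain ⟨rfl, -, rfl⟩ := he
        obtain ⟨-, hhA⟩ := hV.of_mem_col (by omega) hh
        refine ha (mem_image.2 ⟨h, mem_insert_self _ _, ?_⟩)
        rw [erase_insert hhA]

theorem lper_eq_zero_of_mem {r : List ℕ} {i : ℕ} (hi : i ∈ r) :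
    ∀ {A : Finset ℕ}, (∀ l ∈ A, u i l = 0) → lper u r A = 0 := by
  induction r with
  | nil => simp at hi
  | cons j r ih =>
    intro A hA
    rcases List.mem_cons.1 hi with rfl | hi
    · exact lper_cons_eq_zero hA
    · refine sum_eq_zero fun l _ => ?_
      rw [ih hi fun l hl => hA l (mem_of_mem_erase hl), mul_zero]

/-- Summing out one row deletes one of the `k + 1` columns in each term, so the total mass obeys the
recursion of the factorial. -/
theorem sum_norm_lper_ofFn (hu : ∀ l < n, ∀ l' < n,
    ∑ i ∈ range m, u i l * starRingEnd ℂ (u i l') = if l = l' then 1 else 0) {k : ℕ} :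
    ∀ {A : Finset ℕ}, A ⊆ range n → #A = k →
      ∑ z : Fin k → Fin m, ‖lper u (List.ofFn fun j => (z j : ℕ)) A‖ ^ 2 = k.factorial := by
  induction k with
  | zero =>
    intro A _ hA
    rw [card_eq_zero] at hA
    simp [lper, hA]
  | succ k ih =>
    intro A hA hc
    rw [← (Fin.consEquiv fun _ => Fin m).sum_comp, Fintype.sum_prod_type, sum_comm]
    simp only [Fin.consEquiv_apply, List.ofFn_succ, Fin.cons_zero, Fin.cons_succ]
    have h1 : ∀ z : Fin k → Fin m, ∑ i : Fin m,
        ‖lper u ((i : ℕ) :: List.ofFn fun j => (z j : ℕ)) A‖ ^ 2 =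
        ∑ l ∈ A, ‖lper u (List.ofFn fun j => (z j : ℕ)) (A.erase l)‖ ^ 2 := by
      intro z
      rw [← sum_norm_lper_cons u (range m) A fun b hb b' hb' =>
        hu b (mem_range.1 (hA hb)) b' (mem_range.1 (hA hb')), Finset.sum_range]
    simp only [h1]
    rw [sum_comm]
    have h2 : ∀ l ∈ A, ∑ z : Fin k → Fin m,
        ‖lper u (List.ofFn fun j => (z j : ℕ)) (A.erase l)‖ ^ 2 = k.factorial := fun l hl =>
      ih ((erase_subset l A).trans hA) (by rw [card_erase_of_mem hl, hc]; rfl)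
    rw [sum_congr rfl h2, sum_const, hc, nsmul_eq_mul, Nat.factorial_succ, Nat.cast_mul]

end ChainLaw

/-! ### Lists of modes and occupation vectors -/

section Occupation

variable {m n : ℕ}

theorem occupation_comp (z : Fin n → Fin m) (σ : Equiv.Perm (Fin n)) :
    occupation (z ∘ σ) = occupation z := by
  funext i
  rw [occupation, occupation]
  exact card_bij (fun l _ => σ l) (by simp) (by simp)
    fun l hl => ⟨σ.symm l, by simpa using hl, by simp⟩

theorem occupation_le_one {z : Fin n → Fin m} (hz : Function.Injective z) (i : Fin m) :
    occupation z i ≤ 1 := by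
  rw [occupation, card_le_one]
  intro a ha b hb
  simp only [mem_filter, mem_univ, true_and] at ha hb
  exact hz (ha.trans hb.symm)

theorem injective_of_occupation_le_one {z : Fin n → Fin m} (h : ∀ i, occupation z i ≤ 1) :
    Function.Injective z := by
  intro a b hab
  have := h (z b)
  rw [occupation, card_le_one] at this
  exact this a (by simp [hab]) b (by simp)

/-- Glue bijections between the fibres of the two lists, which have equal sizes. -/
theorem exists_perm_of_occupation_eq {z w : Fin n → Fin m} (h : occupation z = occupation w) :
    ∃ σ : Equiv.Perm (Fin n), z ∘ σ = w := by
  have hcard : ∀ i : Fin m, Fintype.card {a // w a = i} = Fintype.card {a // z a = i} := by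
    intro i
    rw [Fintype.card_subtype, Fintype.card_subtype]
    exact (congrFun h i).symm
  refine ⟨(Equiv.sigmaFiberEquiv w).symm.trans ((Equiv.sigmaCongrRight fun i =>
    Fintype.equivOfCardEq (hcard i)).trans (Equiv.sigmaFiberEquiv z)), ?_⟩
  funext a
  simp only [Function.comp_apply, Equiv.trans_apply]
  exact ((Fintype.equivOfCardEq (hcard (w a))) ⟨a, rfl⟩).2

/-- Each list of modes arises from a list `z` with the same occupation vector in `∏ᵢ zᵢ!` ways. -/
theorem card_perm_comp_eq {z w : Fin n → Fin m} (h : occupation z = occupation w) :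
    #{σ : Equiv.Perm (Fin n) | z ∘ σ = w} = ∏ i, (occupation z i).factorial := by
  obtain ⟨τ, hτ⟩ := exists_perm_of_occupation_eq h
  have h1 : #{σ : Equiv.Perm (Fin n) | z ∘ σ = w} = #{σ : Equiv.Perm (Fin n) | z ∘ σ = z} := by
    refine card_bij (fun σ _ => σ * τ⁻¹) ?_ ?_ ?_
    · intro σ hσ
      simp only [mem_filter, mem_univ, true_and] at hσ ⊢
      funext a
      have := congrFun (hσ.trans hτ.symm) (τ⁻¹ a)
      simpa using this
    · intro σ _ σ' _ he
      exact mul_right_cancel he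
    · intro σ hσ
      simp only [mem_filter, mem_univ, true_and] at hσ
      refine ⟨σ * τ, ?_, by simp⟩
      simp only [mem_filter, mem_univ, true_and]
      rw [← hτ]
      funext a
      exact congrFun hσ (τ a)
  rw [h1, ← Fintype.card_subtype, DomMulAct.stabilizer_card z]
  refine prod_congr rfl fun i _ => ?_
  rw [Fintype.card_subtype]
  rfl

/-- Count the permutations in two ways: the sum of `F (z ∘ σ)` over all `σ` has `n!` equal terms,
and it hits each rearrangement of `z` as often as the stabiliser of `z` has elements. -/
theorem sum_occupation_eq (F : (Fin n → Fin m) → ℝ)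
    (hF : ∀ z (σ : Equiv.Perm (Fin n)), F (z ∘ σ) = F z) (z : Fin n → Fin m) :
    ∑ w with occupation z = occupation w, F w =
      n.factorial * (F z / ∏ i, ((occupation z i).factorial : ℝ)) := by
  have hpos : (0 : ℝ) < ∏ i, ((occupation z i).factorial : ℝ) :=
    prod_pos fun i _ => by exact_mod_cast Nat.factorial_pos _
  have h1 : ∑ σ : Equiv.Perm (Fin n), F (z ∘ σ) = n.factorial * F z := by
    simp [hF, Fintype.card_perm]
  have h2 : ∑ σ : Equiv.Perm (Fin n), F (z ∘ σ) =
      (∏ i, ((occupation z i).factorial : ℝ)) * ∑ w with occupation z = occupation w, F w := by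
    rw [← sum_fiberwise_of_maps_to (s := univ) (t := univ.filter fun w => occupation z = occupation w)
      (g := fun σ : Equiv.Perm (Fin n) => z ∘ σ) (fun σ _ => by simp [occupation_comp]), mul_sum]
    refine sum_congr rfl fun w hw => ?_
    have hw' : occupation z = occupation w := by simpa using hw
    rw [sum_congr rfl (g := fun _ => F w) fun σ hσ => by rw [(mem_filter.1 hσ).2], sum_const,
      card_perm_comp_eq hw', nsmul_eq_mul]
    push_cast
    rfl
  rw [h1] at h2
  field_simp
  linarith

theorem eq_of_monotone_of_occupation_eq {z w : Fin n → Fin m} (hz : Monotone z) (hw : Monotone w)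
    (h : occupation z = occupation w) : z = w := by
  obtain ⟨σ, rfl⟩ := exists_perm_of_occupation_eq h
  have h2 := Tuple.unique_monotone (f := z) (σ := σ) (τ := 1) hw (by simpa using hz)
  simpa using h2.symm

/-- The sum over all lists of modes, as a sum over the nondecreasing lists. -/
theorem sum_monotone (F : (Fin n → Fin m) → ℝ)
    (hF : ∀ z (σ : Equiv.Perm (Fin n)), F (z ∘ σ) = F z) :
    ∑ w, F w = n.factorial * ∑ z with Monotone z, F z / ∏ i, ((occupation z i).factorial : ℝ) := by
  have hsort : ∀ w : Fin n → Fin m, w ∘ Tuple.sort w ∈ univ.filter fun z : Fin n → Fin m =>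
      Monotone z := fun w => by simpa using Tuple.monotone_sort w
  rw [← sum_fiberwise_of_maps_to (fun w _ => hsort w), mul_sum]
  refine sum_congr rfl fun z hz => ?_
  have hz' : Monotone z := by simpa using hz
  rw [← sum_occupation_eq F hF z]
  refine sum_congr (filter_congr fun w _ => ?_) fun _ _ => rfl
  constructor
  · rintro rfl
    exact occupation_comp _ _
  · intro h
    exact eq_of_monotone_of_occupation_eq (Tuple.monotone_sort w) hz'
      ((occupation_comp _ _).trans h.symm)

end Occupation

/-! ### The law of the output -/

/-- The outcome that corresponds to a value of the chain. -/
def outcome (m n : ℕ) : Option (Finset ℕ × List ℕ) → Option (Fin m → ℕ)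
  | none => none
  | some (_, r) => some fun i => #{l ∈ range n | rowOf r l = (i : ℕ)}

/-- The final value of the chain in which the photons are detected in the modes `z`. -/
def finalValue {m n : ℕ} (z : Fin n → Fin m) : Option (Finset ℕ × List ℕ) :=
  some (range n, (List.ofFn fun j => (z j : ℕ)).reverse)

theorem outcome_finalValue {m n : ℕ} (z : Fin n → Fin m) :
    outcome m n (finalValue z) = some (occupation z) := by
  rw [finalValue, outcome, Option.some_inj]
  funext i
  rw [occupation]
  symm
  refine card_bij (fun l _ => (l : ℕ)) ?_ (fun _ _ _ _ h => Fin.ext h) ?_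
  · intro l hl
    simpa [rowOf, List.getD_eq_getElem?_getD, Fin.ext_iff] using hl
  · intro l hl
    obtain ⟨hl, h⟩ := mem_filter.1 hl
    have hl := mem_range.1 hl
    refine ⟨⟨l, hl⟩, ?_, rfl⟩
    simpa [rowOf, List.getD_eq_getElem?_getD, hl, Fin.ext_iff] using h

theorem finalValue_injective {m n : ℕ} :
    Function.Injective (finalValue : (Fin n → Fin m) → Option (Finset ℕ × List ℕ)) := by
  intro z w h
  simp only [finalValue, Option.some_inj, Prod.mk.injEq, List.reverse_inj, true_and] at h
  have := List.ofFn_injective h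
  funext j
  exact Fin.ext (congrFun this j)

theorem permanent_submatrix_comp {m n : ℕ} (U : Matrix (Fin m) (Fin m) ℂ) (c z : Fin n → Fin m)
    (σ : Equiv.Perm (Fin n)) :
    (U.submatrix (z ∘ σ) c).permanent = (U.submatrix z c).permanent :=
  Matrix.permanent_permute_cols σ (U.submatrix z c)

section OutputLaw

variable {m n ω : ℕ} {u : ℕ → ℕ → ℂ} {cand : List ℕ} {fst lst : ℕ → ℕ}
  {U : Matrix (Fin m) (Fin m) ℂ} {c : Fin n → Fin m}

theorem lper_ofFn_eq (hu : ∀ (i : Fin m) (l : Fin n), u i l = U i (c l)) (z : Fin n → Fin m) :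
    lper u (List.ofFn fun j => (z j : ℕ)) (range n) = (U.submatrix z c).permanent := by
  rw [lper_ofFn_eq_permanent]
  congr 1
  ext l h
  exact hu _ _

/-- After `n` steps all columns are selected, so a final value is just a list of modes. -/
theorem Valid.exists_finalValue (G : Geometry m n ω u cand fst lst) {A : Finset ℕ} {r : List ℕ}
    (hV : Valid n u cand n A r) : ∃ z : Fin n → Fin m, finalValue z = some (A, r) := by
  have hr : r.reverse.length = n := by rw [List.length_reverse, hV.length]
  refine ⟨fun j => ⟨r.reverse[j], G.lt _ (hV.mem _ (List.mem_reverse.1 (List.getElem_mem _)))⟩, ?_⟩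
  rw [finalValue, Option.some_inj, Prod.mk.injEq]
  refine ⟨(eq_of_subset_of_card_le hV.sub (by rw [hV.card, card_range])).symm, ?_⟩
  rw [List.reverse_eq_iff]
  refine List.ext_getElem (by simp [hV.length]) fun i h1 h2 => by simp

-- Besides `chain_apply`, two cases give zero: a repeated mode is never reached, and a mode outside
-- `cand` is a zero row, hence neither reached nor of nonzero permanent.
open Classical in
theorem chain_finalValue (G : Geometry m n ω u cand fst lst)
    (hu : ∀ (i : Fin m) (l : Fin n), u i l = U i (c l)) (z : Fin n → Fin m) :
    chain n u cand n (finalValue z) = if Function.Injective z then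
      ENNReal.ofReal (‖(U.submatrix z c).permanent‖ ^ 2 / n.factorial) else 0 := by
  have hnd : (List.ofFn fun j => (z j : ℕ)).reverse.Nodup ↔ Function.Injective z := by
    rw [List.nodup_reverse, List.nodup_ofFn]
    exact ⟨fun h => h.of_comp (f := Fin.val), fun h => Fin.val_injective.comp h⟩
  by_cases hz : Function.Injective z
  · rw [if_pos hz, ← lper_ofFn_eq hu]
    by_cases hc : ∀ j, (z j : ℕ) ∈ cand
    · rw [finalValue, chain_apply G le_rfl subset_rfl (by simp) (hnd.2 hz)
        (by simpa [List.mem_ofFn] using hc), lper_perm _ (List.reverse_perm _),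
        Nat.descFactorial_self]
    · push Not at hc
      obtain ⟨j, hj⟩ := hc
      rw [lper_eq_zero_of_mem (i := z j) (List.mem_ofFn.2 ⟨j, rfl⟩)]
      · by_contra hne
        rw [show ENNReal.ofReal (‖(0 : ℂ)‖ ^ 2 / n.factorial) = 0 by simp] at hne
        exact hj ((chain_valid G le_rfl ((PMF.mem_support_iff _ _).2 hne)).mem _
          (by simp [List.mem_ofFn]))
      · intro l hl
        by_contra hne
        exact hj (G.supp _ (z j).2 l (mem_range.1 hl) hne).1
  · rw [if_neg hz]
    by_contra hne
    exact hz (hnd.1 (chain_valid G le_rfl ((PMF.mem_support_iff _ _).2 hne)).nodup)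

theorem exists_finalValue_of_chain_ne_zero (G : Geometry m n ω u cand fst lst)
    {A : Finset ℕ × List ℕ} (h : chain n u cand n (some A) ≠ 0) :
    ∃ z : Fin n → Fin m, finalValue z = some A :=
  (chain_valid G le_rfl ((PMF.mem_support_iff _ _).2 h)).exists_finalValue G

theorem outcomeProb_eq (hc : Function.Injective c) (z : Fin n → Fin m) :
    outcomeProb U c z =
      ‖(U.submatrix z c).permanent‖ ^ 2 / ∏ i, ((occupation z i).factorial : ℝ) := by
  rw [outcomeProb]
  congr 1
  refine prod_congr rfl fun i _ => ?_
  rw [Nat.factorial_eq_one.2 (occupation_le_one hc i), Nat.cast_one, one_mul]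

/-- The outcome collects all orderings of `r`, each of probability `|per|² / n!`;
`sum_occupation_eq` removes the `n!`. -/
theorem map_outcome_some (G : Geometry m n ω u cand fst lst)
    (hu : ∀ (i : Fin m) (l : Fin n), u i l = U i (c l)) (hc : Function.Injective c)
    {r : Fin n → Fin m} (hr : Function.Injective r) :
    (chain n u cand n).map (outcome m n) (some (occupation r)) =
      ENNReal.ofReal (outcomeProb U c r) := by
  classical
  rw [PMF.map_apply, tsum_eq_sum (s := (univ : Finset (Fin n → Fin m)).image finalValue), sum_image
    finalValue_injective.injOn]
  · simp only [outcome_finalValue, Option.some_inj]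
    rw [← sum_filter]
    have h1 : ∀ z ∈ univ.filter (fun z => occupation r = occupation z),
        chain n u cand n (finalValue z) =
          ENNReal.ofReal (‖(U.submatrix z c).permanent‖ ^ 2 / n.factorial) := by
      intro z hz
      rw [chain_finalValue G hu, if_pos]
      refine injective_of_occupation_le_one fun i => ?_
      rw [← (mem_filter.1 hz).2]
      exact occupation_le_one hr i
    rw [sum_congr rfl h1, ← ENNReal.ofReal_sum_of_nonneg fun _ _ => by positivity, ← sum_div]
    congr 1
    have h2 := sum_occupation_eq (fun z => ‖(U.submatrix z c).permanent‖ ^ 2)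
      (fun z σ => by simp only [permanent_submatrix_comp]) r
    have hn : (n.factorial : ℝ) ≠ 0 := by exact_mod_cast n.factorial_ne_zero
    rw [outcomeProb_eq hc, div_eq_iff hn, mul_comm]
    convert h2
  · rintro (_ | A) hA
    · exact if_neg (by simp [outcome])
    · refine (em (chain n u cand n (some A) = 0)).elim (fun h => by rw [h, ite_self]) fun hne => ?_
      exfalso
      obtain ⟨z, hz⟩ := exists_finalValue_of_chain_ne_zero G hne
      exact hA (mem_image.2 ⟨z, mem_univ _, hz⟩)

/-- The weights `P` of all lists sum to one, and so does the law of the chain, which agrees with `P`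
on injective lists. So `none` has the mass of the other lists, which `sum_monotone` groups into
outcomes. -/
theorem map_outcome_none (G : Geometry m n ω u cand fst lst)
    (hu : ∀ (i : Fin m) (l : Fin n), u i l = U i (c l)) (hc : Function.Injective c) :
    (chain n u cand n).map (outcome m n) none =
      ∑ z : {z : Fin n → Fin m // Monotone z ∧ ¬ Function.Injective z},
        ENNReal.ofReal (outcomeProb U c z) := by
  classical
  have hn : (n.factorial : ℝ) ≠ 0 := by exact_mod_cast n.factorial_ne_zero
  set P : (Fin n → Fin m) → ℝ := fun z => ‖(U.submatrix z c).permanent‖ ^ 2 / n.factorial with hP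
  have hP0 : ∀ z, 0 ≤ P z := fun z => by positivity
  have htotal : ∑ z, P z = 1 := by
    rw [hP, ← sum_div, div_eq_one_iff_eq hn]
    rw [← sum_norm_lper_ofFn (u := u) (m := m) (n := n) G.orth subset_rfl (card_range n)]
    exact sum_congr rfl fun z _ => by rw [lper_ofFn_eq hu]
  have hnone : (chain n u cand n).map (outcome m n) none = chain n u cand n none := by
    rw [PMF.map_apply, tsum_eq_single none]
    · exact if_pos rfl
    · rintro (_ | A) hA
      · exact absurd rfl hA
      · exact if_neg (by simp [outcome])
  have hone : chain n u cand n none + ∑ z with Function.Injective z, ENNReal.ofReal (P z) = 1 := by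
    have h := (chain n u cand n).tsum_coe
    rw [tsum_eq_sum (s := insert none ((univ : Finset (Fin n → Fin m)).image finalValue)), sum_insert (by simp [finalValue]),
      sum_image finalValue_injective.injOn] at h
    · simp only [chain_finalValue G hu] at h
      rw [← h, sum_filter]
    · rintro (_ | A) hA
      · simp at hA
      · by_contra hne
        obtain ⟨z, hz⟩ := exists_finalValue_of_chain_ne_zero G hne
        exact hA (mem_insert_of_mem (mem_image.2 ⟨z, mem_univ _, hz⟩))
  have hcoll : ∑ z with ¬ Function.Injective z, ENNReal.ofReal (P z) +
      ∑ z with Function.Injective z, ENNReal.ofReal (P z) = 1 := by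
    rw [add_comm, sum_filter_add_sum_filter_not, ← ENNReal.ofReal_sum_of_nonneg fun z _ => hP0 z,
      htotal, ENNReal.ofReal_one]
  -- Finiteness permits cancelling the injective lists from the two totals.
  have hfin : ∑ z with Function.Injective z, ENNReal.ofReal (P z) ≠ ⊤ := by
    rw [ENNReal.sum_ne_top]
    exact fun _ _ => ENNReal.ofReal_ne_top
  rw [hnone, (ENNReal.add_left_inj hfin).1 (hone.trans hcoll.symm),
    ← ENNReal.ofReal_sum_of_nonneg fun z _ => hP0 z]
  -- Injective lists get weight zero, so that a sum over all lists can be sorted.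
  have hsum := sum_monotone (fun z => if Function.Injective z then 0 else
    ‖(U.submatrix z c).permanent‖ ^ 2) fun z σ => by
      simp only [permanent_submatrix_comp, Equiv.injective_comp]
  rw [← ENNReal.ofReal_sum_of_nonneg fun z _ => by rw [outcomeProb_eq hc]; positivity]
  congr 1
  simp only [outcomeProb_eq hc]
  rw [hP, ← sum_div, div_eq_iff hn, mul_comm, sum_filter]
  simp only [ite_not]
  rw [hsum]
  congr 1
  rw [← sum_subtype (univ.filter fun z : Fin n → Fin m => Monotone z ∧ ¬ Function.Injective z)
    (by simp) fun z => ‖(U.submatrix z c).permanent‖ ^ 2 / ∏ i, ((occupation z i).factorial : ℝ),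
    ← filter_filter, sum_filter (p := fun z => ¬ Function.Injective z)]
  refine sum_congr (by congr!) fun z _ => ?_
  by_cases hz : Function.Injective z <;> simp [hz]

theorem samplesCollisionFree_of_sim {A : Program} {s : State} {t : ℕ}
    (G : Geometry m n ω u cand fst lst)
    (hu : ∀ (i : Fin m) (l : Fin n), u i l = U i (c l)) (hc : Function.Injective c)
    (h : Sim A s t (chain n u cand n) (Rel n u cand fst lst)) : SamplesCollisionFree A s U c := by
  have hmap : ((A.exec s).map fun x => output m n x.1) =
      (chain n u cand n).map (outcome m n) := by
    refine h.map_exec (output m n) (outcome m n) ?_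
    rintro (_ | ⟨B, r⟩) ha s' hR
    · exact if_neg hR
    · obtain ⟨-, hD⟩ := hR
      have hr := (chain_valid G le_rfl ha).length
      rw [output, if_pos hD.ok, outcome, Option.some_inj]
      funext i
      refine congrArg card (filter_congr fun l hl => ?_)
      rw [hD.rows l (by rw [hr]; exact mem_range.1 hl)]
  rw [SamplesCollisionFree, hmap]
  exact ⟨fun r hr => map_outcome_some G hu hc hr, map_outcome_none G hu hc⟩

end OutputLaw

/-! ### The preparation of the candidate rows -/

/-- The preparation determines its candidate list only existentially. It suffices that the rest of
the program gives `b` the same probability from every state in which the preparation may end. -/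
theorem Hoare.seq_law {β : Type} {p q : Program} {s : State} {t : ℕ} {Q : State → Prop}
    (h : Hoare p s t Q) (f : State → β) (b : β) (x : ENNReal)
    (hq : ∀ s', Q s' → ((q.exec s').map fun y => f y.1) b = x) :
    (((p ;; q).exec s).map fun y => f y.1) b = x := by
  have h1 : ((p ;; q).exec s).map (fun y => f y.1) =
      (p.exec s).bind fun y => (q.exec y.1).map fun z => f z.1 := by
    simp only [Program.exec, PMF.map_bind, PMF.map_comp]
    rfl
  rw [h1, PMF.bind_apply]
  calc _ = ∑' y, p.exec s y * x := by
        refine tsum_congr fun y => ?_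
        by_cases hy : p.exec s y = 0
        · rw [hy, zero_mul, zero_mul]
        · rw [hq _ (h y ((PMF.mem_support_iff _ _).2 hy)).1]
    _ = x := by rw [ENNReal.tsum_mul_right, PMF.tsum_coe, one_mul]

theorem SamplesCollisionFree.seq {m n : ℕ} {U : Matrix (Fin m) (Fin m) ℂ} {c : Fin n → Fin m}
    {p q : Program} {s : State} {t : ℕ} {Q : State → Prop} (h : Hoare p s t Q)
    (hq : ∀ s', Q s' → SamplesCollisionFree q s' U c) : SamplesCollisionFree (p ;; q) s U c :=
  ⟨fun r hr => h.seq_law (output m n) _ _ fun s' hs' => (hq s' hs').1 r hr,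
    h.seq_law (output m n) _ _ fun s' hs' => (hq s' hs').2⟩

/-- The lists `R l` of rows form a path decomposition of width at most `ω` of the graph of the
first `n` columns of `u`, and these columns are orthonormal. -/
structure RowLists (m n ω : ℕ) (u : ℕ → ℕ → ℂ) (R : ℕ → List ℕ) : Prop where
  lt : ∀ l < n, ∀ i ∈ R l, i < m
  length_le : ∀ l < n, (R l).length ≤ ω
  convex : ∀ i l l' l'', l ≤ l' → l' ≤ l'' → l'' < n → i ∈ R l → i ∈ R l'' → i ∈ R l'
  supp : ∀ i < m, ∀ l < n, u i l ≠ 0 → i ∈ R l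
  orth : ∀ l < n, ∀ l' < n,
    ∑ i ∈ range m, u i l * starRingEnd ℂ (u i l') = if l = l' then 1 else 0

/-- The state holds the columns `u` and the lists `R l`, and is zero elsewhere. -/
structure HoldsRows (m n : ℕ) (u : ℕ → ℕ → ℂ) (R : ℕ → List ℕ) (s : State) : Prop where
  photons : s.reg 0 = n
  regs : ∀ v, 3 ≤ v → v ≤ 5 → s.reg v = 0
  lengths : ∀ l < n, s.nat 1 l 0 = (R l).length
  rows : ∀ l < n, ∀ q < (R l).length, s.nat 2 l q = (R l).getD q 0
  nats : ∀ a, 3 ≤ a → ∀ i j, s.nat a i j = 0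
  cpxs : ∀ a, 1 ≤ a → s.cpx a = 0
  amps : ∀ i < m, ∀ l < n, s.cpx 0 i (s.nat 0 l 0) = u i l

/-- The candidates that have been found when the pairs `S` of a column and a row have been
processed. -/
structure Found (S : ℕ → ℕ → Prop) (cand : List ℕ) (s : State) : Prop where
  nodup : cand.Nodup
  length : s.reg 4 = cand.length
  cands : ∀ x < cand.length, s.nat 7 x 0 = cand.getD x 0
  pos : ∀ i ∈ cand, s.nat 8 i 0 ≠ 0
  zero : ∀ i ∉ cand, s.nat 8 i 0 = 0
  fst : ∀ i ∈ cand, S (s.nat 8 i 0 - 1) i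
  lst : ∀ i ∈ cand, S (s.nat 6 i 0) i
  range : ∀ l i, S l i → i ∈ cand ∧ s.nat 8 i 0 - 1 ≤ l ∧ l ≤ s.nat 6 i 0

theorem Found.congr {S S' : ℕ → ℕ → Prop} {cand : List ℕ} {s s' : State} (h : Found S cand s)
    (hS : ∀ l i, S' l i ↔ S l i) (h4 : s'.reg 4 = s.reg 4)
    (hn : ∀ a, 6 ≤ a → a ≤ 8 → s'.nat a = s.nat a) : Found S' cand s' := by
  obtain rfl : S' = S := by
    funext l i
    exact propext (hS l i)
  obtain ⟨h1, h2, h3, h5, h6, h7, h8, h9⟩ := h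
  have e6 := hn 6 le_rfl (by norm_num)
  have e7 := hn 7 (by norm_num) (by norm_num)
  have e8 := hn 8 (by norm_num) le_rfl
  constructor
  · exact h1
  · rwa [h4]
  · rwa [e7]
  · rwa [e8]
  · rwa [e8]
  · rwa [e8]
  · rwa [e6]
  · rwa [e6, e8]

/-- Process the row number `q` (register `11`) of the column in register `10`. -/
def findProg : Program :=
  .setReg 12 (.read 2 (.reg 10) (.reg 11)) ;;
  .setNat 6 (.reg 12) (.const 0) (.reg 10) ;;
  .ifZero (.read 8 (.reg 12) (.const 0))
    (.setNat 8 (.reg 12) (.const 0) (.add (.reg 10) (.const 1)) ;;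
      .setNat 7 (.reg 4) (.const 0) (.reg 12) ;;
      .setReg 4 (.add (.reg 4) (.const 1)))
    .skip

/-- The columns come in increasing order by `hS`. So array `6`, overwritten each time, ends with the
last column, while array `8`, written only while zero, keeps the first one plus one; the offset lets
zero mean "not yet seen". -/
theorem findProg_hoare {S : ℕ → ℕ → Prop} {cand : List ℕ} {s : State} {l q i : ℕ}
    (h : Found S cand s) (hS : ∀ l' i', S l' i' → l' ≤ l) (hl : s.reg 10 = l) (hq : s.reg 11 = q)
    (hi : s.nat 2 l q = i) :
    Hoare findProg s 26 fun s' => ∃ cand', Found (fun l' i' => S l' i' ∨ l' = l ∧ i' = i) cand' s' := by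
  refine Hoare.block rfl (by decide) ?_
  by_cases hc : i ∈ cand
  · refine ⟨cand, ?_⟩
    have h8 := h.pos i hc
    have hrun : findProg.run s = (s.setReg 12 i).setNat 6 i 0 l := by
      simp [findProg, Program.run, NatExp.eval, State.setReg, State.setNat, hl, hq, hi, h8]
    rw [hrun]
    obtain ⟨h1, h2, h3, h5, h6, h7, h9, h10⟩ := h
    constructor
    · exact h1
    · exact h2
    · exact h3
    · exact h5
    · exact h6
    · exact fun i' hi' => Or.inl (h7 i' hi')
    · intro i' hi'
      by_cases hii : i' = i
      · right; simp [State.setReg, State.setNat, hii]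
      · left; simpa [State.setReg, State.setNat, hii] using h9 i' hi'
    · rintro l' i' (h | ⟨rfl, rfl⟩)
      · obtain ⟨g1, g2, g3⟩ := h10 l' i' h
        refine ⟨g1, g2, ?_⟩
        by_cases hii : i' = i
        · simpa [State.setReg, State.setNat, hii] using hS l' i' h
        · simpa [State.setReg, State.setNat, hii] using g3
      · refine ⟨hc, ?_, ?_⟩
        · exact hS _ _ (h7 _ hc)
        · simp [State.setReg, State.setNat]
  · refine ⟨cand ++ [i], ?_⟩
    have h8 := h.zero i hc
    have hrun : findProg.run s = ((((s.setReg 12 i).setNat 6 i 0 l).setNat 8 i 0 (l + 1)).setNat 7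
        cand.length 0 i).setReg 4 (cand.length + 1) := by
      simp [findProg, Program.run, NatExp.eval, State.setReg, State.setNat, hl, hq, hi, h8,
        h.length]
    rw [hrun]
    obtain ⟨h1, h2, h3, h5, h6, h7, h9, h10⟩ := h
    have hne : ∀ i' ∈ cand, i' ≠ i := fun i' hi' he => hc (he ▸ hi')
    constructor
    · exact h1.append (List.nodup_singleton i) (by simpa using hc)
    · simp [State.setReg]
    · intro x hx
      simp only [List.length_append, List.length_singleton] at hx
      rcases (Nat.lt_succ_iff_lt_or_eq.1 hx) with hx | rfl
      · have := h3 x hx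
        simpa [State.setReg, State.setNat, hx.ne, List.getD_eq_getElem?_getD,
          List.getElem?_append, hx] using this
      · simp [State.setReg, State.setNat, List.getD_eq_getElem?_getD]
    · intro i' hi'
      rcases List.mem_append.1 hi' with hi' | hi'
      · simpa [State.setReg, State.setNat, hne i' hi'] using h5 i' hi'
      · obtain rfl := List.mem_singleton.1 hi'
        simp [State.setReg, State.setNat]
    · intro i' hi'
      simp only [List.mem_append, List.mem_singleton, not_or] at hi'
      simpa [State.setReg, State.setNat, hi'.2] using h6 i' hi'.1
    · intro i' hi'
      rcases List.mem_append.1 hi' with hi' | hi'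
      · left; simpa [State.setReg, State.setNat, hne i' hi'] using h7 i' hi'
      · obtain rfl := List.mem_singleton.1 hi'
        right; simp [State.setReg, State.setNat]
    · intro i' hi'
      rcases List.mem_append.1 hi' with hi' | hi'
      · left; simpa [State.setReg, State.setNat, hne i' hi'] using h9 i' hi'
      · obtain rfl := List.mem_singleton.1 hi'
        right; simp [State.setReg, State.setNat]
    · rintro l' i' (h | ⟨rfl, rfl⟩)
      · obtain ⟨g1, g2, g3⟩ := h10 l' i' h
        refine ⟨List.mem_append_left _ g1, ?_⟩
        simpa [State.setReg, State.setNat, hne i' g1] using And.intro (Nat.sub_le_iff_le_add.1 g2) g3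
      · simp [State.setReg, State.setNat]

/-- The preparation: find the candidate rows, and the first and the last column in whose node each
of them occurs. -/
def initProg : Program :=
  .loop 10 (.reg 0)
    (.setNat 13 (.reg 10) (.const 0) (.const 1) ;;
      .loop 11 (.read 1 (.reg 10) (.const 0)) findProg) ;;
  .setReg 6 (.const 1)

section Init

variable {m n ω : ℕ} {u : ℕ → ℕ → ℂ} {R : ℕ → List ℕ}

/-- By convexity a row whose first and last columns enclose `l` belongs to `R l`, which bounds the
width; the candidates lie in the union of the `n` lists, which bounds their number. -/
theorem RowLists.geometry (hR : RowLists m n ω u R) {cand : List ℕ} {s : State}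
    (h : Found (fun l i => l < n ∧ i ∈ R l) cand s) :
    Geometry m n ω u cand (fun i => s.nat 8 i 0 - 1) (fun i => s.nat 6 i 0) where
  nodup := h.nodup
  lt i hi := hR.lt _ (h.lst i hi).1 i (h.lst i hi).2
  le i hi := (h.range _ _ (h.fst i hi)).2.2
  supp i hi l hl hu := h.range l i ⟨hl, hR.supp i hi l hl hu⟩
  width l hl := by
    refine le_trans ?_ (hR.length_le l hl)
    refine List.Subperm.length_le (List.subperm_of_subset (h.nodup.filter _) fun i hi => ?_)
    simp only [List.mem_filter, decide_eq_true_eq] at hi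
    obtain ⟨hi, h1, h2⟩ := hi
    exact hR.convex i _ l _ h1 h2 (h.lst i hi).1 (h.fst i hi).2 (h.lst i hi).2
  length_le := by
    rw [← List.toFinset_card_of_nodup h.nodup]
    calc _ ≤ #((range n).biUnion fun l => (R l).toFinset) := by
          refine card_le_card fun i hi => ?_
          have := h.fst i (List.mem_toFinset.1 hi)
          exact mem_biUnion.2 ⟨_, mem_range.2 this.1, List.mem_toFinset.2 this.2⟩
      _ ≤ #(range n) * ω := card_biUnion_le_card_mul _ _ _ fun l hl =>
          (List.toFinset_card_le _).trans (hR.length_le l (mem_range.1 hl))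
      _ = n * ω := by rw [card_range]
  orth := hR.orth

/-- With no photons recorded, nearly all data of the sampler are the initial zeros; only the powers
`2 ^ 0` in array `13` and register `6` have to be written. -/
theorem initProg_hoare (hR : RowLists m n ω u R) {s : State} (hs : HoldsRows m n u R s) :
    Hoare initProg s (n * (27 * ω + 12) + 10) fun s' => ∃ cand fst lst,
      Geometry m n ω u cand fst lst ∧ Static n u cand fst lst s' ∧ Dyn n fst lst ∅ [] s' := by
  refine Hoare.seq (t₁ := n * (27 * ω + 12) + 2) (t₂ := 2) (Hoare.loop (t := 27 * ω + 11)
    (fun k s' => (∃ cand, Found (fun l i => l < k ∧ i ∈ R l) cand s') ∧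
      ∀ l < k, s'.nat 13 l 0 = 1) n hs.photons ?_ ?_ (by simp only [NatExp.cost]; grind)) ?_
      (by omega)
  · refine ⟨⟨[], ?_⟩, by simp⟩
    constructor <;> simp [hs.regs, hs.nats]
  · rintro k hk s' ⟨⟨cand, hF⟩, h13⟩ hfr
    refine Hoare.seq (t₁ := 4) (t₂ := 27 * ω + 5) (Q := fun s'' =>
      (∃ cand, Found (fun l i => l < k ∧ i ∈ R l) cand s'') ∧ (∀ l < k + 1, s''.nat 13 l 0 = 1) ∧
        s''.reg 10 = k) (Hoare.block rfl (by decide) ⟨⟨cand, ?_⟩, ?_, ?_⟩) ?_ (by omega)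
    · refine hF.congr (fun _ _ => Iff.rfl) ?_ fun a h1 h2 => ?_
      · simp [Program.run, State.setNat, State.setReg]
      · funext i j
        have : a ≠ 13 := by omega
        simp [Program.run, State.setNat, State.setReg, this]
    · intro l hl
      by_cases hlk : l = k
      · simp [Program.run, NatExp.eval, State.setNat, State.setReg, hlk]
      · simpa [Program.run, NatExp.eval, State.setNat, State.setReg, hlk] using h13 l (by omega)
    · simp [Program.run, State.setNat, State.setReg]
    · rintro s₂ ⟨⟨cand, hF⟩, h13, h10⟩ hfr₂
      have hlen : s₂.nat 1 k 0 = (R k).length := by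
        rw [hfr₂.nat 1 rfl, ← hs.lengths k hk, ← hfr.nat 1 rfl]
        rfl
      have hrow : ∀ q < (R k).length, s₂.nat 2 k q = (R k).getD q 0 := by
        intro q hq
        rw [hfr₂.nat 2 rfl, ← hs.rows k hk q hq, ← hfr.nat 2 rfl]
        rfl
      refine Hoare.mono (Hoare.loop (t := 26) (t' := 27 * ω + 5) (fun q s' =>
        (∃ cand, Found (fun l i => (l < k ∧ i ∈ R l) ∨ (l = k ∧ i ∈ (R k).take q)) cand s'))
        (R k).length (by simp [NatExp.eval, h10, hlen]) ⟨cand, ?_⟩ ?_ ?_) le_rfl ?_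
      · exact hF.congr (by simp) rfl fun _ _ _ => rfl
      · rintro q hq s₃ ⟨cand, hF⟩ hfr₃
        refine Hoare.mono (findProg_hoare (l := k) (q := q) (i := (R k).getD q 0)
          (hF.congr (s' := s₃.setReg 11 q) (fun _ _ => Iff.rfl) (by simp [State.setReg])
            fun _ _ _ => rfl) ?_ ?_ (by simp [State.setReg]) ?_) le_rfl ?_
        · rintro l' i' (h | h)
          · exact h.1.le
          · exact h.1.le
        · have := hfr₃.reg 10 rfl
          simpa [State.setReg, h10] using this
        · rw [← hrow q hq, ← hfr₃.nat 2 rfl]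
          rfl
        · rintro s₄ ⟨cand', h'⟩ -
          refine ⟨cand', h'.congr (fun l i => ?_) rfl fun _ _ _ => rfl⟩
          rw [List.take_add_one, List.getD_eq_getElem?_getD, List.getElem?_eq_getElem hq]
          simp only [List.mem_append, Option.toList_some, List.mem_singleton, Option.getD_some]
          tauto
      · simp only [NatExp.cost]
        have := hR.length_le k hk
        omega
      · rintro s₃ ⟨cand, h⟩ hfr₃
        refine ⟨⟨cand, h.congr (fun l i => ?_) rfl fun _ _ _ => rfl⟩, ?_⟩
        · rw [List.take_length, Nat.lt_succ_iff_lt_or_eq]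
          constructor
          · rintro ⟨h1 | rfl, h2⟩
            · exact Or.inl ⟨h1, h2⟩
            · exact Or.inr ⟨rfl, h2⟩
          · rintro (⟨h1, h2⟩ | ⟨rfl, h2⟩)
            · exact ⟨Or.inl h1, h2⟩
            · exact ⟨Or.inr rfl, h2⟩
        · rwa [hfr₃.nat 13 rfl]
  · rintro s' ⟨⟨cand, hF⟩, h13⟩ hfr
    refine Hoare.block rfl (by decide) ⟨cand, _, _, hR.geometry hF, ?_, ?_⟩
    · constructor
      · show s'.reg 0 = n
        rw [hfr.reg 0 rfl, hs.photons]
      · exact hF.length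
      · exact hF.cands
      · intro i hi
        have := hF.pos i hi
        show s'.nat 8 i 0 = _
        omega
      · exact fun _ _ => rfl
      · intro i hi l hl
        show s'.cpx 0 i (s'.nat 0 l 0) = _
        rw [hfr.cpx 0 rfl, hfr.nat 0 rfl, hs.amps i ((hR.geometry hF).lt i hi) l hl]
    · constructor
      · show s'.reg 3 = 0
        rw [hfr.reg 3 rfl, hs.regs 3 le_rfl (by norm_num)]
      · simp
      · intro i
        show s'.nat 5 i 0 = _
        rw [hfr.nat 5 rfl, hs.nats 5 (by norm_num)]
        simp
      · intro i _
        show s'.nat 4 i 0 = _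
        rw [hfr.nat 4 rfl, hs.nats 4 (by norm_num)]
        simp
      · simp [Program.run, State.setReg, NatExp.eval]
      · intro i _
        show s'.cpx 1 i = 0 ∧ s'.cpx 2 i = 0
        rw [hfr.cpx 1 rfl, hfr.cpx 2 rfl, hs.cpxs 1 le_rfl, hs.cpxs 2 (by norm_num)]
        exact ⟨rfl, rfl⟩
      · constructor
        · simp
        · simp [active]
        · intro l _
          show s'.nat 11 l 0 = _
          rw [hfr.nat 11 rfl, hs.nats 11 (by norm_num)]
          simp [active]
        · intro l _
          show s'.nat 12 l 0 = _
          rw [hfr.nat 12 rfl, hs.nats 12 (by norm_num)]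
          simp [expired, code]
        · intro l hl
          show s'.nat 13 l 0 = _
          rw [h13 l hl]
          simp [active]

/-- The sampler. -/
def sampler : Program := initProg ;; mainLoop

/-- A bound for the number of steps that the sampler takes. -/
def samplerTime (n ω : ℕ) : ℕ := n * (27 * ω + 12) + 10 + (n * (stepTime n ω + 1) + 2)

theorem sampler_samples (hR : RowLists m n ω u R) {s : State} (hs : HoldsRows m n u R s)
    {U : Matrix (Fin m) (Fin m) ℂ} {c : Fin n → Fin m}
    (hu : ∀ (i : Fin m) (l : Fin n), u i l = U i (c l)) (hc : Function.Injective c) :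
    SamplesCollisionFree sampler s U c :=
  SamplesCollisionFree.seq (initProg_hoare hR hs) fun _ ⟨_, _, _, G, hS, hD⟩ =>
    samplesCollisionFree_of_sim G hu hc (mainLoop_sim G hS hD)

theorem sampler_hoare (hR : RowLists m n ω u R) {s : State} (hs : HoldsRows m n u R s) :
    Hoare sampler s (samplerTime n ω) fun _ => True :=
  Hoare.seq (initProg_hoare hR hs) (fun _ ⟨_, _, _, G, hS, hD⟩ _ =>
    (mainLoop_sim G hS hD).hoare.mono le_rfl fun _ _ _ => trivial) le_rfl

end Init

/-! ### Linear tree decompositions -/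

section Tree

variable {m n : ℕ} {U : Matrix (Fin m) (Fin m) ℂ} {T : TreeDecomposition U (Fin m)}
  {c : Fin n → Fin m}

/-- A walk in the path graph changes the node number by one at a time, so it cannot pass `j'`
without visiting it. -/
theorem TreeDecomposition.IsLinear.convex (hT : T.IsLinear) {r j j' j'' : Fin m} (h : j ≤ j')
    (h' : j' ≤ j'') (hj : r ∈ T.rho j) (hj'' : r ∈ T.rho j'') : r ∈ T.rho j' := by
  by_contra hr
  have hne : ∀ t, r ∈ T.rho t → (t : ℕ) ≠ j' := fun t ht he => hr (Fin.ext he ▸ ht)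
  have key : ∀ a b : {t | r ∈ T.rho t}, (T.tree.induce {t | r ∈ T.rho t}).Walk a b →
      (a : Fin m) < j' → (b : Fin m) < j' := by
    intro a b w
    induction w with
    | nil => exact id
    | @cons x y z hxy _ ih =>
      intro hx
      refine ih ?_
      rw [SimpleGraph.comap_adj, hT.1, SimpleGraph.pathGraph_adj] at hxy
      have := hne y y.2
      simp only [Function.Embedding.subtype_apply] at hxy
      rw [Fin.lt_def] at hx ⊢
      omega
  obtain ⟨w⟩ := (T.rows_connected r).preconnected ⟨j, hj⟩ ⟨j'', hj''⟩
  exact absurd (key _ _ w (lt_of_le_of_ne h fun he => hne j hj (congrArg _ he))) (not_lt.2 h')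

theorem TreeDecomposition.IsLinear.mem_rho (hT : T.IsLinear) {r j : Fin m} (h : U r j ≠ 0) :
    r ∈ T.rho j := by
  obtain ⟨t, h1, h2⟩ := T.edges_covered r j h
  rw [hT.2.2, mem_singleton] at h2
  rwa [h2]

theorem TreeDecomposition.IsLinear.card_rho_le (hT : T.IsLinear) (j : Fin m) :
    #(T.rho j) ≤ T.treewidth := by
  have h := le_sup (f := fun t => #(T.rho t) + #(T.kappa t)) (mem_univ j)
  simp only [hT.2.2, card_singleton] at h
  rw [treewidth]
  simp only [hT.2.2, card_singleton]
  omega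

/-- A unitary matrix has no zero column. This matters because `timeBound` vanishes for `ω = 0`. -/
theorem TreeDecomposition.IsLinear.treewidth_pos (hT : T.IsLinear)
    (hU : U ∈ Matrix.unitaryGroup (Fin m) ℂ) (j : Fin m) : 1 ≤ T.treewidth := by
  by_contra h0
  have hz : ∀ r, U r j = 0 := by
    intro r
    by_contra h
    have h1 := hT.card_rho_le j
    have h2 := card_pos.2 ⟨r, hT.mem_rho h⟩
    omega
  have h1 := congrFun (congrFun (Matrix.mem_unitaryGroup_iff'.1 hU) j) j
  rw [Matrix.mul_apply] at h1
  simp [hz] at h1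

/-- The columns `c` of `U`. -/
noncomputable def amp (U : Matrix (Fin m) (Fin m) ℂ) (c : Fin n → Fin m) (i l : ℕ) : ℂ :=
  if h : i < m ∧ l < n then U ⟨i, h.1⟩ (c ⟨l, h.2⟩) else 0

theorem amp_coe (U : Matrix (Fin m) (Fin m) ℂ) (c : Fin n → Fin m) (i : Fin m) (l : Fin n) :
    amp U c i l = U i (c l) := by
  rw [amp, dif_pos ⟨i.2, l.2⟩]

/-- Stated for any lists of the rows in the nodes, to cover both lists read from the input and light
cones computed by the machine. -/
theorem TreeDecomposition.IsLinear.rowLists (hT : T.IsLinear)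
    (hU : U ∈ Matrix.unitaryGroup (Fin m) ℂ) (hc : StrictMono c) {R : ℕ → List ℕ}
    (hR : ∀ l : Fin n, (R l).Nodup)
    (hmem : ∀ (l : Fin n) (i : ℕ), i ∈ R l ↔ ∃ r ∈ T.rho (c l), (r : ℕ) = i) :
    RowLists m n T.treewidth (amp U c) R where
  lt l hl i hi := by
    obtain ⟨r, -, rfl⟩ := (hmem ⟨l, hl⟩ i).1 hi
    exact r.2
  length_le l hl := by
    refine le_trans ?_ (hT.card_rho_le (c ⟨l, hl⟩))
    rw [← List.toFinset_card_of_nodup (hR ⟨l, hl⟩), ← card_map Fin.valEmbedding]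
    refine card_le_card fun i hi => ?_
    obtain ⟨r, hr, rfl⟩ := (hmem ⟨l, hl⟩ i).1 (List.mem_toFinset.1 hi)
    exact mem_map_of_mem _ hr
  convex i l l' l'' h h' hl hi hi' := by
    obtain ⟨r, hr, rfl⟩ := (hmem ⟨l, by omega⟩ i).1 hi
    obtain ⟨r', hr', he⟩ := (hmem ⟨l'', hl⟩ r).1 hi'
    rw [Fin.ext he] at hr'
    exact (hmem ⟨l', by omega⟩ r).2 ⟨r, hT.convex (hc.monotone h) (hc.monotone h') hr hr', rfl⟩
  supp i hi l hl h := by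
    rw [amp, dif_pos ⟨hi, hl⟩] at h
    exact (hmem ⟨l, hl⟩ i).2 ⟨⟨i, hi⟩, hT.mem_rho h, rfl⟩
  orth l hl l' hl' := by
    -- In `star U * U` the conjugate factor comes first, hence the exchanged columns.
    have h1 := congrFun (congrFun (Matrix.mem_unitaryGroup_iff'.1 hU) (c ⟨l', hl'⟩)) (c ⟨l, hl⟩)
    rw [Matrix.mul_apply, Matrix.one_apply] at h1
    rw [Finset.sum_range]
    have h2 : ((c ⟨l', hl'⟩) = (c ⟨l, hl⟩)) ↔ l = l' := by
      rw [hc.injective.eq_iff, Fin.mk.injEq, eq_comm]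
    simp only [h2] at h1
    rw [← h1]
    refine sum_congr rfl fun i _ => ?_
    rw [amp_coe U c i ⟨l, hl⟩, amp_coe U c i ⟨l', hl'⟩, Matrix.star_apply, mul_comm]
    rfl

/-- The rows in the nodes of the columns `c`. -/
def rowList (c : Fin n → Fin m) (T : TreeDecomposition U (Fin m)) (l : ℕ) : List ℕ :=
  if h : l < n then (T.rho (c ⟨l, h⟩)).sort.map Fin.val else []

theorem rowList_nodup (l : Fin n) : (rowList c T l).Nodup := by
  rw [rowList, dif_pos l.2]
  exact (sort_nodup _ _).map Fin.val_injective

theorem mem_rowList (l : Fin n) (i : ℕ) :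
    i ∈ rowList c T l ↔ ∃ r ∈ T.rho (c l), (r : ℕ) = i := by
  rw [rowList, dif_pos l.2]
  simp

theorem treeInput_holdsRows : HoldsRows m n (amp U c) (rowList c T) (treeInput U c T) where
  photons := rfl
  regs v h h' := by
    have h0 : v ≠ 0 := by omega
    have h1 : v ≠ 1 := by omega
    simp [treeInput, h0, h1]
  lengths l hl := by simp [treeInput, rowList, hl]
  rows l hl q hq := by simp [treeInput, rowList, hl]
  nats a ha i j := by
    have h0 : a ≠ 0 := by omega
    have h1 : a ≠ 1 := by omega
    have h2 : a ≠ 2 := by omega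
    simp [treeInput, h0, h1, h2]
  cpxs a ha := by
    funext i j
    have h0 : a ≠ 0 := by omega
    simp [treeInput, h0]
  amps i hi l hl := by simp [treeInput, amp, hi, hl]

/-- Each monomial of `samplerTime` is dominated by one of the two in `timeBound`, since `n` and `ω`
are positive; the coefficients sum to less than `1000`. -/
theorem samplerTime_le {n ω : ℕ} (hn : 1 ≤ n) (hω : 1 ≤ ω) :
    samplerTime n ω ≤ 1000 * timeBound n ω := by
  set T := ω * n ^ 3 with hT
  set S := n ^ 2 * 2 ^ ω * ω ^ 2 with hS
  have a1 : n ^ 2 * 2 ^ ω * ω ^ 1 ≤ S := by rw [hS]; gcongr; norm_num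
  have a2 : n ^ 2 * 2 ^ ω * ω ^ 0 ≤ S := by rw [hS]; gcongr; norm_num
  have b0 : 1 * n ^ 0 ≤ T := by rw [hT]; gcongr; norm_num
  have b1 : 1 * n ^ 1 ≤ T := by rw [hT]; gcongr; norm_num
  have b2 : 1 * n ^ 2 ≤ T := by rw [hT]; gcongr; norm_num
  have c1 : ω * n ^ 1 ≤ T := by rw [hT]; gcongr; norm_num
  have c2 : ω * n ^ 2 ≤ T := by rw [hT]; gcongr; norm_num
  have h : samplerTime n ω = 200 * (n ^ 2 * 2 ^ ω * ω ^ 1) + 120 * (n ^ 2 * 2 ^ ω * ω ^ 0) +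
      30 * T + 100 * (ω * n ^ 2) + 200 * (1 * n ^ 2) + 27 * (ω * n ^ 1) + 163 * (1 * n ^ 1) +
      12 * (1 * n ^ 0) := by
    rw [samplerTime, stepTime, hT]
    ring
  rw [h, timeBound]
  omega

theorem treeInput_samples (hU : U ∈ Matrix.unitaryGroup (Fin m) ℂ) (hT : T.IsLinear)
    (hc : StrictMono c) : SamplesCollisionFree sampler (treeInput U c T) U c :=
  sampler_samples (hT.rowLists hU hc rowList_nodup mem_rowList) treeInput_holdsRows
    (amp_coe U c) hc.injective

theorem treeInput_runsInTime (hU : U ∈ Matrix.unitaryGroup (Fin m) ℂ) (hT : T.IsLinear)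
    (hn : 1 ≤ n) (hc : StrictMono c) :
    sampler.RunsInTime (treeInput U c T) (1000 * timeBound n T.treewidth) := fun x hx =>
  (sampler_hoare (hT.rowLists hU hc rowList_nodup mem_rowList) treeInput_holdsRows x hx).2.trans
    (samplerTime_le hn (hT.treewidth_pos hU (c ⟨0, hn⟩)))

end Tree

/-! ### Nearest-neighbour circuits -/

theorem conj_exp_I_mul (x : ℝ) :
    starRingEnd ℂ (Complex.exp (Complex.I * x)) = Complex.exp (-(Complex.I * x)) := by
  rw [← Complex.exp_conj]
  simp

theorem conj_exp_neg_I_mul (x : ℝ) :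
    starRingEnd ℂ (Complex.exp (-(Complex.I * x))) = Complex.exp (Complex.I * x) := by
  rw [← Complex.exp_conj]
  simp

theorem beamsplitter_row_row (θ φT φR : ℝ) (x y : Fin 2) :
    beamsplitter θ φT φR x 0 * starRingEnd ℂ (beamsplitter θ φT φR y 0) +
      beamsplitter θ φT φR x 1 * starRingEnd ℂ (beamsplitter θ φT φR y 1) =
      if x = y then 1 else 0 := by
  have hc : (Real.cos θ : ℂ) ^ 2 + (Real.sin θ : ℂ) ^ 2 = 1 := by
    norm_cast
    rw [Real.cos_sq_add_sin_sq]
  have hT : Complex.exp (Complex.I * φT) * Complex.exp (-(Complex.I * φT)) = 1 := by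
    rw [← Complex.exp_add, add_neg_cancel, Complex.exp_zero]
  have hR : Complex.exp (Complex.I * φR) * Complex.exp (-(Complex.I * φR)) = 1 := by
    rw [← Complex.exp_add, add_neg_cancel, Complex.exp_zero]
  fin_cases x <;> fin_cases y <;>
    simp only [beamsplitter, Fin.zero_eta, Fin.mk_one, Fin.isValue, Matrix.of_apply,
      Matrix.cons_val_zero, Matrix.cons_val_one, Matrix.cons_val', Matrix.cons_val_fin_one,
      map_mul, map_neg, conj_exp_I_mul, conj_exp_neg_I_mul, Complex.conj_ofReal, if_true,
      zero_ne_one, one_ne_zero, if_false]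
  · linear_combination hc + (Real.cos θ : ℂ) ^ 2 * hT + (Real.sin θ : ℂ) ^ 2 * hR
  · ring
  · ring
  · linear_combination hc + (Real.cos θ : ℂ) ^ 2 * hT + (Real.sin θ : ℂ) ^ 2 * hR

section Layer

variable {m p : ℕ} {ψ : LayerAngles}

/-- Rows as sums of two indicators make the inner products of rows computable by `sum_ite_eq'`. -/
theorem layer_first {i i' : Fin m} (h : (i : ℕ) % 2 = p % 2) (hi : (i' : ℕ) = i + 1) (j : Fin m) :
    layer m p ψ i j = (if j = i then beamsplitter (ψ.θ i) (ψ.φT i) (ψ.φR i) 0 0 else 0) +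
      if j = i' then beamsplitter (ψ.θ i) (ψ.φT i) (ψ.φR i) 0 1 else 0 := by
  have := i'.2
  simp only [layer, Fin.ext_iff]
  split_ifs <;> first | omega | simp

theorem layer_second {i i' : Fin m} (h : (i : ℕ) % 2 = p % 2) (hi : (i' : ℕ) = i + 1) (j : Fin m) :
    layer m p ψ i' j = (if j = i then beamsplitter (ψ.θ i) (ψ.φT i) (ψ.φR i) 1 0 else 0) +
      if j = i' then beamsplitter (ψ.θ i) (ψ.φT i) (ψ.φR i) 1 1 else 0 := by
  have := i'.2
  have h1 : ¬ ((i' : ℕ) % 2 = p % 2 ∧ (i' : ℕ) + 1 < m) := by omega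
  have h2 : 1 ≤ (i' : ℕ) ∧ ((i' : ℕ) - 1) % 2 = p % 2 := by
    rw [hi, Nat.add_sub_cancel]
    omega
  have hne : i ≠ i' := fun he => by rw [← he] at hi; omega
  rw [layer, if_neg h1, if_pos h2]
  by_cases hj : j = i
  · subst hj
    rw [if_pos hi.symm, if_pos rfl, if_neg hne, add_zero]
  · have hj' : (j : ℕ) + 1 ≠ i' := fun he => hj (Fin.ext (by omega))
    rw [if_neg hj', if_neg hj, zero_add, hi, Nat.add_sub_cancel]

theorem layer_single {i : Fin m} (h : ¬ ((i : ℕ) % 2 = p % 2 ∧ (i : ℕ) + 1 < m))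
    (h' : ¬ (1 ≤ (i : ℕ) ∧ ((i : ℕ) - 1) % 2 = p % 2)) (j : Fin m) :
    layer m p ψ i j = if j = i then 1 else 0 := by
  rw [layer, if_neg h, if_neg h']

theorem layer_cases (p : ℕ) (i : Fin m) :
    (∃ i' : Fin m, (i : ℕ) % 2 = p % 2 ∧ (i' : ℕ) = i + 1) ∨
    (∃ i' : Fin m, (i' : ℕ) % 2 = p % 2 ∧ (i : ℕ) = i' + 1) ∨
    (¬ ((i : ℕ) % 2 = p % 2 ∧ (i : ℕ) + 1 < m) ∧ ¬ (1 ≤ (i : ℕ) ∧ ((i : ℕ) - 1) % 2 = p % 2)) := by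
  by_cases h : (i : ℕ) % 2 = p % 2 ∧ (i : ℕ) + 1 < m
  · exact Or.inl ⟨⟨i + 1, h.2⟩, h.1, rfl⟩
  · by_cases h' : 1 ≤ (i : ℕ) ∧ ((i : ℕ) - 1) % 2 = p % 2
    · exact Or.inr (Or.inl ⟨⟨i - 1, by omega⟩, h'.2, by simp; omega⟩)
    · exact Or.inr (Or.inr ⟨h, h'⟩)

theorem sum_pair_mul_conj_pair {i i' k k' : Fin m} (hi : (i' : ℕ) = i + 1) (hk : (k' : ℕ) = k + 1)
    (hp : (i : ℕ) % 2 = k % 2) (a b c d : ℂ) :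
    ∑ j, ((if j = i then a else 0) + if j = i' then b else 0) *
      starRingEnd ℂ ((if j = k then c else 0) + if j = k' then d else 0) =
      if i = k then a * starRingEnd ℂ c + b * starRingEnd ℂ d else 0 := by
  simp only [map_add, apply_ite (starRingEnd ℂ), map_zero, add_mul, sum_add_distrib,
    ite_mul, zero_mul, sum_ite_eq', mem_univ, if_true]
  simp only [Fin.ext_iff]
  split_ifs <;> first | omega | simp

theorem sum_pair_mul_conj_single {i i' k : Fin m} (hi : i ≠ k) (hi' : i' ≠ k) (a b : ℂ) :
    ∑ j, ((if j = i then a else 0) + if j = i' then b else 0) *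
      starRingEnd ℂ (if j = k then 1 else 0) = 0 := by
  simp [apply_ite (starRingEnd ℂ), hi.symm, hi'.symm]

/-- Two rows of the same pair are orthonormal because the beamsplitter is unitary; otherwise
distinct rows have disjoint supports. -/
theorem layer_mem_unitaryGroup (m p : ℕ) (ψ : LayerAngles) :
    layer m p ψ ∈ Matrix.unitaryGroup (Fin m) ℂ := by
  have hconj : ∀ x y : Fin m → ℂ, ∑ j, x j * starRingEnd ℂ (y j) =
      starRingEnd ℂ (∑ j, y j * starRingEnd ℂ (x j)) := by
    intro x y
    simp [mul_comm]
  have hB := fun a x y => beamsplitter_row_row (ψ.θ a) (ψ.φT a) (ψ.φR a) x y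
  rw [Matrix.mem_unitaryGroup_iff]
  ext i k
  rw [Matrix.mul_apply, Matrix.one_apply]
  simp only [Matrix.star_apply, RCLike.star_def]
  rcases layer_cases p i with ⟨i', h1, h2⟩ | ⟨i', h1, h2⟩ | h <;>
    rcases layer_cases p k with ⟨k', g1, g2⟩ | ⟨k', g1, g2⟩ | g
  · simp only [layer_first h1 h2, layer_first g1 g2]
    rw [sum_pair_mul_conj_pair h2 g2 (h1.trans g1.symm)]
    split_ifs with he
    · rw [← he, hB, if_pos rfl]
    · rfl
  · simp only [layer_first h1 h2, layer_second g1 g2]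
    rw [sum_pair_mul_conj_pair h2 g2 (h1.trans g1.symm), if_neg (c := i = k)]
    · split_ifs with he
      · rw [← he, hB, if_neg zero_ne_one]
      · rfl
    · rw [Fin.ext_iff]; omega
  · simp only [layer_first h1 h2, layer_single g.1 g.2]
    have := k.2
    have := i'.2
    have hik : i ≠ k := fun he => by rw [Fin.ext_iff] at he; omega
    rw [sum_pair_mul_conj_single hik (fun he => by rw [Fin.ext_iff] at he; omega), if_neg hik]
  · simp only [layer_second h1 h2, layer_first g1 g2]
    rw [sum_pair_mul_conj_pair h2 g2 (h1.trans g1.symm), if_neg (c := i = k)]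
    · split_ifs with he
      · rw [← he, hB, if_neg one_ne_zero]
      · rfl
    · rw [Fin.ext_iff]; omega
  · simp only [layer_second h1 h2, layer_second g1 g2]
    rw [sum_pair_mul_conj_pair h2 g2 (h1.trans g1.symm)]
    have he : i' = k' ↔ i = k := by simp only [Fin.ext_iff]; omega
    simp only [he]
    split_ifs with hik
    · rw [← he.2 hik, hB, if_pos rfl]
    · rfl
  · simp only [layer_second h1 h2, layer_single g.1 g.2]
    have := i.2
    have hik : i ≠ k := fun he => by rw [Fin.ext_iff] at he; omega
    rw [sum_pair_mul_conj_single (fun he => by rw [Fin.ext_iff] at he; omega) hik, if_neg hik]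
  · simp only [layer_single h.1 h.2, layer_first g1 g2]
    have := k'.2
    have hik : k ≠ i := fun he => by rw [Fin.ext_iff] at he; omega
    rw [hconj, sum_pair_mul_conj_single hik (fun he => by rw [Fin.ext_iff] at he; omega),
      if_neg hik.symm, map_zero]
  · simp only [layer_single h.1 h.2, layer_second g1 g2]
    have := k.2
    have hik : k ≠ i := fun he => by rw [Fin.ext_iff] at he; omega
    rw [hconj, sum_pair_mul_conj_single (fun he => by rw [Fin.ext_iff] at he; omega) hik,
      if_neg hik.symm, map_zero]
  · simp only [layer_single h.1 h.2, layer_single g.1 g.2]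
    simp [apply_ite (starRingEnd ℂ), eq_comm]

theorem layer_eq_zero {i j : Fin m} (h : layer m p ψ i j ≠ 0) :
    (i : ℕ) ≤ j + 1 ∧ (j : ℕ) ≤ i + 1 := by
  contrapose! h
  simp only [layer, Fin.ext_iff]
  split_ifs <;> first | omega | rfl

theorem layer_zero_eq_zero {i j : Fin m} (h : layer m 0 ψ i j ≠ 0) :
    (j : ℕ) - j % 2 ≤ i ∧ (i : ℕ) ≤ j - j % 2 + 1 := by
  contrapose! h
  simp only [layer, Fin.ext_iff]
  split_ifs <;> first | omega | rfl

end Layer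

theorem circuit_mem_unitaryGroup (m : ℕ) (Ψ : ℕ → LayerAngles) (D : ℕ) :
    circuit m Ψ D ∈ Matrix.unitaryGroup (Fin m) ℂ := by
  induction D with
  | zero => exact one_mem _
  | succ D ih => exact mul_mem (layer_mem_unitaryGroup _ _ _) ih

/-- The first layer confines mode `j` to its pair, which starts at `j - j % 2`; each of the `D`
further layers moves by at most one. Using the pair instead of `j ± 1` saves the one row needed for
the bound `2D`. -/
theorem circuit_light_cone {m : ℕ} {Ψ : ℕ → LayerAngles} {D : ℕ} {i j : Fin m}
    (h : circuit m Ψ (D + 1) i j ≠ 0) :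
    (j : ℕ) - j % 2 ≤ i + D ∧ (i : ℕ) ≤ j - j % 2 + 1 + D := by
  induction D generalizing i with
  | zero =>
    rw [circuit, circuit, mul_one] at h
    exact layer_zero_eq_zero h
  | succ D ih =>
    rw [circuit, Matrix.mul_apply] at h
    obtain ⟨k, -, hk⟩ := exists_ne_zero_of_sum_ne_zero h
    have h1 := layer_eq_zero (left_ne_zero_of_mul hk)
    have h2 := ih (right_ne_zero_of_mul hk)
    omega

/-! ### The tree decomposition into light cones -/

theorem pathGraph_induce_connected {m : ℕ} {S : Set (Fin m)} (hS : S.OrdConnected)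
    (hne : S.Nonempty) : ((SimpleGraph.pathGraph m).induce S).Connected := by
  have key : ∀ (k : ℕ) (a b : S), ((b : Fin m) : ℕ) = (a : Fin m) + k →
      ((SimpleGraph.pathGraph m).induce S).Reachable a b := by
    intro k
    induction k with
    | zero =>
      intro a b hab
      rw [show a = b from Subtype.ext (Fin.ext hab.symm)]
    | succ k ih =>
      intro a b hab
      have hlt : ((a : Fin m) : ℕ) + k < m := by have := (b : Fin m).2; omega
      have hc : (⟨(a : Fin m) + k, hlt⟩ : Fin m) ∈ S := hS.out a.2 b.2
        ⟨by rw [Fin.le_def]; simp, by rw [Fin.le_def]; dsimp only; omega⟩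
      refine (ih a ⟨_, hc⟩ rfl).trans (SimpleGraph.Adj.reachable ?_)
      rw [SimpleGraph.comap_adj, SimpleGraph.pathGraph_adj]
      left
      simp only [Function.Embedding.subtype_apply]
      omega
  have := hne.to_subtype
  refine ⟨fun a b => ?_⟩
  rcases le_total ((a : Fin m) : ℕ) (b : Fin m) with h | h
  · exact key ((b : Fin m) - (a : Fin m)) a b (by omega)
  · exact (key ((a : Fin m) - (b : Fin m)) b a (by omega)).symm

/-- Every edge is a bridge: once the edge from `v` to `v + 1` is deleted, a walk cannot leave the
nodes up to `v`. -/
theorem pathGraph_isTree {m : ℕ} (hm : 1 ≤ m) : (SimpleGraph.pathGraph m).IsTree := by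
  have : Nonempty (Fin m) := ⟨⟨0, hm⟩⟩
  refine ⟨⟨SimpleGraph.pathGraph_preconnected m⟩, ?_⟩
  have key : ∀ v w : Fin m, (v : ℕ) + 1 = w →
      ¬ ((SimpleGraph.pathGraph m).deleteEdges {s(v, w)}).Reachable v w := by
    rintro v w hvw ⟨q⟩
    have hind : ∀ a b : Fin m, ((SimpleGraph.pathGraph m).deleteEdges {s(v, w)}).Walk a b →
        a ≤ v → b ≤ v := by
      intro a b q
      induction q with
      | nil => exact id
      | @cons x y z hxy _ ih =>
        intro hx
        refine ih ?_
        simp only [SimpleGraph.deleteEdges_adj, SimpleGraph.pathGraph_adj, Set.mem_singleton_iff,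
          Sym2.eq_iff, Fin.ext_iff] at hxy
        rw [Fin.le_def] at hx ⊢
        omega
    have := hind v w q le_rfl
    rw [Fin.le_def] at this
    omega
  rw [SimpleGraph.isAcyclic_iff_forall_adj_isBridge]
  intro v w hvw
  rw [SimpleGraph.isBridge_iff]
  rcases SimpleGraph.pathGraph_adj.1 hvw with h | h
  · exact key v w h
  · rw [SimpleGraph.reachable_comm, Sym2.eq_swap]
    exact key w v h

/-- The light cones of the modes form a linear tree decomposition. -/
def lightCones {m D : ℕ} (Ψ : ℕ → LayerAngles) (hm : 1 ≤ m) (hD : 1 ≤ D) :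
    TreeDecomposition (circuit m Ψ D) (Fin m) where
  tree := SimpleGraph.pathGraph m
  isTree := pathGraph_isTree hm
  root := ⟨0, hm⟩
  rho j := {i | (j : ℕ) - j % 2 + 1 ≤ i + D ∧ (i : ℕ) ≤ j - j % 2 + D}
  kappa j := {j}
  rows_covered r := ⟨r, by simp; omega⟩
  cols_covered j := ⟨j, by simp⟩
  edges_covered r j h := by
    obtain ⟨D, rfl⟩ := Nat.exists_eq_add_of_le' hD
    have := circuit_light_cone h
    refine ⟨j, ?_, by simp⟩
    simp
    omega
  -- The start `j - j % 2` of the pair is monotone in `j`, so the modes whose cone contains `r` form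
  -- an interval.
  rows_connected r := by
    refine pathGraph_induce_connected ⟨fun a ha b hb t ht => ?_⟩ ⟨r, ?_⟩
    · have h1 := Fin.le_def.1 ht.1
      have h2 := Fin.le_def.1 ht.2
      simp only [mem_filter, mem_univ, true_and, Set.mem_ofPred_eq] at ha hb ⊢
      omega
    · simp; omega
  cols_connected j := by
    refine pathGraph_induce_connected ⟨fun a ha b hb t ht => ?_⟩ ⟨j, by simp⟩
    simp only [mem_singleton, Set.mem_ofPred_eq] at ha hb ⊢
    subst ha hb
    exact le_antisymm ht.1 ht.2

theorem lightCones_isLinear {m D : ℕ} (Ψ : ℕ → LayerAngles) (hm : 1 ≤ m) (hD : 1 ≤ D) :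
    (lightCones Ψ hm hD).IsLinear := ⟨rfl, rfl, fun _ => rfl⟩

theorem lightCones_treewidth_le {m D : ℕ} (Ψ : ℕ → LayerAngles) (hm : 1 ≤ m) (hD : 1 ≤ D) :
    (lightCones Ψ hm hD).treewidth ≤ 2 * D := by
  rw [TreeDecomposition.treewidth, Nat.sub_le_iff_le_add]
  refine Finset.sup_le fun j _ => ?_
  have h1 : #((lightCones Ψ hm hD).kappa j) = 1 := rfl
  rw [h1, add_le_add_iff_right, ← card_map Fin.valEmbedding]
  calc _ ≤ #(Ico ((j : ℕ) - j % 2 + 1 - D) ((j : ℕ) - j % 2 + 1 + D)) := by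
        refine card_le_card fun i hi => ?_
        obtain ⟨r, hr, rfl⟩ := mem_map.1 hi
        simp only [lightCones, mem_filter, mem_univ, true_and] at hr
        simp only [Fin.valEmbedding_apply, mem_Ico]
        omega
    _ ≤ 2 * D := by rw [Nat.card_Ico]; omega

/-! ### The sampler for circuits -/

/-- Write the interval of the rows in the light cone of the mode of photon `l` (register `10`). -/
def coneProg : Program :=
  .setReg 12 (.add (.half (.read 0 (.reg 10) (.const 0))) (.half (.read 0 (.reg 10) (.const 0)))) ;;
  .setReg 13 (.sub (.add (.reg 12) (.const 1)) (.reg 2)) ;;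
  .setReg 14 (.add (.add (.reg 12) (.const 1)) (.reg 2)) ;;
  .setReg 14 (.sub (.sub (.reg 14) (.sub (.reg 14) (.reg 1))) (.reg 13)) ;;
  .setNat 1 (.reg 10) (.const 0) (.reg 14)

/-- Write the light cones of all occupied modes. -/
def conesProg : Program :=
  .loop 10 (.reg 0)
    (coneProg ;; .loop 11 (.reg 14) (.setNat 2 (.reg 10) (.reg 11) (.add (.reg 13) (.reg 11))))

/-- The rows in the light cone of the mode `j`. -/
def coneRows (m D j : ℕ) : List ℕ :=
  List.range' (j - j % 2 + 1 - D) (min (j - j % 2 + 1 + D) m - (j - j % 2 + 1 - D))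

theorem coneRows_length (m D j : ℕ) :
    (coneRows m D j).length = min (j - j % 2 + 1 + D) m - (j - j % 2 + 1 - D) :=
  List.length_range'

theorem coneRows_getD {m D j q : ℕ} (hq : q < (coneRows m D j).length) :
    (coneRows m D j).getD q 0 = j - j % 2 + 1 - D + q := by
  rw [coneRows_length] at hq
  rw [coneRows, List.getD_eq_getElem?_getD, List.getElem?_range' hq, one_mul, Option.getD_some]

theorem mem_coneRows {m D : ℕ} (Ψ : ℕ → LayerAngles) (hm : 1 ≤ m) (hD : 1 ≤ D) (j : Fin m) (i : ℕ) :
    i ∈ coneRows m D j ↔ ∃ r ∈ (lightCones Ψ hm hD).rho j, (r : ℕ) = i := by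
  have hj := j.2
  simp only [coneRows, List.mem_range'_1, lightCones, mem_filter, mem_univ, true_and]
  constructor
  · intro h
    exact ⟨⟨i, by omega⟩, by dsimp only; omega, rfl⟩
  · rintro ⟨r, h, rfl⟩
    have := r.2
    omega

section Cones

variable {m n D : ℕ} {U : Matrix (Fin m) (Fin m) ℂ} {c : Fin n → Fin m}

/-- The light cones of the modes `c`. -/
def coneList (D : ℕ) (c : Fin n → Fin m) (l : ℕ) : List ℕ :=
  if h : l < n then coneRows m D (c ⟨l, h⟩) else []

/-- Halving and doubling rounds `j` down to an even number, and `y - (y - m)` with truncated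
subtraction is the minimum of `y` and `m`. -/
theorem coneProg_run {s : State} {l j : ℕ} (h0 : s.reg 10 = l) (h1 : s.reg 1 = m) (h2 : s.reg 2 = D)
    (hj : s.nat 0 l 0 = j) : ∃ x : ℕ, coneProg.run s =
      ((((s.setReg 12 (j - j % 2)).setReg 13 (j - j % 2 + 1 - D)).setReg 14 x).setReg 14
        (coneRows m D j).length).setNat 1 l 0 (coneRows m D j).length := by
  have he : j / 2 + j / 2 = j - j % 2 := by omega
  refine ⟨j - j % 2 + 1 + D, ?_⟩
  have hlen : (coneRows m D j).length =
      j - j % 2 + 1 + D - (j - j % 2 + 1 + D - m) - (j - j % 2 + 1 - D) := by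
    rw [coneRows_length]; omega
  rw [hlen]
  simp [coneProg, Program.run, NatExp.eval, State.setReg, h0, h1, h2, hj, he]

theorem conesProg_hoare {ω : ℕ} (hω : ∀ l < n, (coneList D c l).length ≤ ω) :
    Hoare conesProg (circuitInput D U c) (n * (7 * ω + 50) + 2)
      (HoldsRows m n (amp U c) (coneList D c)) := by
  refine Hoare.mono (Hoare.loop (t := 7 * ω + 49) (fun k s' => ∀ l < k,
    s'.nat 1 l 0 = (coneList D c l).length ∧
    ∀ q < (coneList D c l).length, s'.nat 2 l q = (coneList D c l).getD q 0) n rfl (by simp) ?_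
    (by simp only [NatExp.cost]; grind)) le_rfl ?_
  · intro k hk s hs hfr
    have hlist : coneList D c k = coneRows m D (c ⟨k, hk⟩) := by rw [coneList, dif_pos hk]
    set j := (c ⟨k, hk⟩ : ℕ) with hj
    refine Hoare.seq (t₁ := 40) (t₂ := 7 * ω + 9) (Hoare.block (Q := fun s' => s'.reg 10 = k ∧
      s'.reg 13 = j - j % 2 + 1 - D ∧ s'.reg 14 = (coneRows m D j).length ∧
      s'.nat 1 = ((s.setReg 10 k).setNat 1 k 0 (coneRows m D j).length).nat 1 ∧
      s'.nat 2 = s.nat 2) rfl (by decide) ?_) ?_ (by omega)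
    · have h1 : (s.setReg 10 k).reg 1 = m := by
        show s.reg 1 = m
        rw [hfr.reg 1 rfl]; rfl
      have h2 : (s.setReg 10 k).reg 2 = D := by
        show s.reg 2 = D
        rw [hfr.reg 2 rfl]; rfl
      have h3 : (s.setReg 10 k).nat 0 k 0 = j := by
        show s.nat 0 k 0 = j
        rw [hfr.nat 0 rfl]
        simp [circuitInput, hk, hj]
      obtain ⟨x, hx⟩ := coneProg_run (by simp [State.setReg]) h1 h2 h3
      rw [hx]
      refine ⟨?_, ?_, ?_, ?_, ?_⟩ <;> simp [State.setReg, State.setNat]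
    · rintro s₁ ⟨g10, g13, g14, g1, g2⟩ -
      refine Hoare.mono (Hoare.loop (t := 6) (fun q s' =>
        (∀ q' < q, s'.nat 2 k q' = (coneRows m D j).getD q' 0) ∧
        ∀ l < k, ∀ q', s'.nat 2 l q' = s.nat 2 l q') (coneRows m D j).length g14
        ⟨by simp, fun l _ q' => by rw [g2]⟩ ?_ (t' := 7 * ω + 9) ?_) le_rfl ?_
      · rintro q hq s₂ ⟨e1, e2⟩ hfr₂
        have k10 : s₂.reg 10 = k := by rw [hfr₂.reg 10 rfl, g10]
        have k13 : s₂.reg 13 = j - j % 2 + 1 - D := by rw [hfr₂.reg 13 rfl, g13]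
        refine Hoare.block rfl (by decide) ⟨fun q' hq' => ?_, fun l hl q' => ?_⟩
        · rcases Nat.lt_succ_iff_lt_or_eq.1 hq' with h | rfl
          · simpa [Program.run, NatExp.eval, State.setReg, State.setNat, k10, h.ne] using e1 q' h
          · rw [coneRows_getD hq]
            simp [Program.run, NatExp.eval, State.setReg, State.setNat, k10, k13]
        · simpa [Program.run, NatExp.eval, State.setReg, State.setNat, k10, hl.ne] using e2 l hl q'
      · have := hω k hk
        rw [hlist] at this
        simp only [NatExp.cost]
        omega
      · rintro s₂ ⟨e1, e2⟩ hfr₂ l hl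
        have f1 : s₂.nat 1 = ((s.setReg 10 k).setNat 1 k 0 (coneRows m D j).length).nat 1 := by
          rw [hfr₂.nat 1 rfl, g1]
        rw [f1]
        rcases Nat.lt_succ_iff_lt_or_eq.1 hl with h | rfl
        · obtain ⟨a1, a2⟩ := hs l h
          refine ⟨?_, fun q hq => (e2 l h q).trans (a2 q hq)⟩
          simpa [State.setReg, State.setNat, h.ne] using a1
        · rw [hlist]
          exact ⟨by simp [State.setReg, State.setNat], e1⟩
  · intro s hs hfr
    constructor
    · rw [hfr.reg 0 rfl]; rfl
    · intro v h h'
      have e : conesProg.wReg v = false := by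
        interval_cases v <;> rfl
      rw [hfr.reg v e]
      have h0 : v ≠ 0 := by omega
      have h1 : v ≠ 1 := by omega
      have h2 : v ≠ 2 := by omega
      simp [circuitInput, h0, h1, h2]
    · exact fun l hl => (hs l hl).1
    · exact fun l hl => (hs l hl).2
    · intro a ha i j
      have h0 : a ≠ 0 := by omega
      have h1 : a ≠ 1 := by omega
      have h2 : a ≠ 2 := by omega
      rw [hfr.nat a (by simp [conesProg, coneProg, Program.wNat, h1, h2])]
      simp [circuitInput, h0]
    · intro a ha
      have h0 : a ≠ 0 := by omega
      rw [hfr.cpx a rfl]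
      funext i j
      simp [circuitInput, h0]
    · intro i hi l hl
      rw [hfr.cpx 0 rfl, hfr.nat 0 rfl]
      simp [circuitInput, amp, hi, hl]

/-- The sampler for circuits. -/
def circuitSampler : Program := conesProg ;; sampler

variable {Ψ : ℕ → LayerAngles}

theorem coneList_rowLists (hm : 1 ≤ m) (hD : 1 ≤ D) (hc : StrictMono c) :
    RowLists m n (lightCones Ψ hm hD).treewidth (amp (circuit m Ψ D) c) (coneList D c) := by
  refine (lightCones_isLinear Ψ hm hD).rowLists (circuit_mem_unitaryGroup m Ψ D) hc
    (fun l => ?_) fun l i => ?_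
  · rw [coneList, dif_pos l.2]
    exact List.nodup_range'
  · rw [coneList, dif_pos l.2, mem_coneRows Ψ hm hD]

theorem circuitInput_samples (hm : 1 ≤ m) (hD : 1 ≤ D) (hc : StrictMono c) :
    SamplesCollisionFree circuitSampler (circuitInput D (circuit m Ψ D) c) (circuit m Ψ D) c :=
  SamplesCollisionFree.seq (conesProg_hoare (coneList_rowLists (Ψ := Ψ) hm hD hc).length_le)
    fun _ hs => sampler_samples (coneList_rowLists hm hD hc) hs (amp_coe _ c) hc.injective

theorem circuitInput_runsInTime (hm : 1 ≤ m) (hD : 1 ≤ D) (hn : 1 ≤ n) (hc : StrictMono c) :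
    circuitSampler.RunsInTime (circuitInput D (circuit m Ψ D) c)
      (1100 * timeBound n (lightCones Ψ hm hD).treewidth) := by
  have hR := coneList_rowLists (Ψ := Ψ) hm hD hc
  have hω := (lightCones_isLinear Ψ hm hD).treewidth_pos (circuit_mem_unitaryGroup m Ψ D) (c ⟨0, hn⟩)
  intro x hx
  refine (Hoare.seq (conesProg_hoare hR.length_le) (fun _ hs _ => sampler_hoare hR hs) le_rfl
    x hx).2.trans ?_
  generalize (lightCones Ψ hm hD).treewidth = ω at hω
  have h1 := samplerTime_le hn hω
  have c0 : ω ^ 1 * n ^ 1 ≤ ω ^ 1 * n ^ 3 := by gcongr; norm_num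
  have b1 : ω ^ 0 * n ^ 1 ≤ ω ^ 1 * n ^ 3 := by gcongr <;> norm_num
  have b0 : ω ^ 0 * n ^ 0 ≤ ω ^ 1 * n ^ 3 := by gcongr <;> norm_num
  have h2 : n * (7 * ω + 50) + 2 =
      7 * (ω ^ 1 * n ^ 1) + 50 * (ω ^ 0 * n ^ 1) + 2 * (ω ^ 0 * n ^ 0) := by ring
  have h3 : ω ^ 1 * n ^ 3 ≤ timeBound n ω := by
    rw [timeBound, pow_one]
    exact Nat.le_add_left _ _
  omega

end Cones

/-! ### Polynomial time at logarithmic depth -/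

theorem timeBound_mono {n n' ω ω' : ℕ} (hn : n ≤ n') (hω : ω ≤ ω') :
    timeBound n ω ≤ timeBound n' ω' := by
  rw [timeBound, timeBound]
  gcongr
  norm_num

/-- Replacing the base `2` by `e` turns the exponential of the logarithm into a power of `m`. -/
theorem two_pow_le_of_le_log {m D K : ℕ} (hm : 1 ≤ m) (hD : (D : ℝ) ≤ K * Real.log m) :
    2 ^ (2 * D) ≤ m ^ (2 * K) := by
  have hm' : (0 : ℝ) < m := by exact_mod_cast hm
  have h2 : (2 : ℝ) ≤ Real.exp 1 := by
    have := Real.add_one_le_exp (1 : ℝ)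
    linarith
  have h : (2 : ℝ) ^ (2 * D) ≤ (m : ℝ) ^ (2 * K) := by
    calc (2 : ℝ) ^ (2 * D) ≤ Real.exp 1 ^ (2 * D) := by gcongr
      _ = Real.exp (2 * D) := by rw [← Real.exp_nat_mul]; push_cast; ring_nf
      _ ≤ Real.exp (2 * (K * Real.log m)) := by gcongr
      _ = (m : ℝ) ^ (2 * K) := by
        rw [← Real.exp_log (pow_pos hm' (2 * K)), Real.log_pow]
        push_cast
        ring_nf
  exact_mod_cast h

/-- Insert `n ≤ m`, `ω ≤ 2D`, `D ≤ K m` and `2 ^ (2D) ≤ m ^ (2K)` into the time bound, where `K` is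
`γ` rounded up to a natural number. -/
theorem circuitInput_runsInPolyTime (γ : ℝ) : ∃ p : Polynomial ℕ,
    ∀ (m D n : ℕ) (Ψ : ℕ → LayerAngles) (c : Fin n → Fin m),
      1 ≤ D → (D : ℝ) ≤ γ * Real.log m → 1 ≤ n → StrictMono c →
      circuitSampler.RunsInTime (circuitInput D (circuit m Ψ D) c) (p.eval m) := by
  set K := ⌈γ⌉₊ with hK
  refine ⟨1100 * (Polynomial.X ^ 2 * Polynomial.X ^ (2 * K) *
    (2 * (K : Polynomial ℕ) * Polynomial.X) ^ 2 +
    (2 * (K : Polynomial ℕ) * Polynomial.X) * Polynomial.X ^ 3), ?_⟩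
  intro m D n Ψ c hD hDm hn hc x hx
  have hm : 1 ≤ m := (c ⟨0, hn⟩).pos
  have hnm : n ≤ m := by simpa using Fintype.card_le_of_injective c hc.injective
  have hlog : 0 ≤ Real.log m := Real.log_natCast_nonneg m
  have hDK : (D : ℝ) ≤ K * Real.log m :=
    hDm.trans (mul_le_mul_of_nonneg_right (Nat.le_ceil γ) hlog)
  have hDm' : D ≤ K * m := by
    have h1 : (D : ℝ) ≤ K * m := hDK.trans (mul_le_mul_of_nonneg_left
      (Real.log_le_self (Nat.cast_nonneg m)) (Nat.cast_nonneg K))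
    exact_mod_cast h1
  refine (circuitInput_runsInTime hm hD hn hc x hx).trans ?_
  have h1 := timeBound_mono hnm (lightCones_treewidth_le Ψ hm hD)
  have h2 := two_pow_le_of_le_log hm hDK
  have h3 : 2 * D ≤ 2 * K * m := by rw [mul_assoc]; omega
  have h4 : timeBound m (2 * D) ≤ m ^ 2 * m ^ (2 * K) * (2 * K * m) ^ 2 + 2 * K * m * m ^ 3 := by
    rw [timeBound]
    gcongr
  simp only [Polynomial.eval_mul, Polynomial.eval_add, Polynomial.eval_pow, Polynomial.eval_X,
    Polynomial.eval_natCast, Polynomial.eval_ofNat]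
  exact Nat.mul_le_mul_left 1100 (h1.trans h4)

end BosonSampling

theorem mainTheorem1 :
    ∃ C : ℕ,
      -- a matrix that is given together with a linear tree decomposition
      (∃ A : BosonSampling.Program,
        ∀ (m n : ℕ) (U : Matrix (Fin m) (Fin m) ℂ)
          (T : BosonSampling.TreeDecomposition U (Fin m)) (c : Fin n → Fin m),
          U ∈ Matrix.unitaryGroup (Fin m) ℂ → T.IsLinear → 1 ≤ n → StrictMono c →
          BosonSampling.SamplesCollisionFree A (BosonSampling.treeInput U c T) U c ∧
          A.RunsInTime (BosonSampling.treeInput U c T)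
            (C * BosonSampling.timeBound n T.treewidth)) ∧
      -- a nearest-neighbour circuit of depth `D`
      (∃ A : BosonSampling.Program,
        (∀ (m D : ℕ) (Ψ : ℕ → BosonSampling.LayerAngles), 1 ≤ m → 1 ≤ D →
          ∃ T : BosonSampling.TreeDecomposition (BosonSampling.circuit m Ψ D) (Fin m),
            T.IsLinear ∧ T.treewidth ≤ 2 * D ∧
            ∀ (n : ℕ) (c : Fin n → Fin m), 1 ≤ n → StrictMono c →
              BosonSampling.SamplesCollisionFree A
                (BosonSampling.circuitInput D (BosonSampling.circuit m Ψ D) c)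
                (BosonSampling.circuit m Ψ D) c ∧
              A.RunsInTime (BosonSampling.circuitInput D (BosonSampling.circuit m Ψ D) c)
                (C * BosonSampling.timeBound n T.treewidth)) ∧
        -- polynomial time for depth `O(log m)`
        (∀ γ : ℝ, ∃ p : Polynomial ℕ,
          ∀ (m D n : ℕ) (Ψ : ℕ → BosonSampling.LayerAngles) (c : Fin n → Fin m),
            1 ≤ D → (D : ℝ) ≤ γ * Real.log m → 1 ≤ n → StrictMono c →
            A.RunsInTime (BosonSampling.circuitInput D (BosonSampling.circuit m Ψ D) c)
              (p.eval m))) := by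
  refine ⟨1100, ⟨BosonSampling.sampler, fun m n U T c hU hT hn hc =>
    ⟨BosonSampling.treeInput_samples hU hT hc, fun x hx => ?_⟩⟩,
    ⟨BosonSampling.circuitSampler, fun m D Ψ hm hD =>
      ⟨BosonSampling.lightCones Ψ hm hD, BosonSampling.lightCones_isLinear Ψ hm hD,
        BosonSampling.lightCones_treewidth_le Ψ hm hD, fun n c hn hc =>
        ⟨BosonSampling.circuitInput_samples hm hD hc,
          BosonSampling.circuitInput_runsInTime hm hD hn hc⟩⟩,
      BosonSampling.circuitInput_runsInPolyTime⟩⟩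
  exact (BosonSampling.treeInput_runsInTime hU hT hn hc x hx).trans
    (Nat.mul_le_mul_right _ (by norm_num))
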